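/- Let $N\ge 2$, let $k$ be a commutative ring, and let $q\in k$ be a primitive $N$-th root of $1$, i.e. $q^N=1$ and $q^l-1$ is a non-zero-divisor for $1\le l\le N-1$. An NDG $k$-module is a $\mathbb Z$-graded $k$-module with an endomorphism $d$ of degree $1$ such that $d^N=0$. An $N_qDG$ category $\mathcal A$ is a category whose morphism sets $\mathcal A(A,B)$ are NDG $k$-modules, with $k$-bilinear composition that is homogeneous of degree $0$ and satisfies $d(fg)=d(f)g+q^r f\,d(g)$ for $f$ of degree $r$. A right graded $\mathcal A$-module $X$ consists of graded $k$-modules $X(A)$ with associative unital $k$-bilinear products $X(A_1)\times\mathcal A(A_2,A_1)\to X(A_2)$, homogeneous of degree $0$; a right NDG $\mathcal A$-module is one for which each $X(A)$ is moreover an NDG $k$-module and $d(xf)=d(x)f+q^r x\,d(f)$ for $x$ of degree $r$. Let $\operatorname{Hom}^n_{\mathcal A}(X,Y)$ be the $k$-module of families $F_A:X(A)\to Y(A)$ of $k$-linear maps, homogeneous of degree $n$, with $F(xf)=F(x)f$. Let $\mathrm{Gr}^0(\mathcal A)$ be the category of right graded $\mathcal A$-modules with morphisms $\operatorname{Hom}^0_{\mathcal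 A}(X,Y)$, and let $\mathcal C_{Ndg}(\mathcal A)$ be the category of right NDG $\mathcal A$-modules, whose morphisms are the $F\in\operatorname{Hom}^0_{\mathcal A}(X,Y)$ commuting with $d$. The $N$-complex $\operatorname{Hom}^{\bullet q}_{\mathcal A}(X,Y)$ has components $\operatorname{Hom}^n_{\mathcal A}(X,Y)$ and differential $F\mapsto d_Y\circ F-q^n F\circ d_X$ in degree $n$. The homotopy category $\mathcal K_{Ndg}(\mathcal A)$ has the right NDG $\mathcal A$-modules as objects and $$\operatorname{Hom}_{\mathcal K_{Ndg}(\mathcal A)}(X,Y)=H^0_{(1)}\operatorname{Hom}^{\bullet q}_{\mathcal A}(X,Y)=\operatorname{Ker}\bigl(d:\operatorname{Hom}^0_{\mathcal A}\to\operatorname{Hom}^1_{\mathcal A}\bigr)\big/\operatorname{Im}\bigl(d^{N-1}:\operatorname{Hom}^{1-N}_{\mathcal A}\to\operatorname{Hom}^0_{\mathcal A}\bigr)$$ as morphisms, composed as maps. Let $\mathcal E_{\mathcal A}$ be the class of exact sequences $0\to X\to Y\to Z\to 0$ in $\mathcal C_{Ndg}(\mathcal A)$ that become split exact in $\mathrm{Gr}^0(\mathcal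 A)$ when the differentials are forgotten. Then, for every $N_qDG$ category $\mathcal A$: 1. $(\mathcal C_{Ndg}(\mathcal A),\mathcal E_{\mathcal A})$ is a Frobenius category: an exact category in the sense of Quillen with enough projectives and enough injectives, in which an object is projective if and only if it is injective. 2. The stable category of $(\mathcal C_{Ndg}(\mathcal A),\mathcal E_{\mathcal A})$, i.e. the quotient of $\mathcal C_{Ndg}(\mathcal A)$ by the morphisms that factor through a projective object, is the category $\mathcal K_{Ndg}(\mathcal A)$: there is an isomorphism of categories between them, compatible with the projections from $\mathcal C_{Ndg}(\mathcal A)$. 3. In particular $\mathcal K_{Ndg}(\mathcal A)$ is an algebraic triangulated category: it is a triangulated category with the standard structure of the stable category of $(\mathcal C_{Ndg}(\mathcal A),\mathcal E_{\mathcal A})$. That is, each sequence $0\to X\to Y\to Z\to 0$ in $\mathcal E_{\mathcal A}$ has a connecting morphism $Z\to X[1]$ in $\mathcal K_{Ndg}(\mathcal A)$, natural in the sequence and an isomorphism when $Y$ is injective, and the distinguished triangles are exactly those isomorphic to $X\to Y\to Z\to X[1]$ for a sequence in $\mathcal E_{\mathcal A}$. -/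

import Mathlib

open CategoryTheory CategoryTheory.Limits CategoryTheory.Pretriangulated

universe w₀ w₁ u w

namespace NDG

/-! ### Exact, Frobenius and stable categories -/

section Exact

universe v v' u'

variable {C : Type u} [Category.{v} C] [Preadditive C]

/-- `f` is an inflation: the first map of some conflation `X ⟶ Y ⟶ Z`. -/
def IsInflation (E : ObjectProperty (ShortComplex C)) {X Y : C} (f : X ⟶ Y) : Prop :=
  ∃ (Z : C) (g : Y ⟶ Z) (w : f ≫ g = 0), E (ShortComplex.mk f g w)

/-- `g` is a deflation: the second map of some conflation `X ⟶ Y ⟶ Z`. -/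
def IsDeflation (E : ObjectProperty (ShortComplex C)) {Y Z : C} (g : Y ⟶ Z) : Prop :=
  ∃ (X : C) (f : X ⟶ Y) (w : f ≫ g = 0), E (ShortComplex.mk f g w)

/-- `(C, E)` is an exact category in the sense of Quillen: `C` is additive, and `E` is a class of
kernel-cokernel pairs (the conflations), closed under isomorphisms, satisfying the usual axioms. -/
structure IsExactCategory (E : ObjectProperty (ShortComplex C)) : Prop where
  additive : HasFiniteBiproducts C
  iso_closed : ∀ S S' : ShortComplex C, Nonempty (S ≅ S') → E S → E S'
  kernel : ∀ S : ShortComplex C, E S → Nonempty (IsLimit (KernelFork.ofι S.f S.zero))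
  cokernel : ∀ S : ShortComplex C, E S → Nonempty (IsColimit (CokernelCofork.ofπ S.g S.zero))
  id_inflation : ∀ X : C, IsInflation E (𝟙 X)
  id_deflation : ∀ X : C, IsDeflation E (𝟙 X)
  comp_inflation : ∀ {X Y Z : C} (f : X ⟶ Y) (g : Y ⟶ Z),
    IsInflation E f → IsInflation E g → IsInflation E (f ≫ g)
  comp_deflation : ∀ {X Y Z : C} (f : X ⟶ Y) (g : Y ⟶ Z),
    IsDeflation E f → IsDeflation E g → IsDeflation E (f ≫ g)
  pushout : ∀ {X Y X' : C} (f : X ⟶ Y) (a : X ⟶ X'), IsInflation E f →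
    ∃ (Y' : C) (b : Y ⟶ Y') (f' : X' ⟶ Y'), IsPushout f a b f' ∧ IsInflation E f'
  pullback : ∀ {Y Z Z' : C} (g : Y ⟶ Z) (c : Z' ⟶ Z), IsDeflation E g →
    ∃ (Y' : C) (b : Y' ⟶ Y) (g' : Y' ⟶ Z'), IsPullback b g' g c ∧ IsDeflation E g'

/-- `P` is projective relative to the conflations in `E`. -/
def IsProj (E : ObjectProperty (ShortComplex C)) (P : C) : Prop :=
  ∀ {Y Z : C} (g : Y ⟶ Z), IsDeflation E g → ∀ f : P ⟶ Z, ∃ f' : P ⟶ Y, f' ≫ g = f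

/-- `I` is injective relative to the conflations in `E`. -/
def IsInj (E : ObjectProperty (ShortComplex C)) (I : C) : Prop :=
  ∀ {X Y : C} (f : X ⟶ Y), IsInflation E f → ∀ g : X ⟶ I, ∃ g' : Y ⟶ I, f ≫ g' = g

/-- `(C, E)` is a Frobenius category: an exact category with enough projectives and enough
injectives in which the projective objects are exactly the injective objects. -/
structure IsFrobenius (E : ObjectProperty (ShortComplex C)) : Prop where
  exact : IsExactCategory E
  enough_proj : ∀ X : C, ∃ (P : C) (p : P ⟶ X), IsProj E P ∧ IsDeflation E p
  enough_inj : ∀ X : C, ∃ (I : C) (i : X ⟶ I), IsInj E I ∧ IsInflation E i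
  proj_iff_inj : ∀ X : C, IsProj E X ↔ IsInj E X

/-- Two parallel morphisms are stably equal if their difference factors through a projective. -/
def stableRel (E : ObjectProperty (ShortComplex C)) : HomRel C := fun X Y f g =>
  ∃ (P : C) (a : X ⟶ P) (b : P ⟶ Y), IsProj E P ∧ f - g = a ≫ b

/-- The stable category of `(C, E)`: the objects of `C`, and morphisms modulo those that factor
through a projective object. -/
abbrev StableCategory (E : ObjectProperty (ShortComplex C)) : Type u :=
  CategoryTheory.Quotient (stableRel E)

/-- The projection from `C` to its stable category. -/
abbrev stableProj (E : ObjectProperty (ShortComplex C)) : C ⥤ StableCategory E :=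
  CategoryTheory.Quotient.functor (stableRel E)

/-- Let `π : C ⥤ T` present `T` as the stable category of the Frobenius category `(C, E)`. The
(pre)triangulated structure of `T` is the standard one of a stable category if every conflation
`S : X ⟶ Y ⟶ Z` has a connecting morphism `δ S : π Z ⟶ (π X)⟦1⟧`, natural in `S`, which is an
isomorphism when `Y` is injective (so that the suspension of `X` is the cokernel of an inflation of
`X` into an injective object, and `δ S` is the morphism induced by extending `X ⟶ I` to `Y`), and
the distinguished triangles are the triangles isomorphic to `π X ⟶ π Y ⟶ π Z ⟶ (π X)⟦1⟧` for a
conflation `S`. -/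
def IsStableTriangulation (E : ObjectProperty (ShortComplex C))
    {T : Type u'} [Category.{v'} T] [Preadditive T] [HasZeroObject T] [HasShift T ℤ]
    [∀ n : ℤ, (shiftFunctor T n).Additive] [Pretriangulated T] (π : C ⥤ T) : Prop :=
  ∃ δ : ∀ S : ShortComplex C, E S → (π.obj S.X₃ ⟶ (π.obj S.X₁)⟦(1 : ℤ)⟧),
    (∀ (S S' : ShortComplex C) (hS : E S) (hS' : E S') (φ : S ⟶ S'),
      π.map φ.τ₃ ≫ δ S' hS' = δ S hS ≫ (π.map φ.τ₁)⟦(1 : ℤ)⟧') ∧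
    (∀ (S : ShortComplex C) (hS : E S), IsInj E S.X₂ → IsIso (δ S hS)) ∧
    (∀ D : Triangle T, D ∈ (distTriang T) ↔
      ∃ (S : ShortComplex C) (hS : E S),
        Nonempty (D ≅ Triangle.mk (π.map S.f) (π.map S.g) (δ S hS)))

end Exact

/-! ### Graded and `N`-differential graded modules over a commutative ring -/

/-- `q` is a primitive `N`-th root of `1`: `q ^ N = 1`, and `q ^ l - 1` is a non-zero-divisor for
`1 ≤ l ≤ N - 1`. (Such an element is a unit.) -/
def IsPrimitiveRootOfOne {k : Type w₀} [CommRing k] (q : kˣ) (N : ℕ) : Prop :=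
  (q : k) ^ N = 1 ∧ ∀ l : ℕ, 1 ≤ l → l < N → (q : k) ^ l - 1 ∈ nonZeroDivisors k

/-- A `ℤ`-graded `k`-module `∐ᵢ Uⁱ`; the submodule `deg i` is the component `Uⁱ`. -/
structure GrMod (k : Type w₀) [CommRing k] where
  carrier : Type w
  [addCommGroup : AddCommGroup carrier]
  [module : Module k carrier]
  deg : ℤ → Submodule k carrier
  isInternal : DirectSum.IsInternal deg

attribute [instance] GrMod.addCommGroup GrMod.module

instance (k : Type w₀) [CommRing k] : CoeSort (GrMod.{w₀, w} k) (Type w) := ⟨GrMod.carrier⟩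

/-- An `N`-differential graded `k`-module. -/
structure NDGMod (k : Type w₀) [CommRing k] (N : ℕ) extends GrMod.{w₀, w} k where
  d : carrier →ₗ[k] carrier
  d_mem : ∀ (i : ℤ) (x : carrier), x ∈ deg i → d x ∈ deg (i + 1)
  d_pow : d ^ N = 0

instance (k : Type w₀) [CommRing k] (N : ℕ) : CoeSort (NDGMod.{w₀, w} k N) (Type w) :=
  ⟨fun U => U.carrier⟩

/-! ### `N_qDG` categories -/

/-- An `N_qDG` category. The composite `f g` of `f : B ⟶ C` and `g : A ⟶ B` is `comp f g`. -/
structure NqDGCat (k : Type w₀) [CommRing k] (N : ℕ) (q : kˣ) where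
  Obj : Type u
  Hom : Obj → Obj → NDGMod.{w₀, w₁} k N
  one : ∀ A : Obj, Hom A A
  comp : ∀ {A B C : Obj}, Hom B C →ₗ[k] Hom A B →ₗ[k] Hom A C
  one_mem : ∀ A : Obj, one A ∈ (Hom A A).deg 0
  comp_mem : ∀ {A B C : Obj} (r s : ℤ) (f : Hom B C) (g : Hom A B),
    f ∈ (Hom B C).deg r → g ∈ (Hom A B).deg s → comp f g ∈ (Hom A C).deg (r + s)
  one_comp : ∀ {A B : Obj} (f : Hom A B), comp (one B) f = f
  comp_one : ∀ {A B : Obj} (f : Hom A B), comp f (one A) = f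
  assoc : ∀ {A B C D : Obj} (f : Hom C D) (g : Hom B C) (h : Hom A B),
    comp (comp f g) h = comp f (comp g h)
  leibniz : ∀ {A B C : Obj} (r : ℤ) (f : Hom B C) (g : Hom A B), f ∈ (Hom B C).deg r →
    (Hom A C).d (comp f g) =
      comp ((Hom B C).d f) g + ((q ^ r : kˣ) : k) • comp f ((Hom A B).d g)

section Modules

variable {k : Type w₀} [CommRing k] {N : ℕ} {q : kˣ}

/-- A right graded module over an `N_qDG` category; `act x f` is the product `x f`. -/
structure GrRightModule (𝒜 : NqDGCat.{w₀, w₁, u} k N q) where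
  obj : 𝒜.Obj → GrMod.{w₀, w} k
  act : ∀ {A₁ A₂ : 𝒜.Obj}, obj A₁ →ₗ[k] 𝒜.Hom A₂ A₁ →ₗ[k] obj A₂
  act_mem : ∀ {A₁ A₂ : 𝒜.Obj} (r s : ℤ) (x : obj A₁) (f : 𝒜.Hom A₂ A₁),
    x ∈ (obj A₁).deg r → f ∈ (𝒜.Hom A₂ A₁).deg s → act x f ∈ (obj A₂).deg (r + s)
  act_one : ∀ {A : 𝒜.Obj} (x : obj A), act x (𝒜.one A) = x
  act_comp : ∀ {A₁ A₂ A₃ : 𝒜.Obj} (x : obj A₁) (f : 𝒜.Hom A₂ A₁) (g : 𝒜.Hom A₃ A₂),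
    act x (𝒜.comp f g) = act (act x f) g

/-- A right `NDG` module over an `N_qDG` category. -/
structure NDGRightModule (𝒜 : NqDGCat.{w₀, w₁, u} k N q) extends
    GrRightModule.{w₀, w₁, u, w} 𝒜 where
  d : ∀ A : 𝒜.Obj, obj A →ₗ[k] obj A
  d_mem : ∀ (A : 𝒜.Obj) (i : ℤ) (x : obj A), x ∈ (obj A).deg i → d A x ∈ (obj A).deg (i + 1)
  d_pow : ∀ A : 𝒜.Obj, d A ^ N = 0
  leibniz : ∀ {A₁ A₂ : 𝒜.Obj} (r : ℤ) (x : obj A₁) (f : 𝒜.Hom A₂ A₁), x ∈ (obj A₁).deg r →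
    d A₂ (act x f) = act (d A₁ x) f + ((q ^ r : kˣ) : k) • act x ((𝒜.Hom A₂ A₁).d f)

variable {𝒜 : NqDGCat.{w₀, w₁, u} k N q}

/-- Families of `k`-linear maps `X(A) → Y(A)`. -/
abbrev Fam (X Y : GrRightModule.{w₀, w₁, u, w} 𝒜) : Type (max u w) :=
  ∀ A : 𝒜.Obj, X.obj A →ₗ[k] Y.obj A

/-- `Hom_𝒜^n(X, Y)`: the homogeneous morphisms of degree `n` between right graded modules. -/
def grHom (X Y : GrRightModule.{w₀, w₁, u, w} 𝒜) (n : ℤ) : Submodule k (Fam X Y) where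
  carrier := {F |
    (∀ (A : 𝒜.Obj) (i j : ℤ), i + n = j → ∀ x ∈ (X.obj A).deg i, F A x ∈ (Y.obj A).deg j) ∧
    (∀ (A₁ A₂ : 𝒜.Obj) (x : X.obj A₁) (f : 𝒜.Hom A₂ A₁),
      F A₂ (X.act x f) = Y.act (F A₁ x) f)}
  add_mem' := by
    rintro F G ⟨hF, hF'⟩ ⟨hG, hG'⟩
    refine ⟨fun A i j h x hx => add_mem (hF A i j h x hx) (hG A i j h x hx), fun A₁ A₂ x f => ?_⟩
    simp [hF', hG']
  zero_mem' := ⟨fun A i j h x hx => zero_mem _, fun A₁ A₂ x f => by simp⟩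
  smul_mem' := by
    rintro c F ⟨hF, hF'⟩
    refine ⟨fun A i j h x hx => Submodule.smul_mem _ c (hF A i j h x hx), fun A₁ A₂ x f => ?_⟩
    simp [hF']

theorem grHom_id (X : GrRightModule.{w₀, w₁, u, w} 𝒜) :
    (fun A => LinearMap.id : Fam X X) ∈ grHom X X 0 :=
  ⟨fun A i j h x hx => by obtain rfl : i = j := by omega
                          exact hx, fun A₁ A₂ x f => rfl⟩

theorem grHom_comp {X Y Z : GrRightModule.{w₀, w₁, u, w} 𝒜} {m n l : ℤ} (h : m + n = l)
    {F : Fam X Y} {G : Fam Y Z} (hF : F ∈ grHom X Y m) (hG : G ∈ grHom Y Z n) :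
    (fun A => G A ∘ₗ F A : Fam X Z) ∈ grHom X Z l :=
  ⟨fun A i j hij x hx => hG.1 A (i + m) j (by omega) _ (hF.1 A i _ rfl x hx),
    fun A₁ A₂ x f => by simp [hF.2, hG.2]⟩

/-- The category `Gr⁰(𝒜)` of right graded `𝒜`-modules and homogeneous morphisms of degree `0`. -/
instance : Category (GrRightModule.{w₀, w₁, u, w} 𝒜) where
  Hom X Y := grHom X Y 0
  id X := ⟨fun _ => LinearMap.id, grHom_id X⟩
  comp F G := ⟨fun A => G.1 A ∘ₗ F.1 A, grHom_comp (add_zero 0) F.2 G.2⟩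

instance : Preadditive (GrRightModule.{w₀, w₁, u, w} 𝒜) where
  homGroup X Y := inferInstanceAs (AddCommGroup (grHom X Y 0))
  add_comp X Y Z F F' G := Subtype.ext (funext fun A => LinearMap.comp_add (F.1 A) (F'.1 A) (G.1 A))
  comp_add X Y Z F G G' := Subtype.ext (funext fun A => LinearMap.add_comp (F.1 A) (G'.1 A) (G.1 A))

/-- The morphisms in `C_Ndg(𝒜)`: homogeneous morphisms of degree `0` that commute with `d`. -/
def chainHom (X Y : NDGRightModule.{w₀, w₁, u, w} 𝒜) :
    Submodule k (Fam X.toGrRightModule Y.toGrRightModule) where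
  carrier := {F | F ∈ grHom X.toGrRightModule Y.toGrRightModule 0 ∧
    ∀ A : 𝒜.Obj, F A ∘ₗ X.d A = Y.d A ∘ₗ F A}
  add_mem' := by
    rintro F G ⟨hF, hF'⟩ ⟨hG, hG'⟩
    exact ⟨add_mem hF hG, fun A => by
      simp [LinearMap.add_comp, LinearMap.comp_add, hF' A, hG' A]⟩
  zero_mem' := ⟨zero_mem _, fun A => by simp⟩
  smul_mem' := by
    rintro c F ⟨hF, hF'⟩
    exact ⟨Submodule.smul_mem _ c hF, fun A => by
      simp [LinearMap.smul_comp, LinearMap.comp_smul, hF' A]⟩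

theorem chainHom_comp {X Y Z : NDGRightModule.{w₀, w₁, u, w} 𝒜}
    {F : Fam X.toGrRightModule Y.toGrRightModule} {G : Fam Y.toGrRightModule Z.toGrRightModule}
    (hF : F ∈ chainHom X Y) (hG : G ∈ chainHom Y Z) :
    (fun A => G A ∘ₗ F A : Fam X.toGrRightModule Z.toGrRightModule) ∈ chainHom X Z :=
  ⟨grHom_comp (add_zero 0) hF.1 hG.1, fun A => by
    rw [LinearMap.comp_assoc, hF.2 A, ← LinearMap.comp_assoc, hG.2 A, LinearMap.comp_assoc]⟩

/-- The category `C_Ndg(𝒜)` of right `NDG` `𝒜`-modules. -/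
instance : Category (NDGRightModule.{w₀, w₁, u, w} 𝒜) where
  Hom X Y := chainHom X Y
  id X := ⟨fun _ => LinearMap.id, grHom_id X.toGrRightModule, fun _ => rfl⟩
  comp F G := ⟨fun A => G.1 A ∘ₗ F.1 A, chainHom_comp F.2 G.2⟩

instance : Preadditive (NDGRightModule.{w₀, w₁, u, w} 𝒜) where
  homGroup X Y := inferInstanceAs (AddCommGroup (chainHom X Y))
  add_comp X Y Z F F' G := Subtype.ext (funext fun A => LinearMap.comp_add (F.1 A) (F'.1 A) (G.1 A))
  comp_add X Y Z F G G' := Subtype.ext (funext fun A => LinearMap.add_comp (F.1 A) (G'.1 A) (G.1 A))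

variable (𝒜) in
/-- The functor `U₀ : C_Ndg(𝒜) ⥤ Gr⁰(𝒜)` that forgets the differentials. -/
def forgetD : NDGRightModule.{w₀, w₁, u, w} 𝒜 ⥤ GrRightModule.{w₀, w₁, u, w} 𝒜 where
  obj X := X.toGrRightModule
  map F := ⟨F.1, F.2.1⟩

instance : (forgetD.{w₀, w₁, u, w} 𝒜).Additive where
  map_add := rfl

variable (𝒜) in
/-- The class `ℰ_𝒜`: the short exact sequences `0 → X → Y → Z → 0` of right `NDG` modules (exact as
sequences of `k`-modules) which become split exact in `Gr⁰(𝒜)`. -/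
def degreewiseSplit : ObjectProperty (ShortComplex (NDGRightModule.{w₀, w₁, u, w} 𝒜)) := fun S =>
  (∀ A : 𝒜.Obj, Function.Injective (S.f.1 A) ∧ Function.Exact (S.f.1 A) (S.g.1 A) ∧
    Function.Surjective (S.g.1 A)) ∧
  Nonempty (S.map (forgetD 𝒜)).Splitting

/-! ### The Hom `N`-complex and the homotopy category -/

/-- The differential of `Hom^{•q}_𝒜(X, Y)` in degree `i`: `F ↦ d_Y ∘ F - q ^ i • F ∘ d_X`. It is
written on all families of linear maps, and maps `Hom_𝒜^i(X, Y)` to `Hom_𝒜^{i+1}(X, Y)`. -/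
def homD (X Y : NDGRightModule.{w₀, w₁, u, w} 𝒜) (i : ℤ) :
    Fam X.toGrRightModule Y.toGrRightModule →ₗ[k] Fam X.toGrRightModule Y.toGrRightModule where
  toFun F A := Y.d A ∘ₗ F A - ((q ^ i : kˣ) : k) • (F A ∘ₗ X.d A)
  map_add' F G := by
    funext A
    simp only [Pi.add_apply, LinearMap.comp_add, LinearMap.add_comp, smul_add]
    abel
  map_smul' c F := by
    funext A
    simp only [Pi.smul_apply, LinearMap.comp_smul, LinearMap.smul_comp, smul_sub, RingHom.id_apply]
    rw [smul_comm]

/-- The `r`-fold differential of `Hom^{•q}_𝒜(X, Y)` from degree `i` to degree `i + r`. -/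
def homDPow (X Y : NDGRightModule.{w₀, w₁, u, w} 𝒜) : ℕ → ℤ →
    (Fam X.toGrRightModule Y.toGrRightModule →ₗ[k] Fam X.toGrRightModule Y.toGrRightModule)
  | 0, _ => LinearMap.id
  | r + 1, i => homDPow X Y r (i + 1) ∘ₗ homD X Y i

/-- `Z^i_(r) Hom^{•q}_𝒜(X, Y)`, the kernel of the `r`-fold differential on `Hom_𝒜^i(X, Y)`. -/
def homZ (X Y : NDGRightModule.{w₀, w₁, u, w} 𝒜) (r : ℕ) (i : ℤ) :
    Submodule k (Fam X.toGrRightModule Y.toGrRightModule) :=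
  grHom X.toGrRightModule Y.toGrRightModule i ⊓ LinearMap.ker (homDPow X Y r i)

/-- `B^i_(r) Hom^{•q}_𝒜(X, Y)`, the image of the `r`-fold differential on `Hom_𝒜^{i-r}(X, Y)`. -/
def homB (X Y : NDGRightModule.{w₀, w₁, u, w} 𝒜) (r : ℕ) (i : ℤ) :
    Submodule k (Fam X.toGrRightModule Y.toGrRightModule) :=
  (grHom X.toGrRightModule Y.toGrRightModule (i - r)).map (homDPow X Y r (i - r))

/-- `H^i_(r) Hom^{•q}_𝒜(X, Y) = Z^i_(r) / B^i_(N-r)`. -/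
abbrev homH (X Y : NDGRightModule.{w₀, w₁, u, w} 𝒜) (r : ℕ) (i : ℤ) : Type (max u w) :=
  homZ X Y r i ⧸ (homB X Y (N - r) i).submoduleOf (homZ X Y r i)

/-- `Hom_{C_Ndg(𝒜)}(X, Y) = Z^0_(1) Hom^{•q}_𝒜(X, Y)`. -/
theorem mem_homZ_iff {X Y : NDGRightModule.{w₀, w₁, u, w} 𝒜}
    {F : Fam X.toGrRightModule Y.toGrRightModule} : F ∈ homZ X Y 1 0 ↔ F ∈ chainHom X Y := by
  refine and_congr Iff.rfl ?_
  change homD X Y 0 F = 0 ↔ _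
  rw [funext_iff]
  refine forall_congr' fun A => ?_
  simp only [homD, LinearMap.coe_mk, AddHom.coe_mk, zpow_zero, Units.val_one, one_smul,
    Pi.zero_apply, sub_eq_zero]
  exact eq_comm

theorem homDPow_comp_left {X Y Z : NDGRightModule.{w₀, w₁, u, w} 𝒜}
    {G : Fam Y.toGrRightModule Z.toGrRightModule} (hG : G ∈ chainHom Y Z) (r : ℕ) :
    ∀ (i : ℤ) (F : Fam X.toGrRightModule Y.toGrRightModule),
      homDPow X Z r i (fun A => G A ∘ₗ F A) = fun A => G A ∘ₗ homDPow X Y r i F A := by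
  induction r with
  | zero => intro i F; rfl
  | succ r ih =>
    intro i F
    have h : homD X Z i (fun A => G A ∘ₗ F A) = fun A => G A ∘ₗ homD X Y i F A := by
      funext A
      simp only [homD, LinearMap.coe_mk, AddHom.coe_mk, LinearMap.comp_sub, LinearMap.comp_smul]
      rw [← LinearMap.comp_assoc, ← hG.2 A, LinearMap.comp_assoc, LinearMap.comp_assoc]
    change homDPow X Z r (i + 1) (homD X Z i _) = _
    rw [h, ih]
    rfl

theorem homDPow_comp_right {X Y Z : NDGRightModule.{w₀, w₁, u, w} 𝒜}
    {F : Fam X.toGrRightModule Y.toGrRightModule} (hF : F ∈ chainHom X Y) (r : ℕ) :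
    ∀ (i : ℤ) (G : Fam Y.toGrRightModule Z.toGrRightModule),
      homDPow X Z r i (fun A => G A ∘ₗ F A) = fun A => homDPow Y Z r i G A ∘ₗ F A := by
  induction r with
  | zero => intro i G; rfl
  | succ r ih =>
    intro i G
    have h : homD X Z i (fun A => G A ∘ₗ F A) = fun A => homD Y Z i G A ∘ₗ F A := by
      funext A
      simp only [homD, LinearMap.coe_mk, AddHom.coe_mk, LinearMap.sub_comp, LinearMap.smul_comp]
      rw [LinearMap.comp_assoc (X.d A), hF.2 A, LinearMap.comp_assoc, LinearMap.comp_assoc]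
    change homDPow X Z r (i + 1) (homD X Z i _) = _
    rw [h, ih]
    rfl

theorem homB_comp_left {X Y Z : NDGRightModule.{w₀, w₁, u, w} 𝒜} {r : ℕ}
    {F : Fam X.toGrRightModule Y.toGrRightModule} {G : Fam Y.toGrRightModule Z.toGrRightModule}
    (hF : F ∈ homB X Y r 0) (hG : G ∈ chainHom Y Z) :
    (fun A => G A ∘ₗ F A : Fam X.toGrRightModule Z.toGrRightModule) ∈ homB X Z r 0 := by
  obtain ⟨S, hS, rfl⟩ := hF
  exact ⟨fun A => G A ∘ₗ S A, grHom_comp (add_zero _) hS hG.1, homDPow_comp_left hG r _ S⟩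

theorem homB_comp_right {X Y Z : NDGRightModule.{w₀, w₁, u, w} 𝒜} {r : ℕ}
    {F : Fam X.toGrRightModule Y.toGrRightModule} {G : Fam Y.toGrRightModule Z.toGrRightModule}
    (hF : F ∈ chainHom X Y) (hG : G ∈ homB Y Z r 0) :
    (fun A => G A ∘ₗ F A : Fam X.toGrRightModule Z.toGrRightModule) ∈ homB X Z r 0 := by
  obtain ⟨S, hS, rfl⟩ := hG
  exact ⟨fun A => S A ∘ₗ F A, grHom_comp (zero_add _) hF.1 hS, homDPow_comp_right hF r _ S⟩

/-- Composition `Z^0_(1) × Z^0_(1) → Z^0_(1)`. -/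
def homZComp {X Y Z : NDGRightModule.{w₀, w₁, u, w} 𝒜} (F : homZ X Y 1 0) (G : homZ Y Z 1 0) :
    homZ X Z 1 0 :=
  ⟨fun A => G.1 A ∘ₗ F.1 A,
    mem_homZ_iff.2 (chainHom_comp (mem_homZ_iff.1 F.2) (mem_homZ_iff.1 G.2))⟩

/-- The composition induced on `H^0_(1)` by the composition of maps. -/
def homHComp {X Y Z : NDGRightModule.{w₀, w₁, u, w} 𝒜} :
    homH X Y 1 0 → homH Y Z 1 0 → homH X Z 1 0 :=
  Quotient.map₂ homZComp (by
    intro F F' hF G G' hG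
    have hF := (Submodule.quotientRel_def _).1 hF
    have hG := (Submodule.quotientRel_def _).1 hG
    refine (Submodule.quotientRel_def _).2 ?_
    have h := add_mem (homB_comp_left hF (mem_homZ_iff.1 G.2))
      (homB_comp_right (mem_homZ_iff.1 F'.2) hG)
    change _ ∈ homB X Z (N - 1) 0
    convert h using 1
    funext A
    ext x
    simp [homZComp])

variable (𝒜) in
/-- The objects of the homotopy category `K_Ndg(𝒜)`: the right `NDG` `𝒜`-modules. -/
structure KNdg where
  as : NDGRightModule.{w₀, w₁, u, w} 𝒜

/-- The homotopy category: `Hom(X, Y) = H^0_(1) Hom^{•q}_𝒜(X, Y)`. -/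
instance : Category (KNdg.{w₀, w₁, u, w} 𝒜) where
  Hom X Y := homH X.as Y.as 1 0
  id X := Submodule.Quotient.mk ⟨fun _ => LinearMap.id,
    mem_homZ_iff.2 ⟨grHom_id X.as.toGrRightModule, fun _ => rfl⟩⟩
  comp F G := homHComp F G
  id_comp := by rintro X Y ⟨F⟩; rfl
  comp_id := by rintro X Y ⟨F⟩; rfl
  assoc := by rintro W X Y Z ⟨F⟩ ⟨G⟩ ⟨H⟩; rfl

instance : Preadditive (KNdg.{w₀, w₁, u, w} 𝒜) where
  homGroup X Y := inferInstanceAs (AddCommGroup (homH X.as Y.as 1 0))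
  add_comp := by
    rintro X Y Z ⟨F⟩ ⟨F'⟩ ⟨G⟩
    exact congrArg Submodule.Quotient.mk
      (Subtype.ext (funext fun A => LinearMap.comp_add (F.1 A) (F'.1 A) (G.1 A)))
  comp_add := by
    rintro X Y Z ⟨F⟩ ⟨G⟩ ⟨G'⟩
    exact congrArg Submodule.Quotient.mk
      (Subtype.ext (funext fun A => LinearMap.add_comp (F.1 A) (G'.1 A) (G.1 A)))

variable (𝒜) in
/-- The projection `C_Ndg(𝒜) ⥤ K_Ndg(𝒜)`, sending a morphism to its class in `H^0_(1)`. -/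
def homotopyProj : NDGRightModule.{w₀, w₁, u, w} 𝒜 ⥤ KNdg.{w₀, w₁, u, w} 𝒜 where
  obj X := ⟨X⟩
  map F := Submodule.Quotient.mk ⟨F.1, mem_homZ_iff.2 F.2⟩

end Modules

end NDG

/-!
The statement has an abstract half, Happel's theorem that the stable category of a Frobenius
category is triangulated, and a concrete half, the Frobenius structure of `C_Ndg(𝒜)`.

For the abstract half, let `π : C ⥤ T` present `T` as the stable category of a Frobenius category
`(C, E)` (`PresentsStable`: `π` is additive, full, essentially surjective, and kills exactly the
morphisms that factor through a projective). To get a shift by all of `ℤ`, and not only a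
suspension that is an equivalence, one uses two-sided injective resolutions: sequences of
conflations `Xₙ ⟶ Iₙ ⟶ Xₙ₊₁` with `Iₙ` injective. With sequences of compatible morphisms of `T` as
morphisms, they form a category on which `ℤ` acts by translation, and evaluation at `0` is an
equivalence from it to `T` (`PresentsStable.isEquivalence_ev`), because in a Frobenius category a
stable morphism extends uniquely to the next, and to the previous, term of the resolutions.
Transporting the shift along this equivalence gives `PresentsStable.exists_shift`, where the
connecting morphism of a conflation `X ⟶ Y ⟶ Z` is the unique stable morphism `Z ⟶ X₁` that extends
the identity of `X`. The axioms of a triangulated category for the triangles of conflations rest on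
three facts: every stable morphism is isomorphic to the image of an inflation
(`PresentsStable.exists_inflation`), commutative squares of inflations in `T` lift to morphisms of
conflations (`PresentsStable.exists_hom_of_comm`), and pushouts of conflations are conflations. The
last one yields the rotation, through the conflation `X ⟶ Y ⊞ I ⟶ Q`, and the octahedron, through
the conflation formed by the cokernels of two composable inflations and of their composite.

For the concrete half, inflations (deflations) are the morphisms with a graded retraction
(section), which makes the exact structure evident. For each right `NDG` module `X` and each
integer `m` there is a cone, made of `N` translated copies of `X`. Morphisms from the cone to `Y`
correspond to the graded morphisms `X ⟶ Y` of degree `m` (restriction to the zeroth copy), and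
morphisms from `Y` to the cone to the graded morphisms `Y ⟶ X` of degree `-(m + N - 1)` (last
coordinate): the other components are forced to be iterated differentials in the Hom `N`-complex,
up to units, and the only condition is that the `N`-fold differential vanishes. Since graded
morphisms extend along graded split monomorphisms and lift along graded split epimorphisms, cones
are both projective and injective, and every `X` embeds into a cone and is a quotient of one. A
morphism `X ⟶ Y` that factors through the embedding of `X` in its cone is, by this description, an
`(N - 1)`-fold differential. This identifies the morphisms that are null-homotopic with those that
factor through a projective object (`NDGRightModule.mem_homB_iff`).

That the cone and the Hom complex have `N`-differentials is where `q` enters: both differentials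
are sums `a + b` with `b a = q a b` and `a ^ N = b ^ N = 0`, and the Gaussian binomial coefficients
`[N, j]` with `0 < j < N` vanish for a primitive `N`-th root of unity
(`add_pow_eq_zero_of_qCommute`).
-/

namespace NDG

/-! ### Consequences of the axioms of an exact category -/

section Exact

universe v v' u'

variable {C : Type u} [Category.{v} C] [Preadditive C] {E : ObjectProperty (ShortComplex C)}

namespace IsExactCategory

variable (hE : IsExactCategory E)

include hE

theorem mono_f {S : ShortComplex C} (hS : E S) : Mono S.f :=
  (hE.kernel S hS).elim fun h => mono_of_isLimit_fork h

theorem epi_g {S : ShortComplex C} (hS : E S) : Epi S.g :=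
  (hE.cokernel S hS).elim fun h => epi_of_isColimit_cofork h

theorem exists_desc {S : ShortComplex C} (hS : E S) {W : C} (u : S.X₂ ⟶ W) (h : S.f ≫ u = 0) :
    ∃ t : S.X₃ ⟶ W, S.g ≫ t = u := by
  obtain ⟨hc⟩ := hE.cokernel S hS
  obtain ⟨l, hl⟩ := CokernelCofork.IsColimit.desc' hc u h
  exact ⟨l, hl⟩

theorem exists_lift {S : ShortComplex C} (hS : E S) {W : C} (u : W ⟶ S.X₂) (h : u ≫ S.g = 0) :
    ∃ t : W ⟶ S.X₁, t ≫ S.f = u := by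
  obtain ⟨hc⟩ := hE.kernel S hS
  obtain ⟨l, hl⟩ := KernelFork.IsLimit.lift' hc u h
  exact ⟨l, hl⟩

/-- An inflation together with any of its cokernels is a conflation. -/
theorem conflation_of_cokernel {X Y Z : C} {f : X ⟶ Y} {g : Y ⟶ Z} (w : f ≫ g = 0)
    (hf : IsInflation E f) [Epi g]
    (h : ∀ {W : C} (u : Y ⟶ W), f ≫ u = 0 → ∃ t : Z ⟶ W, g ≫ t = u) :
    E (ShortComplex.mk f g w) := by
  obtain ⟨Z', g', w', hS⟩ := hf
  obtain ⟨a, ha⟩ := hE.exists_desc hS g w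
  obtain ⟨b, hb⟩ := h g' w'
  have : Epi g' := hE.epi_g hS
  dsimp at ha
  let e : Z' ≅ Z :=
    ⟨a, b, by rw [← cancel_epi g', reassoc_of% ha, hb, Category.comp_id],
      by rw [← cancel_epi g, reassoc_of% hb, ha, Category.comp_id]⟩
  exact hE.iso_closed _ (ShortComplex.mk f g w) ⟨ShortComplex.isoMk (Iso.refl X) (Iso.refl Y) e
    (by simp) (by simpa using ha.symm)⟩ hS

theorem inflation_of_iso {X Y X' Y' : C} {f : X ⟶ Y} {f' : X' ⟶ Y'} (hf : IsInflation E f)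
    (e : X ≅ X') (e' : Y ≅ Y') (h : f ≫ e'.hom = e.hom ≫ f') : IsInflation E f' := by
  obtain ⟨Z, g, w, hS⟩ := hf
  have w' : f' ≫ e'.inv ≫ g = 0 := by
    rw [← cancel_epi e.hom, ← reassoc_of% h, e'.hom_inv_id_assoc, w, comp_zero]
  exact ⟨Z, e'.inv ≫ g, w', hE.iso_closed _ (ShortComplex.mk f' (e'.inv ≫ g) w')
    ⟨ShortComplex.isoMk e e' (Iso.refl Z) (by simpa using h.symm) (by simp)⟩ hS⟩

theorem inflation_of_isPushout {X Y X' Y' : C} {f : X ⟶ Y} {a : X ⟶ X'} {b : Y ⟶ Y'}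
    {f' : X' ⟶ Y'} (h : IsPushout f a b f') (hf : IsInflation E f) : IsInflation E f' := by
  obtain ⟨Y'', b', f'', h', hf''⟩ := hE.pushout f a hf
  exact hE.inflation_of_iso hf'' (Iso.refl _) (h'.isoIsPushout _ _ h) (by simp)

/-- The pushout of a conflation along a morphism out of its first term is a conflation with the
same third term. -/
theorem conflation_of_isPushout {X Y Z X' Y' : C} {f : X ⟶ Y} {g : Y ⟶ Z} {w : f ≫ g = 0}
    (hS : E (ShortComplex.mk f g w)) {a : X ⟶ X'} {b : Y ⟶ Y'} {f' : X' ⟶ Y'}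
    (h : IsPushout f a b f') :
    ∃ (g' : Y' ⟶ Z) (w' : f' ≫ g' = 0), b ≫ g' = g ∧ E (ShortComplex.mk f' g' w') := by
  have hw : f ≫ g = a ≫ (0 : X' ⟶ Z) := by rw [w, comp_zero]
  have : Epi g := hE.epi_g hS
  have hb : b ≫ h.desc g 0 hw = g := h.inl_desc _ _ _
  have : Epi (h.desc g 0 hw) := by
    have : Epi (b ≫ h.desc g 0 hw) := by rwa [hb]
    exact epi_of_epi b _
  refine ⟨h.desc g 0 hw, h.inr_desc _ _ _, hb, hE.conflation_of_cokernel _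
    (hE.inflation_of_isPushout h ⟨Z, g, w, hS⟩) fun {W} u hu => ?_⟩
  obtain ⟨t, ht⟩ := hE.exists_desc hS (b ≫ u) (by
    dsimp only
    rw [← Category.assoc, h.w, Category.assoc, hu, comp_zero])
  refine ⟨t, h.hom_ext ?_ ?_⟩
  · rw [reassoc_of% hb]
    exact ht
  · rw [h.inr_desc_assoc, zero_comp, hu]

/-- If `f` is an inflation with cokernel `p` and `g` is an inflation, the map induced by `g` on the
cokernels of `f` and `f ≫ g` is the pushout of `g` along `p`. -/
theorem isPushout_cokernel {X Y Z Y₁ Z₁ : C} {f : X ⟶ Y} {p : Y ⟶ Y₁} {w : f ≫ p = 0}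
    (hS : E (ShortComplex.mk f p w)) {g : Y ⟶ Z} {r : Z ⟶ Z₁} {w' : (f ≫ g) ≫ r = 0}
    (hS' : E (ShortComplex.mk (f ≫ g) r w')) {a : Y₁ ⟶ Z₁} (ha : p ≫ a = g ≫ r) :
    IsPushout g p r a := by
  have : Epi p := hE.epi_g hS
  have : Epi r := hE.epi_g hS'
  have key : ∀ s : PushoutCocone g p, ∃ t : Z₁ ⟶ s.pt, r ≫ t = s.inl := fun s =>
    hE.exists_desc hS' s.inl (by
      dsimp only
      rw [Category.assoc, s.condition, reassoc_of% w, zero_comp])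
  choose t ht using key
  refine ⟨⟨ha.symm⟩, ⟨PushoutCocone.IsColimit.mk _ t ht (fun s => ?_) fun s m hm _ => ?_⟩⟩
  · rw [← cancel_epi p, reassoc_of% ha, ht, s.condition]
  · rw [← cancel_epi r, ht, hm]

/-- The coproduct inclusion `X ⟶ Y ⊞ X` is the pushout of `0 ⟶ Y` along `0 ⟶ X`. -/
theorem inflation_inr [HasBinaryBiproducts C] (X Y : C) :
    IsInflation E (biprod.inr : X ⟶ Y ⊞ X) := by
  -- The kernel `K` of `𝟙 Y` is a zero object, and `K ⟶ Y` is an inflation.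
  obtain ⟨K, f, w, hS⟩ := hE.id_deflation Y
  have : Mono f := hE.mono_f hS
  have hf : f = 0 := by simpa using w
  have hK : ∀ {W : C} (a b : K ⟶ W), a = b := fun a b => by
    have h0 : 𝟙 K = 0 := by rw [← cancel_mono f, hf, comp_zero, comp_zero]
    rw [← Category.id_comp a, ← Category.id_comp b, h0, zero_comp, zero_comp]
  refine hE.inflation_of_isPushout (f := f) (a := (0 : K ⟶ X)) (b := biprod.inl)
    ⟨⟨hK _ _⟩, ⟨PushoutCocone.IsColimit.mk _ (fun s => biprod.desc s.inl s.inr)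
      (fun s => by simp) (fun s => by simp) fun s m h₁ h₂ => ?_⟩⟩ ⟨Y, 𝟙 Y, w, hS⟩
  apply biprod.hom_ext'
  · simpa using h₁
  · simpa using h₂

/-- A morphism into a biproduct is an inflation as soon as its second component is one. -/
theorem inflation_lift [HasBinaryBiproducts C] {X Y I : C} (f : X ⟶ Y) {i : X ⟶ I}
    (hi : IsInflation E i) : IsInflation E (biprod.lift f i) := by
  have h₁ : IsInflation E (biprod.lift f (𝟙 X)) := by
    refine hE.inflation_of_iso (hE.inflation_inr X Y) (Iso.refl _)
      (⟨biprod.desc biprod.inl (biprod.lift f (𝟙 X)), biprod.desc biprod.inl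
        (biprod.lift (-f) (𝟙 X)), ?_, ?_⟩ : Y ⊞ X ≅ Y ⊞ X) (by simp)
    · ext <;> simp
    · ext <;> simp
  have h₂ : IsInflation E (biprod.map (𝟙 Y) i) := by
    refine hE.inflation_of_isPushout (f := i) (a := biprod.inr) (b := biprod.inr)
      ⟨⟨by simp⟩, ⟨PushoutCocone.IsColimit.mk _ (fun s => biprod.desc (biprod.inl ≫ s.inr) s.inl)
        (fun s => by simp) (fun s => ?_) fun s m h₁ h₂ => ?_⟩⟩ hi
    · apply biprod.hom_ext'
      · simp
      · simpa using s.condition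
    · apply biprod.hom_ext'
      · simp [← h₂]
      · simpa using h₁
  have : biprod.lift f i = biprod.lift f (𝟙 X) ≫ biprod.map (𝟙 Y) i := by
    ext <;> simp
  rw [this]
  exact hE.comp_inflation _ _ h₁ h₂

/-- A pushout square of an inflation `i` and a morphism `f`, read as a conflation
`X ⟶ Y ⊞ I ⟶ Q`. -/
theorem conflation_biprod [HasBinaryBiproducts C] {X Y I Q : C} {f : X ⟶ Y} {i : X ⟶ I}
    {j : Y ⟶ Q} {l : I ⟶ Q} (hi : IsInflation E i) (h : IsPushout f i j l) :
    ∃ w : biprod.lift f (-i) ≫ biprod.desc j l = 0,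
      E (ShortComplex.mk (biprod.lift f (-i)) (biprod.desc j l) w) := by
  have w : biprod.lift f (-i) ≫ biprod.desc j l = 0 := by simp [h.w]
  have : Epi (biprod.desc j l) := ⟨fun a b hab => h.hom_ext
    (by simpa using biprod.inl ≫= hab) (by simpa using biprod.inr ≫= hab)⟩
  have hi' : IsInflation E (-i) := hE.inflation_of_iso hi (Iso.refl _)
    (⟨-𝟙 I, -𝟙 I, by simp, by simp⟩ : I ≅ I) (by simp)
  refine ⟨w, hE.conflation_of_cokernel w (hE.inflation_lift f hi') fun {W} a ha => ?_⟩
  refine ⟨h.desc (biprod.inl ≫ a) (biprod.inr ≫ a) ?_, ?_⟩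
  · rw [biprod.lift_eq, Preadditive.add_comp] at ha
    simpa [add_neg_eq_zero] using ha
  · apply biprod.hom_ext' <;> simp

theorem conflation_id (X : C) : ∃ (Z : C) (g : X ⟶ Z) (w : 𝟙 X ≫ g = 0),
    E (ShortComplex.mk (𝟙 X) g w) ∧ IsZero Z := by
  obtain ⟨Z, g, w, hS⟩ := hE.id_inflation X
  have : Epi g := hE.epi_g hS
  have hg : g = 0 := by simpa using w
  refine ⟨Z, g, w, hS, (IsZero.iff_id_eq_zero Z).2 ?_⟩
  rw [← cancel_epi g, hg, zero_comp, zero_comp]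

end IsExactCategory

end Exact

/-! ### The suspension of the stable category -/

section Stable

universe v v' u'

variable {C : Type u} [Category.{v} C] [Preadditive C] {E : ObjectProperty (ShortComplex C)}
  {T : Type u'} [Category.{v'} T] {π : C ⥤ T}

/-- The morphisms `a` and `c` of `T` are the outer components of (the image of) a morphism of short
complexes `S ⟶ S'`. -/
def Extends (π : C ⥤ T) (S S' : ShortComplex C) (a : π.obj S.X₁ ⟶ π.obj S'.X₁)
    (c : π.obj S.X₃ ⟶ π.obj S'.X₃) : Prop :=
  ∃ φ : S ⟶ S', π.map φ.τ₁ = a ∧ π.map φ.τ₃ = c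

theorem Extends.id (π : C ⥤ T) (S : ShortComplex C) :
    Extends π S S (𝟙 (π.obj S.X₁)) (𝟙 (π.obj S.X₃)) := ⟨𝟙 S, by simp, by simp⟩

theorem Extends.comp {S S' S'' : ShortComplex C} {a : π.obj S.X₁ ⟶ π.obj S'.X₁}
    {c : π.obj S.X₃ ⟶ π.obj S'.X₃} {a' : π.obj S'.X₁ ⟶ π.obj S''.X₁}
    {c' : π.obj S'.X₃ ⟶ π.obj S''.X₃} (h : Extends π S S' a c) (h' : Extends π S' S'' a' c') :
    Extends π S S'' (a ≫ a') (c ≫ c') := by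
  obtain ⟨φ, rfl, rfl⟩ := h
  obtain ⟨ψ, rfl, rfl⟩ := h'
  exact ⟨φ ≫ ψ, by simp, by simp⟩

/-- A two-sided injective resolution in `(C, E)`: a sequence of objects `obj n` with conflations
`obj n ⟶ mid n ⟶ obj (n + 1)` whose middle terms are injective. The second morphism is indexed by
a proof of `i + 1 = j`, so that translation is possible without transport. -/
structure Resolution (E : ObjectProperty (ShortComplex C)) (π : C ⥤ T) where
  obj : ℤ → C
  mid : ℤ → C
  f : ∀ i, obj i ⟶ mid i
  g : ∀ i j, i + 1 = j → (mid i ⟶ obj j)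
  w : ∀ i j h, f i ≫ g i j h = 0
  conflation : ∀ i j h, E (ShortComplex.mk (f i) (g i j h) (w i j h))
  inj : ∀ i, IsInj E (mid i)

namespace Resolution

/-- The conflation `obj i ⟶ mid i ⟶ obj j`, for `j = i + 1`. -/
abbrev sc (X : Resolution E π) (i j : ℤ) (h : i + 1 = j) : ShortComplex C :=
  ShortComplex.mk (X.f i) (X.g i j h) (X.w i j h)

/-- A morphism of resolutions is a sequence of morphisms in `T` between the objects, any two
consecutive ones of which are induced by a morphism of conflations. -/
@[ext]
structure Hom (X Y : Resolution E π) where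
  hom : ∀ i, π.obj (X.obj i) ⟶ π.obj (Y.obj i)
  ext' : ∀ i j h, Extends π (X.sc i j h) (Y.sc i j h) (hom i) (hom j)

instance : Category (Resolution E π) where
  Hom := Hom
  id X := ⟨fun _ => 𝟙 _, fun _ _ _ => Extends.id _ _⟩
  comp F G := ⟨fun i => F.hom i ≫ G.hom i, fun i j h => (F.ext' i j h).comp (G.ext' i j h)⟩

@[simp] theorem comp_hom {X Y Z : Resolution E π} (F : X ⟶ Y) (G : Y ⟶ Z) (i : ℤ) :
    Hom.hom (F ≫ G) i = F.hom i ≫ G.hom i := rfl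

theorem hom_ext {X Y : Resolution E π} {F G : X ⟶ Y} (h : ∀ i, F.hom i = G.hom i) : F = G :=
  Hom.ext (funext h)

/-- Restriction of a resolution along a translation `σ` of `ℤ`. -/
def reindex (X : Resolution E π) (σ : ℤ → ℤ) (hσ : ∀ i j, i + 1 = j → σ i + 1 = σ j) :
    Resolution E π where
  obj i := X.obj (σ i)
  mid i := X.mid (σ i)
  f i := X.f (σ i)
  g i j h := X.g (σ i) (σ j) (hσ i j h)
  w _ _ _ := X.w _ _ _
  conflation _ _ _ := X.conflation _ _ _
  inj _ := X.inj _

theorem reindex_congr (X : Resolution E π) {σ τ : ℤ → ℤ} (hσ : ∀ i j, i + 1 = j → σ i + 1 = σ j)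
    (hτ : ∀ i j, i + 1 = j → τ i + 1 = τ j) (h : σ = τ) : X.reindex σ hσ = X.reindex τ hτ := by
  subst h
  rfl

/-- The translation `n ↦ n + a` acting on resolutions. -/
def shift (a : ℤ) : Resolution E π ⥤ Resolution E π where
  obj X := X.reindex (fun n => n + a) (by omega)
  map F := ⟨fun i => F.hom (i + a), fun _ _ _ => F.ext' _ _ _⟩

@[simp] theorem shift_map_hom (a : ℤ) {X Y : Resolution E π} (F : X ⟶ Y) (i : ℤ) :
    ((shift a).map F).hom i = F.hom (i + a) := rfl

theorem shift_zero_obj (X : Resolution E π) : (shift 0).obj X = X :=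
  X.reindex_congr (τ := fun n => n) _ (fun _ _ h => h) (by simp)

theorem shift_add_obj (X : Resolution E π) (a b : ℤ) :
    (shift (a + b)).obj X = (shift b).obj ((shift a).obj X) :=
  X.reindex_congr (τ := fun n => n + b + a) _ (by omega) (by ext; omega)

theorem eqToHom_hom {X Y : Resolution E π} (h : X = Y) (i : ℤ) :
    Hom.hom (eqToHom h) i = eqToHom (by rw [h]) := by
  subst h
  rfl

theorem hom_eqToHom {X Y : Resolution E π} (F : X ⟶ Y) {i j : ℤ} (h : i = j) :
    F.hom i ≫ eqToHom (by rw [h]) = eqToHom (by rw [h]) ≫ F.hom j := by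
  subst h
  simp

noncomputable instance hasShift : HasShift (Resolution E π) ℤ :=
  hasShiftMk _ _
    { F := shift
      zero := NatIso.ofComponents (fun X => eqToIso X.shift_zero_obj) (fun {X Y} F => hom_ext
        fun i => by
          dsimp
          rw [eqToHom_hom, eqToHom_hom]
          exact hom_eqToHom F (add_zero i))
      add := fun a b => NatIso.ofComponents (fun X => eqToIso (X.shift_add_obj a b))
        (fun {X Y} F => hom_ext fun i => by
          dsimp
          rw [eqToHom_hom, eqToHom_hom]
          exact hom_eqToHom F (i := i + (a + b)) (j := i + b + a) (by omega))
      assoc_hom_app := fun a b c X => by simp [eqToHom_map]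
      zero_add_hom_app := fun a X => by simp [eqToHom_map]
      add_zero_hom_app := fun a X => by simp }

variable (E π) in
/-- Evaluation of a resolution at `0`. -/
@[simps]
def ev : Resolution E π ⥤ T where
  obj X := π.obj (X.obj 0)
  map F := F.hom 0

/-- Every object is the zeroth term of a resolution: go up by inflations into injectives, and down
by deflations from projectives. -/
theorem exists_resolution (hE : IsFrobenius E) (X : C) : ∃ R : Resolution E π, R.obj 0 = X := by
  choose I i hI Z p w hS using hE.enough_inj
  choose P p' hP K i' w' hS' using hE.enough_proj
  let pos : ℕ → C := fun n => Nat.rec X (fun _ => Z) n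
  let neg : ℕ → C := fun n => Nat.rec (K X) (fun _ => K) n
  exact ⟨{
    obj := fun
      | Int.ofNat n => pos n
      | Int.negSucc n => neg n
    mid := fun
      | Int.ofNat n => I (pos n)
      | Int.negSucc 0 => P X
      | Int.negSucc (n + 1) => P (neg n)
    f := fun
      | Int.ofNat n => i (pos n)
      | Int.negSucc 0 => i' X
      | Int.negSucc (n + 1) => i' (neg n)
    g := fun
      | Int.ofNat n, _, rfl => p (pos n)
      | Int.negSucc 0, _, rfl => p' X
      | Int.negSucc (n + 1), _, rfl => p' (neg n)
    w := fun
      | Int.ofNat n, _, rfl => w (pos n)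
      | Int.negSucc 0, _, rfl => w' X
      | Int.negSucc (n + 1), _, rfl => w' (neg n)
    conflation := fun
      | Int.ofNat n, _, rfl => hS (pos n)
      | Int.negSucc 0, _, rfl => hS' X
      | Int.negSucc (n + 1), _, rfl => hS' (neg n)
    inj := fun
      | Int.ofNat n => hI (pos n)
      | Int.negSucc 0 => (hE.proj_iff_inj _).1 (hP X)
      | Int.negSucc (n + 1) => (hE.proj_iff_inj _).1 (hP (neg n)) }, rfl⟩

end Resolution

variable [Preadditive T]

/-- The functor `π : C ⥤ T` presents `T` as the stable category of `(C, E)`, up to equivalence. -/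
structure PresentsStable (E : ObjectProperty (ShortComplex C)) (π : C ⥤ T) : Prop where
  additive : π.Additive
  full : π.Full
  essSurj : π.EssSurj
  map_eq_zero_iff : ∀ {X Y : C} (f : X ⟶ Y),
    π.map f = 0 ↔ ∃ (P : C) (a : X ⟶ P) (b : P ⟶ Y), IsProj E P ∧ f = a ≫ b

theorem Extends.add [π.Additive] {S S' : ShortComplex C} {a a' : π.obj S.X₁ ⟶ π.obj S'.X₁}
    {c c' : π.obj S.X₃ ⟶ π.obj S'.X₃} (h : Extends π S S' a c) (h' : Extends π S S' a' c') :
    Extends π S S' (a + a') (c + c') := by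
  obtain ⟨φ, rfl, rfl⟩ := h
  obtain ⟨ψ, rfl, rfl⟩ := h'
  exact ⟨φ + ψ, by simp [π.map_add], by simp [π.map_add]⟩

theorem Extends.neg [π.Additive] {S S' : ShortComplex C} {a : π.obj S.X₁ ⟶ π.obj S'.X₁}
    {c : π.obj S.X₃ ⟶ π.obj S'.X₃} (h : Extends π S S' a c) : Extends π S S' (-a) (-c) := by
  obtain ⟨φ, rfl, rfl⟩ := h
  exact ⟨-φ, by simp [π.map_neg], by simp [π.map_neg]⟩

theorem Extends.sub [π.Additive] {S S' : ShortComplex C} {a a' : π.obj S.X₁ ⟶ π.obj S'.X₁}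
    {c c' : π.obj S.X₃ ⟶ π.obj S'.X₃} (h : Extends π S S' a c) (h' : Extends π S S' a' c') :
    Extends π S S' (a - a') (c - c') := by
  simpa [sub_eq_add_neg] using h.add h'.neg

namespace PresentsStable

variable (hE : IsFrobenius E) (hπ : PresentsStable E π)

include hE hπ

theorem map_eq_zero_of_isInj {X I Y : C} (hI : IsInj E I) (a : X ⟶ I) (b : I ⟶ Y) :
    π.map (a ≫ b) = 0 :=
  (hπ.map_eq_zero_iff _).2 ⟨I, a, b, (hE.proj_iff_inj I).2 hI, rfl⟩

/-- If a morphism from a conflation to a short complex with injective middle term vanishes in `T` on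
the first terms, it vanishes in `T` on the third terms: after subtracting an extension to `S.X₂` of
the factorization of `φ.τ₁` through a projective, the middle component descends to a lift of `φ.τ₃`
to `S'.X₂`. -/
theorem extends_zero_left {S S' : ShortComplex C} (hS : E S)
    (hI : IsInj E S'.X₂) {c : π.obj S.X₃ ⟶ π.obj S'.X₃} (h : Extends π S S' 0 c) : c = 0 := by
  obtain ⟨φ, h₀, rfl⟩ := h
  obtain ⟨P, a, b, hP, hab⟩ := (hπ.map_eq_zero_iff _).1 h₀
  obtain ⟨a', ha'⟩ := (hE.proj_iff_inj P).1 hP S.f ⟨_, _, _, hS⟩ a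
  obtain ⟨t, ht⟩ := hE.exact.exists_desc hS (φ.τ₂ - a' ≫ b ≫ S'.f) (by
    rw [Preadditive.comp_sub, reassoc_of% ha', ← φ.comm₁₂, hab, Category.assoc, sub_self])
  have : Epi S.g := hE.exact.epi_g hS
  have h3 : φ.τ₃ = t ≫ S'.g := by
    rw [← cancel_epi S.g, ← φ.comm₂₃, reassoc_of% ht]
    simp
  rw [h3]
  exact hπ.map_eq_zero_of_isInj hE hI _ _

theorem extends_zero_right {S S' : ShortComplex C} (hS' : E S')
    (hI : IsInj E S.X₂) {a : π.obj S.X₁ ⟶ π.obj S'.X₁} (h : Extends π S S' a 0) : a = 0 := by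
  obtain ⟨φ, rfl, h₀⟩ := h
  obtain ⟨P, a, b, hP, hab⟩ := (hπ.map_eq_zero_iff _).1 h₀
  obtain ⟨b', hb'⟩ := hP S'.g ⟨_, _, _, hS'⟩ b
  obtain ⟨t, ht⟩ := hE.exact.exists_lift hS' (φ.τ₂ - S.g ≫ a ≫ b') (by
    rw [Preadditive.sub_comp, φ.comm₂₃, hab, Category.assoc, Category.assoc, hb', sub_self])
  have : Mono S'.f := hE.exact.mono_f hS'
  have h1 : φ.τ₁ = S.f ≫ t := by
    rw [← cancel_mono S'.f, φ.comm₁₂, Category.assoc, ht]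
    simp
  rw [h1]
  exact hπ.map_eq_zero_of_isInj hE hI _ _

theorem extends_right_unique {S S' : ShortComplex C} (hS : E S)
    (hI : IsInj E S'.X₂) {a : π.obj S.X₁ ⟶ π.obj S'.X₁} {c c' : π.obj S.X₃ ⟶ π.obj S'.X₃}
    (h : Extends π S S' a c) (h' : Extends π S S' a c') : c = c' := by
  have := hπ.additive
  have key := h.sub h'
  rw [sub_self] at key
  exact sub_eq_zero.1 (hπ.extends_zero_left hE hS hI key)

theorem extends_left_unique {S S' : ShortComplex C} (hS' : E S')
    (hI : IsInj E S.X₂) {a a' : π.obj S.X₁ ⟶ π.obj S'.X₁} {c : π.obj S.X₃ ⟶ π.obj S'.X₃}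
    (h : Extends π S S' a c) (h' : Extends π S S' a' c) : a = a' := by
  have := hπ.additive
  have key := h.sub h'
  rw [sub_self] at key
  exact sub_eq_zero.1 (hπ.extends_zero_right hE hS' hI key)

theorem exists_extends_right {S S' : ShortComplex C} (hS : E S)
    (hI : IsInj E S'.X₂) (a : π.obj S.X₁ ⟶ π.obj S'.X₁) : ∃ c, Extends π S S' a c := by
  have := hπ.full
  obtain ⟨a, rfl⟩ := π.map_surjective a
  obtain ⟨b, hb⟩ := hI S.f ⟨_, _, _, hS⟩ (a ≫ S'.f)
  obtain ⟨c, hc⟩ := hE.exact.exists_desc hS (b ≫ S'.g) (by rw [reassoc_of% hb]; simp)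
  exact ⟨π.map c, ⟨a, b, c, hb.symm, hc.symm⟩, rfl, rfl⟩

theorem exists_extends_left {S S' : ShortComplex C} (hS' : E S')
    (hI : IsInj E S.X₂) (c : π.obj S.X₃ ⟶ π.obj S'.X₃) : ∃ a, Extends π S S' a c := by
  have := hπ.full
  obtain ⟨c, rfl⟩ := π.map_surjective c
  obtain ⟨b, hb⟩ := (hE.proj_iff_inj _).2 hI S'.g ⟨_, _, _, hS'⟩ (S.g ≫ c)
  obtain ⟨a, ha⟩ := hE.exact.exists_lift hS' (S.f ≫ b) (by rw [Category.assoc, hb]; simp)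
  exact ⟨π.map a, ⟨a, b, c, ha, hb⟩, rfl, rfl⟩

end PresentsStable

/-- The pointwise sum of two morphisms of resolutions. -/
def Resolution.Hom.add [π.Additive] {X Y : Resolution E π} (F G : X ⟶ Y) : X ⟶ Y :=
  ⟨fun i => F.hom i + G.hom i, fun i j h => (F.ext' i j h).add (G.ext' i j h)⟩

namespace PresentsStable

open Resolution

variable (hE : IsFrobenius E) (hπ : PresentsStable E π)

include hE hπ

/-- A morphism of resolutions is determined by its zeroth component. -/
theorem hom_unique {X Y : Resolution E π} (F G : X ⟶ Y) (h : F.hom 0 = G.hom 0) : F = G := by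
  refine Resolution.hom_ext fun n => ?_
  induction n using Int.induction_on with
  | zero => exact h
  | succ n ih =>
    have hF := F.ext' n (n + 1) rfl
    rw [ih] at hF
    exact hπ.extends_right_unique hE (X.conflation _ _ _) (Y.inj _) hF (G.ext' n (n + 1) rfl)
  | pred n ih =>
    have hF := F.ext' (-n - 1) (-n) (by omega)
    rw [ih] at hF
    exact hπ.extends_left_unique hE (Y.conflation _ _ _) (X.inj _) hF (G.ext' _ _ _)

/-- A morphism between the zeroth terms extends to the resolutions. -/
theorem hom_exists (X Y : Resolution E π) (a : π.obj (X.obj 0) ⟶ π.obj (Y.obj 0)) :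
    ∃ F : X ⟶ Y, F.hom 0 = a := by
  choose up hup using fun (n : ℤ) (a : π.obj (X.obj n) ⟶ π.obj (Y.obj n)) =>
    hπ.exists_extends_right hE (S := X.sc n (n + 1) rfl) (S' := Y.sc n (n + 1) rfl)
      (X.conflation _ _ _) (Y.inj _) a
  choose down hdown using fun (i j : ℤ) (h : i + 1 = j) (a : π.obj (X.obj j) ⟶ π.obj (Y.obj j)) =>
    hπ.exists_extends_left hE (S := X.sc i j h) (S' := Y.sc i j h)
      (Y.conflation _ _ _) (X.inj _) a
  let pos : ∀ n : ℕ, π.obj (X.obj n) ⟶ π.obj (Y.obj n) := fun n => Nat.rec a (fun n b => up n b) n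
  let neg : ∀ n : ℕ, π.obj (X.obj (Int.negSucc n)) ⟶ π.obj (Y.obj (Int.negSucc n)) := fun n =>
    Nat.rec (down (Int.negSucc 0) 0 rfl a)
      (fun n b => down (Int.negSucc (n + 1)) (Int.negSucc n) rfl b) n
  refine ⟨⟨fun i => match i with
    | Int.ofNat n => pos n
    | Int.negSucc n => neg n, ?_⟩, rfl⟩
  rintro (n | _ | n) _ rfl
  · exact hup n (pos n)
  · exact hdown (Int.negSucc 0) 0 rfl a
  · exact hdown (Int.negSucc (n + 1)) (Int.negSucc n) rfl (neg n)

theorem isEquivalence_ev : (ev E π).IsEquivalence where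
  faithful := ⟨fun {_ _} F G h => hπ.hom_unique hE F G h⟩
  full := ⟨fun {X Y} a => hπ.hom_exists hE X Y a⟩
  essSurj := ⟨fun X => by
    have := hπ.essSurj
    obtain ⟨R, hR⟩ := exists_resolution (π := π) hE (π.objPreimage X)
    exact ⟨R, ⟨eqToIso (by simp [hR]) ≪≫ π.objObjPreimageIso X⟩⟩⟩

/-- The stable category has a shift by `ℤ` together with connecting morphisms of conflations. -/
theorem exists_shift : ∃ (_ : HasShift T ℤ) (_ : ∀ n : ℤ, (shiftFunctor T n).Additive)
    (δ : ∀ S : ShortComplex C, E S → (π.obj S.X₃ ⟶ (π.obj S.X₁)⟦(1 : ℤ)⟧)),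
    (∀ (S S' : ShortComplex C) (hS : E S) (hS' : E S') (φ : S ⟶ S'),
      π.map φ.τ₃ ≫ δ S' hS' = δ S hS ≫ (π.map φ.τ₁)⟦(1 : ℤ)⟧') ∧
    (∀ (S : ShortComplex C) (hS : E S), IsInj E S.X₂ → IsIso (δ S hS)) := by
  have := hπ.additive
  have := hπ.isEquivalence_ev hE
  let R := (ev E π).inv
  let s : ℤ → T ⥤ T := fun n => R ⋙ shiftFunctor (Resolution E π) n ⋙ ev E π
  let e : ∀ n, ev E π ⋙ s n ≅ shiftFunctor (Resolution E π) n ⋙ ev E π := fun n =>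
    Functor.isoWhiskerRight (ev E π).asEquivalence.unitIso.symm
      (shiftFunctor (Resolution E π) n ⋙ ev E π)
  -- The shift of resolutions is transported along the equivalence `ev`.
  let _ : HasShift T ℤ := HasShift.induced (ev E π) ℤ s e
  -- `R` is the identity on morphisms, up to the counit.
  have hmap : ∀ {X Y : T} (a : X ⟶ Y), (R.map a).hom 0 =
      (ev E π).asEquivalence.counitIso.hom.app X ≫ a ≫
        (ev E π).asEquivalence.counitIso.inv.app Y := fun a => (ev E π).fun_inv_map _ _ a
  have hadd : ∀ n : ℤ, (shiftFunctor T n).Additive := fun n => ⟨fun {X Y a b} => by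
    have h : R.map (a + b) = Hom.add (R.map a) (R.map b) := by
      apply hπ.hom_unique hE
      change _ = (R.map a).hom 0 + (R.map b).hom 0
      simp [hmap]
      rfl
    change (R.map (a + b)).hom (0 + n) = (R.map a).hom (0 + n) + (R.map b).hom (0 + n)
    rw [h]
    rfl⟩
  let ι : ∀ X : T, X ≅ π.obj ((R.obj X).obj 0) := fun X =>
    ((ev E π).asEquivalence.counitIso.app X).symm
  -- `δ S` extends the identification of `S.X₁` with the zeroth term of its resolution to a
  -- morphism from `S` to the first conflation of that resolution.
  have key : ∀ (S : ShortComplex C) (hS : E S),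
      ∃ c : π.obj S.X₃ ⟶ π.obj ((R.obj (π.obj S.X₁)).obj (0 + 1)),
        Extends π S ((R.obj (π.obj S.X₁)).sc 0 (0 + 1) rfl) (ι (π.obj S.X₁)).hom c :=
    fun S hS => hπ.exists_extends_right hE (S' := (R.obj (π.obj S.X₁)).sc 0 (0 + 1) rfl) hS
      ((R.obj (π.obj S.X₁)).inj 0) _
  choose δ hδ using key
  refine ⟨inferInstance, hadd, δ, fun S S' hS hS' φ => ?_, fun S hS hI => ?_⟩
  · have h₁ : Extends π S S' (π.map φ.τ₁) (π.map φ.τ₃) := ⟨φ, rfl, rfl⟩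
    have h₂ := h₁.comp (hδ S' hS')
    have h₃ := (hδ S hS).comp ((R.map (π.map φ.τ₁)).ext' 0 (0 + 1) rfl)
    have h : π.map φ.τ₁ ≫ (ι (π.obj S'.X₁)).hom =
        (ι (π.obj S.X₁)).hom ≫ (R.map (π.map φ.τ₁)).hom 0 := by
      simp only [hmap]
      exact (Iso.inv_hom_id_app_assoc (ev E π).asEquivalence.counitIso (π.obj S.X₁) _).symm
    rw [← h] at h₃
    exact hπ.extends_right_unique hE hS ((R.obj _).inj 0) h₂ h₃
  · have hR := (R.obj (π.obj S.X₁)).conflation 0 (0 + 1) rfl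
    have hRI : IsInj E ((R.obj (π.obj S.X₁)).mid 0) := (R.obj (π.obj S.X₁)).inj 0
    obtain ⟨c, hc⟩ := hπ.exists_extends_right hE hR hI (ι (π.obj S.X₁)).inv
    have h₁ := (hδ S hS).comp hc
    have h₂ := hc.comp (hδ S hS)
    rw [Iso.hom_inv_id] at h₁
    rw [Iso.inv_hom_id] at h₂
    exact ⟨c, hπ.extends_right_unique hE hS hI h₁ (Extends.id _ _),
      hπ.extends_right_unique hE hR hRI h₂ (Extends.id _ _)⟩

end PresentsStable

end Stable

/-! ### The triangulated structure of the stable category -/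

section Triangulated

universe v v' u'

variable {C : Type u} [Category.{v} C] [Preadditive C] {E : ObjectProperty (ShortComplex C)}
  {T : Type u'} [Category.{v'} T] [Preadditive T] {π : C ⥤ T}

namespace PresentsStable

section

variable (hE : IsFrobenius E) (hπ : PresentsStable E π)

include hE hπ

/-- A deflation with injective kernel becomes an isomorphism in the stable category. -/
theorem isIso_map_g {S : ShortComplex C} (hS : E S) (hI : IsInj E S.X₁) : IsIso (π.map S.g) := by
  have := hπ.additive
  have := hE.exact.epi_g hS
  obtain ⟨r, hr⟩ := hI S.f ⟨_, _, _, hS⟩ (𝟙 _)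
  obtain ⟨s, hs⟩ := hE.exact.exists_desc hS (𝟙 _ - r ≫ S.f) (by
    rw [Preadditive.comp_sub, reassoc_of% hr, Category.comp_id, sub_self])
  refine ⟨π.map s, ?_, ?_⟩
  · rw [← π.map_comp, hs, π.map_sub, hπ.map_eq_zero_of_isInj hE hI, sub_zero, π.map_id]
  · rw [← π.map_comp, ← π.map_id]
    congr 1
    rw [← cancel_epi S.g, reassoc_of% hs, Preadditive.sub_comp,
      Category.assoc, S.zero, Category.id_comp, comp_zero, sub_zero, Category.comp_id]

/-- Every morphism of the stable category is isomorphic to the image of an inflation. -/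
theorem exists_inflation {X : C} {Q : T} (f : π.obj X ⟶ Q) :
    ∃ (Y : C) (f' : X ⟶ Y) (e : Q ≅ π.obj Y), IsInflation E f' ∧ f ≫ e.hom = π.map f' := by
  have := hπ.additive
  have := hπ.full
  have := hπ.essSurj
  have := hE.exact.additive
  have := hasBinaryBiproducts_of_finite_biproducts C
  obtain ⟨f₀, hf₀⟩ := π.map_surjective (f ≫ (π.objObjPreimageIso Q).inv)
  obtain ⟨I, i, hI, hi⟩ := hE.enough_inj X
  have h₀ : π.map ((biprod.snd : π.objPreimage Q ⊞ I ⟶ I) ≫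
      (biprod.inr : I ⟶ π.objPreimage Q ⊞ I)) = 0 :=
    hπ.map_eq_zero_of_isInj hE hI _ _
  have h₁ : π.map ((biprod.fst : π.objPreimage Q ⊞ I ⟶ _) ≫ biprod.inl) = 𝟙 _ := by
    rw [← π.map_id, ← biprod.total, π.map_add, h₀, add_zero]
  let e : π.obj (π.objPreimage Q) ≅ π.obj (π.objPreimage Q ⊞ I) :=
    ⟨π.map biprod.inl, π.map biprod.fst, by rw [← π.map_comp, biprod.inl_fst, π.map_id],
      by rw [← π.map_comp, h₁]⟩
  refine ⟨_, biprod.lift f₀ i, (π.objObjPreimageIso Q).symm ≪≫ e, hE.exact.inflation_lift f₀ hi, ?_⟩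
  calc f ≫ (π.objObjPreimageIso Q).inv ≫ π.map biprod.inl
      = π.map (biprod.lift f₀ i ≫ biprod.fst ≫ biprod.inl) := by
        rw [biprod.lift_fst_assoc, π.map_comp, hf₀, Category.assoc]
    _ = π.map (biprod.lift f₀ i) := by rw [π.map_comp, h₁, Category.comp_id]

/-- The image of a conflation in the stable category is exact in the middle. -/
theorem exists_comp_map_f {S : ShortComplex C} (hS : E S) {W : T} (z : W ⟶ π.obj S.X₂)
    (hz : z ≫ π.map S.g = 0) : ∃ y : W ⟶ π.obj S.X₁, y ≫ π.map S.f = z := by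
  have := hπ.additive
  have := hπ.full
  have := hπ.essSurj
  obtain ⟨z₀, hz₀⟩ := π.map_surjective ((π.objObjPreimageIso W).hom ≫ z)
  obtain ⟨P, a, b, hP, hab⟩ := (hπ.map_eq_zero_iff (z₀ ≫ S.g)).1 (by
    rw [π.map_comp, hz₀, Category.assoc, hz, comp_zero])
  obtain ⟨b', hb'⟩ := hP S.g ⟨_, _, _, hS⟩ b
  obtain ⟨y, hy⟩ := hE.exact.exists_lift hS (z₀ - a ≫ b') (by
    rw [Preadditive.sub_comp, hab, Category.assoc, hb', sub_self])
  refine ⟨(π.objObjPreimageIso W).inv ≫ π.map y, ?_⟩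
  rw [Category.assoc, ← π.map_comp, hy, π.map_sub, hz₀,
    (hπ.map_eq_zero_iff (a ≫ b')).2 ⟨P, a, b', hP, rfl⟩, sub_zero, Iso.inv_hom_id_assoc]

/-- A square between the first morphisms of two conflations which commutes in the stable category
is the image of a morphism of conflations. -/
theorem exists_hom_of_comm {S S' : ShortComplex C} (hS : E S) (a : π.obj S.X₁ ⟶ π.obj S'.X₁)
    (b : π.obj S.X₂ ⟶ π.obj S'.X₂) (hab : π.map S.f ≫ b = a ≫ π.map S'.f) :
    ∃ φ : S ⟶ S', π.map φ.τ₁ = a ∧ π.map φ.τ₂ = b := by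
  have := hπ.additive
  have := hπ.full
  obtain ⟨a, rfl⟩ := π.map_surjective a
  obtain ⟨b, rfl⟩ := π.map_surjective b
  obtain ⟨P, s, t, hP, hst⟩ := (hπ.map_eq_zero_iff (S.f ≫ b - a ≫ S'.f)).1 (by
    rw [π.map_sub, π.map_comp, π.map_comp, hab, sub_self])
  obtain ⟨s', hs'⟩ := (hE.proj_iff_inj P).1 hP S.f ⟨_, _, _, hS⟩ s
  have h : S.f ≫ (b - s' ≫ t) = a ≫ S'.f := by
    rw [Preadditive.comp_sub, reassoc_of% hs', ← hst]
    abel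
  obtain ⟨c, hc⟩ := hE.exact.exists_desc hS ((b - s' ≫ t) ≫ S'.g) (by
    rw [reassoc_of% h, S'.zero, comp_zero])
  refine ⟨⟨a, b - s' ≫ t, c, h.symm, hc.symm⟩, rfl, ?_⟩
  rw [π.map_sub, (hπ.map_eq_zero_iff (s' ≫ t)).2 ⟨P, s', t, hP, rfl⟩, sub_zero]

theorem hasZeroObject : HasZeroObject T := by
  have := hπ.additive
  have := hE.exact.additive
  obtain ⟨Z, hZ⟩ := HasZeroObject.zero (C := C)
  exact ⟨π.obj Z, π.map_isZero hZ⟩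

end

variable [HasShift T ℤ]

/-- A family of connecting morphisms of conflations, natural and invertible on the conflations with
injective middle term. -/
structure IsConnecting (E : ObjectProperty (ShortComplex C)) (π : C ⥤ T)
    (δ : ∀ S : ShortComplex C, E S → (π.obj S.X₃ ⟶ (π.obj S.X₁)⟦(1 : ℤ)⟧)) : Prop where
  naturality : ∀ (S S' : ShortComplex C) (hS : E S) (hS' : E S') (φ : S ⟶ S'),
      π.map φ.τ₃ ≫ δ S' hS' = δ S hS ≫ (π.map φ.τ₁)⟦(1 : ℤ)⟧'
  isIso : ∀ (S : ShortComplex C) (hS : E S), IsInj E S.X₂ → IsIso (δ S hS)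

variable (δ : ∀ S : ShortComplex C, E S → (π.obj S.X₃ ⟶ (π.obj S.X₁)⟦(1 : ℤ)⟧))

/-- The connecting morphism of a conflation `X ⟶ Y ⟶ Z`. -/
def conn {X Y Z : C} {f : X ⟶ Y} {g : Y ⟶ Z} {w : f ≫ g = 0} (hS : E (ShortComplex.mk f g w)) :
    π.obj Z ⟶ (π.obj X)⟦(1 : ℤ)⟧ :=
  δ _ hS

/-- The morphisms `f`, `g`, `h` form a triangle isomorphic to the triangle of a conflation. -/
def IsStandard {X Y Z : T} (f : X ⟶ Y) (g : Y ⟶ Z) (h : Z ⟶ X⟦(1 : ℤ)⟧) : Prop :=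
  ∃ (A B D : C) (a : A ⟶ B) (b : B ⟶ D) (w : a ≫ b = 0) (hS : E (ShortComplex.mk a b w))
    (e₁ : X ≅ π.obj A) (e₂ : Y ≅ π.obj B) (e₃ : Z ≅ π.obj D),
    f ≫ e₂.hom = e₁.hom ≫ π.map a ∧ g ≫ e₃.hom = e₂.hom ≫ π.map b ∧
      h ≫ e₁.hom⟦(1 : ℤ)⟧' = e₃.hom ≫ conn δ hS

omit [Preadditive T] in
theorem isStandard_iff (D : Triangle T) :
    IsStandard δ D.mor₁ D.mor₂ D.mor₃ ↔ ∃ (S : ShortComplex C) (hS : E S),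
      Nonempty (D ≅ Triangle.mk (π.map S.f) (π.map S.g) (δ S hS)) := by
  constructor
  · rintro ⟨A, B, Z, a, b, w, hS, e₁, e₂, e₃, h₁, h₂, h₃⟩
    exact ⟨_, hS, ⟨Triangle.isoMk _ _ e₁ e₂ e₃ h₁ h₂ h₃⟩⟩
  · rintro ⟨S, hS, ⟨e⟩⟩
    exact ⟨S.X₁, S.X₂, S.X₃, S.f, S.g, S.zero, hS, Triangle.π₁.mapIso e, Triangle.π₂.mapIso e,
      Triangle.π₃.mapIso e, e.hom.comm₁, e.hom.comm₂, e.hom.comm₃⟩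

variable {δ}

omit [Preadditive T] in
theorem IsStandard.of_conflation {X Y Z : C} {f : X ⟶ Y} {g : Y ⟶ Z} {w : f ≫ g = 0}
    (hS : E (ShortComplex.mk f g w)) : IsStandard δ (π.map f) (π.map g) (conn δ hS) :=
  ⟨_, _, _, _, _, _, hS, Iso.refl _, Iso.refl _, Iso.refl _, by simp, by simp, by simp⟩

omit [Preadditive T] in
theorem IsStandard.of_iso {X Y Z X' Y' Z' : T} {f : X ⟶ Y} {g : Y ⟶ Z} {h : Z ⟶ X⟦(1 : ℤ)⟧}
    {f' : X' ⟶ Y'} {g' : Y' ⟶ Z'} {h' : Z' ⟶ X'⟦(1 : ℤ)⟧} (H : IsStandard δ f g h)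
    (e₁ : X' ≅ X) (e₂ : Y' ≅ Y) (e₃ : Z' ≅ Z) (h₁ : f' ≫ e₂.hom = e₁.hom ≫ f)
    (h₂ : g' ≫ e₃.hom = e₂.hom ≫ g) (h₃ : h' ≫ e₁.hom⟦(1 : ℤ)⟧' = e₃.hom ≫ h) :
    IsStandard δ f' g' h' := by
  obtain ⟨A, B, D, a, b, w, hS, i₁, i₂, i₃, k₁, k₂, k₃⟩ := H
  refine ⟨A, B, D, a, b, w, hS, e₁ ≪≫ i₁, e₂ ≪≫ i₂, e₃ ≪≫ i₃, ?_, ?_, ?_⟩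
  · simp [reassoc_of% h₁, k₁]
  · simp [reassoc_of% h₂, k₂]
  · simp [reassoc_of% h₃, k₃]

omit [Preadditive T] in
theorem IsConnecting.conn_naturality (hδ : IsConnecting E π δ) {X Y Z X' Y' Z' : C} {f : X ⟶ Y}
    {g : Y ⟶ Z} {w : f ≫ g = 0} (hS : E (ShortComplex.mk f g w)) {f' : X' ⟶ Y'} {g' : Y' ⟶ Z'}
    {w' : f' ≫ g' = 0} (hS' : E (ShortComplex.mk f' g' w')) (a : X ⟶ X') (b : Y ⟶ Y') (c : Z ⟶ Z')
    (h₁ : a ≫ f' = f ≫ b) (h₂ : b ≫ g' = g ≫ c) :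
    π.map c ≫ conn δ hS' = conn δ hS ≫ (π.map a)⟦(1 : ℤ)⟧' :=
  hδ.naturality _ _ hS hS' ⟨a, b, c, h₁, h₂⟩

variable (hE : IsFrobenius E) (hπ : PresentsStable E π) (hδ : IsConnecting E π δ)

include hE hπ

theorem isStandard_contractible (X : T) {Z : T} (hZ : IsZero Z) {g : X ⟶ Z}
    {h : Z ⟶ X⟦(1 : ℤ)⟧} : IsStandard δ (𝟙 X) g h := by
  have := hπ.additive
  have := hπ.essSurj
  obtain ⟨Z', g', w, hS, hZ'⟩ := hE.exact.conflation_id (π.objPreimage X)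
  have hZ'' := π.map_isZero hZ'
  let e := (π.objObjPreimageIso X).symm
  exact ⟨_, _, _, _, _, _, hS, e, e, hZ.iso hZ'', by simp, hZ''.eq_of_tgt _ _, hZ.eq_of_src _ _⟩

/-- Every morphism is the first morphism of the triangle of a conflation. -/
theorem exists_isStandard {P Q : T} (f : P ⟶ Q) :
    ∃ (R : T) (g : Q ⟶ R) (h : R ⟶ P⟦(1 : ℤ)⟧), IsStandard δ f g h := by
  have := hπ.essSurj
  let α := π.objObjPreimageIso P
  obtain ⟨Y, f', e, ⟨Z, g, w, hS⟩, hf'⟩ := hπ.exists_inflation hE (α.hom ≫ f)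
  refine ⟨π.obj Z, e.hom ≫ π.map g, conn δ hS ≫ α.hom⟦(1 : ℤ)⟧', _, _, _, _, _, _, hS, α.symm, e,
    Iso.refl _, ?_, ?_, ?_⟩
  · simp [← hf']
  · simp
  · simp [← Functor.map_comp]

omit hE in
theorem IsStandard.comp_eq_zero {X Y Z : T} {f : X ⟶ Y} {g : Y ⟶ Z} {h : Z ⟶ X⟦(1 : ℤ)⟧}
    (H : IsStandard δ f g h) : f ≫ g = 0 := by
  have := hπ.additive
  obtain ⟨A, B, D, a, b, w, hS, e₁, e₂, e₃, k₁, k₂, k₃⟩ := H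
  rw [← cancel_mono e₃.hom, Category.assoc, k₂, reassoc_of% k₁, ← π.map_comp, w, π.map_zero,
    comp_zero, zero_comp]

/-- The sequence `Hom(W, X) ⟶ Hom(W, Y) ⟶ Hom(W, Z)` is exact. -/
theorem IsStandard.exists_comp_eq {X Y Z : T} {f : X ⟶ Y} {g : Y ⟶ Z} {h : Z ⟶ X⟦(1 : ℤ)⟧}
    (H : IsStandard δ f g h) {W : T} (z : W ⟶ Y) (hz : z ≫ g = 0) : ∃ y : W ⟶ X, y ≫ f = z := by
  obtain ⟨A, B, D, a, b, w, hS, e₁, e₂, e₃, k₁, k₂, k₃⟩ := H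
  obtain ⟨y, hy⟩ := hπ.exists_comp_map_f hE hS (z ≫ e₂.hom) (by
    dsimp only
    rw [Category.assoc, ← k₂, reassoc_of% hz, zero_comp])
  refine ⟨y ≫ e₁.inv, ?_⟩
  rw [← cancel_mono e₂.hom, Category.assoc, Category.assoc, k₁, Iso.inv_hom_id_assoc]
  exact hy

include hδ

/-- A commutative square between the first morphisms extends to a morphism of triangles. -/
theorem IsStandard.exists_hom {X Y Z X' Y' Z' : T} {f : X ⟶ Y} {g : Y ⟶ Z} {h : Z ⟶ X⟦(1 : ℤ)⟧}
    {f' : X' ⟶ Y'} {g' : Y' ⟶ Z'} {h' : Z' ⟶ X'⟦(1 : ℤ)⟧} (H : IsStandard δ f g h)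
    (H' : IsStandard δ f' g' h') (a : X ⟶ X') (b : Y ⟶ Y') (hab : f ≫ b = a ≫ f') :
    ∃ c : Z ⟶ Z', g ≫ c = b ≫ g' ∧ h ≫ a⟦(1 : ℤ)⟧' = c ≫ h' := by
  obtain ⟨A, B, D, r, s, w, hS, e₁, e₂, e₃, k₁, k₂, k₃⟩ := H
  obtain ⟨A', B', D', r', s', w', hS', e₁', e₂', e₃', k₁', k₂', k₃'⟩ := H'
  obtain ⟨⟨α, β, γ, hαβ, hβγ⟩, hα, hβ⟩ := hπ.exists_hom_of_comm hE
    (S' := ShortComplex.mk r' s' w') hS (e₁.inv ≫ a ≫ e₁'.hom) (e₂.inv ≫ b ≫ e₂'.hom) (by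
      rw [← cancel_epi e₁.hom]
      dsimp only
      rw [← reassoc_of% k₁, Iso.hom_inv_id_assoc, Category.assoc, Category.assoc, ← k₁',
        Iso.hom_inv_id_assoc, reassoc_of% hab])
  dsimp only at α β γ hαβ hβγ hα hβ
  have hn := hδ.conn_naturality hS hS' α β γ hαβ hβγ
  refine ⟨e₃.hom ≫ π.map γ ≫ e₃'.inv, ?_, ?_⟩
  · rw [← cancel_mono e₃'.hom]
    simp only [Category.assoc, Iso.inv_hom_id, Category.comp_id]
    rw [reassoc_of% k₂, ← π.map_comp, ← hβγ, π.map_comp, k₂', hβ]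
    simp
  · rw [← cancel_mono (e₁'.hom⟦(1 : ℤ)⟧')]
    simp only [Category.assoc]
    rw [k₃', Iso.inv_hom_id_assoc, hn, ← reassoc_of% k₃, hα]
    simp [← Functor.map_comp]

variable [∀ n : ℤ, (shiftFunctor T n).Additive]

/-- The rotation of the triangle of a conflation `X ⟶ Y ⟶ Z` is the triangle of the conflation
`Y ⟶ Q ⟶ ΣX`, where `Q` is the pushout of an inflation `X ⟶ I` into an injective object. The sign
comes from the conflation `X ⟶ Y ⊞ I ⟶ Q`, which maps to both `X ⟶ Y ⟶ Z` and `X ⟶ I ⟶ ΣX`. -/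
theorem isStandard_rotate_of_conflation {X Y Z : C} {f : X ⟶ Y} {g : Y ⟶ Z} {w : f ≫ g = 0}
    (hS : E (ShortComplex.mk f g w)) :
    IsStandard δ (π.map g) (conn δ hS) (-(π.map f)⟦(1 : ℤ)⟧') := by
  have := hπ.additive
  have := hE.exact.additive
  have := hasBinaryBiproducts_of_finite_biproducts C
  obtain ⟨I, i, hI, hi⟩ := hE.enough_inj X
  obtain ⟨X', p, wp, hJ⟩ := id hi
  obtain ⟨Q, j, l, hQ, -⟩ := hE.exact.pushout f i ⟨_, _, _, hS⟩
  obtain ⟨t, wt, ht, hIQ⟩ := hE.exact.conflation_of_isPushout hS hQ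
  obtain ⟨r, wr, hr, hYQ⟩ := hE.exact.conflation_of_isPushout hJ hQ.flip
  obtain ⟨wU, hU⟩ := hE.exact.conflation_biprod hi hQ
  have h₁ := hδ.conn_naturality hJ hYQ f l (𝟙 _) hQ.w (by simp [hr])
  have h₂ := hδ.conn_naturality hU hS (𝟙 _) biprod.fst t (by simp)
    (by apply biprod.hom_ext' <;> simp [ht, wt])
  have h₃ := hδ.conn_naturality hU hJ (-𝟙 _) biprod.snd r (by simp)
    (by apply biprod.hom_ext' <;> simp [hr, wr])
  simp only [π.map_id, π.map_neg, Functor.map_neg, CategoryTheory.Functor.map_id, Category.id_comp,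
    Category.comp_id, Preadditive.comp_neg] at h₁ h₂ h₃
  have : IsIso (π.map t) := hπ.isIso_map_g hE hIQ hI
  have : IsIso (conn δ hJ) := hδ.isIso _ hJ hI
  refine (IsStandard.of_conflation hYQ).of_iso (Iso.refl _) (asIso (π.map t)).symm
    (-asIso (conn δ hJ)).symm ?_ ?_ ?_
  · rw [← cancel_mono (π.map t)]
    simp [← π.map_comp, ht]
  · rw [← cancel_epi (π.map t), ← cancel_mono (-asIso (conn δ hJ)).hom]
    simp [h₃, h₂]
  · rw [← cancel_epi (-asIso (conn δ hJ)).hom]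
    simp [h₁]

theorem IsStandard.rotate {X Y Z : T} {f : X ⟶ Y} {g : Y ⟶ Z} {h : Z ⟶ X⟦(1 : ℤ)⟧}
    (H : IsStandard δ f g h) : IsStandard δ g h (-f⟦(1 : ℤ)⟧') := by
  obtain ⟨A, B, D, a, b, w, hS, e₁, e₂, e₃, k₁, k₂, k₃⟩ := H
  refine (isStandard_rotate_of_conflation hE hπ hδ hS).of_iso e₂ e₃
    ((shiftFunctor T (1 : ℤ)).mapIso e₁) k₂ k₃ ?_
  simp only [Preadditive.neg_comp, Preadditive.comp_neg, Functor.mapIso_hom, ← Functor.map_comp, k₁]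

/-- A triangle is distinguished if its rotation is: completing its first morphism to a distinguished
triangle, and comparing the rotations, gives a morphism of triangles which is an isomorphism by the
five lemma. -/
theorem IsStandard.of_rotate {X Y Z : T} {f : X ⟶ Y} {g : Y ⟶ Z} {h : Z ⟶ X⟦(1 : ℤ)⟧}
    (H : IsStandard δ g h (-f⟦(1 : ℤ)⟧')) : IsStandard δ f g h := by
  obtain ⟨R, g', h', H'⟩ := exists_isStandard (δ := δ) hE hπ f
  have hR := H'.rotate hE hπ hδ
  have hD' := H.rotate hE hπ hδ
  have hR' := hR.rotate hE hπ hδ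
  have hD'' := hD'.rotate hE hπ hδ
  -- The comparison is made after three rotations, where `f` is the third shifted morphism on both
  -- sides, and is then brought back by the full and faithful shift.
  obtain ⟨c, hc₁, hc₂⟩ := hD''.exists_hom hE hπ hδ (hR'.rotate hE hπ hδ) (𝟙 _) (𝟙 _) (by simp)
  obtain ⟨c, rfl⟩ := (shiftFunctor T (1 : ℤ)).map_surjective c
  simp only [Category.id_comp, Category.comp_id, Preadditive.neg_comp, neg_inj,
    Preadditive.comp_neg, ← Functor.map_comp] at hc₁ hc₂
  replace hc₁ : g ≫ c = g' := (shiftFunctor T (1 : ℤ)).map_injective hc₁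
  replace hc₂ : h = c ≫ h' := (shiftFunctor T (1 : ℤ)).map_injective hc₂
  have hfg : f ≫ g = 0 := by
    have := hD''.comp_eq_zero hπ
    simp only [Preadditive.comp_neg, Preadditive.neg_comp, neg_neg, ← Functor.map_comp] at this
    exact (shiftFunctor T (1 : ℤ)).map_injective (by simpa using this)
  have hinj : ∀ {W : T} (z : W ⟶ Z), z ≫ c = 0 → z = 0 := fun {W} z hz => by
    obtain ⟨y, rfl⟩ := H.exists_comp_eq hE hπ z (by rw [hc₂, reassoc_of% hz, zero_comp])
    rw [Category.assoc, hc₁] at hz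
    obtain ⟨x, rfl⟩ := H'.exists_comp_eq hE hπ y hz
    rw [Category.assoc, hfg, comp_zero]
  have hsurj : ∀ {W : T} (z : W ⟶ R), ∃ y : W ⟶ Z, y ≫ c = z := fun {W} z => by
    obtain ⟨y, hy⟩ := hD'.exists_comp_eq hE hπ (z ≫ h') (by
      rw [Category.assoc, hR'.comp_eq_zero hπ, comp_zero])
    obtain ⟨x, hx⟩ := hR.exists_comp_eq hE hπ (z - y ≫ c) (by
      rw [Preadditive.sub_comp, Category.assoc, ← hc₂, hy, sub_self])
    refine ⟨y + x ≫ g, ?_⟩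
    rw [Preadditive.add_comp, Category.assoc, hc₁, hx]
    abel
  obtain ⟨s, hs⟩ := hsurj (𝟙 R)
  have hs' : c ≫ s = 𝟙 _ := sub_eq_zero.1 (hinj _ (by
    rw [Preadditive.sub_comp, Category.assoc, hs, Category.comp_id, Category.id_comp, sub_self]))
  exact H'.of_iso (Iso.refl _) (Iso.refl _) ⟨c, s, hs', hs⟩ (by simp) (by simpa using hc₁)
    (by simpa using hc₂)

/-- The pretriangulated structure of the stable category whose distinguished triangles are those
isomorphic to the triangle of a conflation. -/
@[reducible]
def pretriangulated [HasZeroObject T] : Pretriangulated T where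
  distinguishedTriangles := {D | IsStandard δ D.mor₁ D.mor₂ D.mor₃}
  isomorphic_distinguished _ h _ e := IsStandard.of_iso h (Triangle.π₁.mapIso e)
    (Triangle.π₂.mapIso e) (Triangle.π₃.mapIso e) e.hom.comm₁ e.hom.comm₂ e.hom.comm₃
  contractible_distinguished X := isStandard_contractible hE hπ X (isZero_zero T)
  distinguished_cocone_triangle f := exists_isStandard hE hπ f
  rotate_distinguished_triangle _ := ⟨fun h => IsStandard.rotate hE hπ hδ h,
    fun h => IsStandard.of_rotate hE hπ hδ h⟩
  complete_distinguished_triangle_morphism _ _ h h' a b hab :=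
    IsStandard.exists_hom hE hπ hδ h h' a b hab

/-- The octahedral axiom holds since, for two composable inflations, the cokernels of the
inflations and of their composite form a conflation. -/
theorem isTriangulated [HasZeroObject T] :
    @IsTriangulated T _ _ _ _ _ (pretriangulated hE hπ hδ) := by
  have := hπ.additive
  have := hπ.essSurj
  let _ := pretriangulated hE hπ hδ
  refine IsTriangulated.mk' fun A₁ A₂ A₃ u₁₂ u₂₃ => ?_
  let α := π.objObjPreimageIso A₁
  obtain ⟨Y, f, e₂, ⟨Z₁₂, p, wp, h₁₂⟩, hf⟩ := hπ.exists_inflation hE (α.hom ≫ u₁₂)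
  obtain ⟨Z, g, e₃, ⟨Z₂₃, s, ws, h₂₃⟩, hg⟩ := hπ.exists_inflation hE (e₂.inv ≫ u₂₃)
  obtain ⟨Z₁₃, r, wr, h₁₃⟩ := hE.exact.comp_inflation f g ⟨_, _, _, h₁₂⟩ ⟨_, _, _, h₂₃⟩
  obtain ⟨a, ha⟩ := hE.exact.exists_desc h₁₂ (g ≫ r) (by simpa using wr)
  dsimp at a ha
  obtain ⟨b, wb, hb, hab⟩ :=
    hE.exact.conflation_of_isPushout h₂₃ (hE.exact.isPushout_cokernel h₁₂ h₁₃ ha)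
  have n₁ := hδ.conn_naturality h₁₂ h₁₃ (𝟙 _) g a (by simp) ha.symm
  have n₂ := hδ.conn_naturality h₁₃ h₂₃ f (𝟙 _) b (by simp) (by simp [hb])
  have n₃ := hδ.conn_naturality h₂₃ hab p r (𝟙 _) ha (by simp [hb])
  simp only [π.map_id, CategoryTheory.Functor.map_id, Category.id_comp, Category.comp_id]
    at n₁ n₂ n₃
  have m₁₃ : IsStandard δ (π.map f ≫ π.map g) (π.map r) (conn δ h₁₃) := by
    rw [← π.map_comp]
    exact IsStandard.of_conflation h₁₃
  have mab : IsStandard δ (π.map a) (π.map b) (conn δ h₂₃ ≫ (π.map p)⟦(1 : ℤ)⟧') := by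
    rw [← n₃]
    exact IsStandard.of_conflation hab
  refine ⟨_, _, _, _, _, _, π.map f, π.map g, α.symm, e₂, e₃, ?_, ?_, π.map p, conn δ h₁₂,
    IsStandard.of_conflation h₁₂, π.map s, conn δ h₂₃, IsStandard.of_conflation h₂₃, π.map r,
    conn δ h₁₃, m₁₃, ⟨⟨π.map a, π.map b, ?_, n₁, ?_, n₂.symm, mab⟩⟩⟩
  · simp [← hf]
  · simp [← hg]
  · rw [← π.map_comp, ha, π.map_comp]
  · rw [← π.map_comp, hb]

end PresentsStable

/-- The stable category of a Frobenius category is triangulated. -/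
theorem exists_isStableTriangulation (hE : IsFrobenius E) (hπ : PresentsStable E π) :
    ∃ (_ : HasZeroObject T) (_ : HasShift T ℤ) (_ : ∀ n : ℤ, (shiftFunctor T n).Additive)
      (_ : Pretriangulated T), IsTriangulated T ∧ IsStableTriangulation E π := by
  obtain ⟨_, _, δ, hδ, hδ'⟩ := hπ.exists_shift hE
  have := hπ.hasZeroObject hE
  have H : PresentsStable.IsConnecting E π δ := ⟨hδ, hδ'⟩
  exact ⟨inferInstance, inferInstance, inferInstance, PresentsStable.pretriangulated hE hπ H,
    PresentsStable.isTriangulated hE hπ H, δ, hδ, hδ', PresentsStable.isStandard_iff δ⟩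

end Triangulated

/-! ### Graded modules: projections, finite products, kernels -/

section GradedModules

variable {k : Type w₀} [CommRing k]

/-- A family of submodules is a grading as soon as there are projections onto its members, which are
jointly injective and of which only finitely many are non-zero at any given element. -/
theorem isInternal_of_projections {M : Type*} [AddCommGroup M] [Module k M]
    {deg : ℤ → Submodule k M} (p : ℤ → M →ₗ[k] M) (h_mem : ∀ i x, p i x ∈ deg i)
    (h_same : ∀ i x, x ∈ deg i → p i x = x) (h_ne : ∀ i j x, i ≠ j → x ∈ deg i → p j x = 0)
    (h_fin : ∀ x, {i | p i x ≠ 0}.Finite) (h_zero : ∀ x, (∀ i, p i x = 0) → x = 0) :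
    DirectSum.IsInternal deg := by
  have key : ∀ j, p j ∘ₗ DirectSum.coeLinearMap deg =
      (deg j).subtype ∘ₗ DirectSum.component k ℤ (fun i => deg i) j := fun j => by
    refine DirectSum.linearMap_ext k fun i => LinearMap.ext fun x => ?_
    by_cases hij : i = j
    · subst hij
      simp [h_same i x x.2, DirectSum.component.lof_self]
    · simp [h_ne i j x hij x.2, DirectSum.component.of, hij]
  constructor
  · rw [injective_iff_map_eq_zero]
    intro v hv
    refine DFinsupp.ext fun j => Subtype.ext ?_
    have := LinearMap.congr_fun (key j) v
    rw [LinearMap.comp_apply, show DirectSum.coeLinearMap deg v = 0 from hv, map_zero] at this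
    exact this.symm
  · intro x
    refine ⟨∑ i ∈ (h_fin x).toFinset, DirectSum.of (fun i => deg i) i ⟨p i x, h_mem i x⟩, ?_⟩
    refine (sub_eq_zero.1 (h_zero _ fun j => ?_)).symm
    simp only [map_sub, map_sum, DirectSum.coeAddMonoidHom_of]
    by_cases hj : p j x = 0
    · rw [hj, zero_sub, neg_eq_zero]
      refine Finset.sum_eq_zero fun i hi => h_ne i j _ ?_ (h_mem i x)
      rintro rfl
      simp [hj] at hi
    · rw [Finset.sum_eq_single_of_mem j (by simpa using hj) fun i _ hij =>
        h_ne i j _ hij (h_mem i x), h_same j _ (h_mem j x), sub_self]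

namespace GrMod

variable (U : GrMod.{w₀, w} k)

/-- The projection of a graded module onto its component of degree `i`. -/
noncomputable def proj (i : ℤ) : U →ₗ[k] U :=
  (U.deg i).subtype ∘ₗ DirectSum.component k ℤ (fun i => U.deg i) i ∘ₗ
    ((LinearEquiv.ofBijective (DirectSum.coeLinearMap U.deg) U.isInternal).symm : _ →ₗ[k] _)

theorem proj_mem (i : ℤ) (x : U) : U.proj i x ∈ U.deg i := Subtype.property _

theorem symm_of_mem {i : ℤ} {x : U} (hx : x ∈ U.deg i) :
    (LinearEquiv.ofBijective (DirectSum.coeLinearMap U.deg) U.isInternal).symm x =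
      DirectSum.lof k ℤ (fun i => U.deg i) i ⟨x, hx⟩ := by
  rw [LinearEquiv.symm_apply_eq]
  exact (DirectSum.coeLinearMap_lof U.deg i ⟨x, hx⟩).symm

theorem proj_same {i : ℤ} {x : U} (hx : x ∈ U.deg i) : U.proj i x = x := by
  simp [proj, U.symm_of_mem hx, DirectSum.component.lof_self]

theorem proj_ne {i j : ℤ} (hij : i ≠ j) {x : U} (hx : x ∈ U.deg i) : U.proj j x = 0 := by
  simp [proj, U.symm_of_mem hx, DirectSum.component.of, hij]

theorem finite_proj (x : U) : {i | U.proj i x ≠ 0}.Finite := by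
  refine (DFinsupp.finite_support
    ((LinearEquiv.ofBijective (DirectSum.coeLinearMap U.deg) U.isInternal).symm x)).subset
    fun i hi h => hi ?_
  change ((((LinearEquiv.ofBijective (DirectSum.coeLinearMap U.deg) U.isInternal).symm x) i :
    U.deg i) : U) = 0
  rw [h]
  rfl

theorem eq_zero_of_proj {x : U} (h : ∀ i, U.proj i x = 0) : x = 0 := by
  have : (LinearEquiv.ofBijective (DirectSum.coeLinearMap U.deg) U.isInternal).symm x = 0 :=
    DFinsupp.ext fun i => Subtype.ext (h i)
  exact (LinearEquiv.map_eq_zero_iff _).1 this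

theorem induction {motive : U → Prop} (add : ∀ x y, motive x → motive y → motive (x + y))
    (zero : motive 0) (homogeneous : ∀ i, ∀ x ∈ U.deg i, motive x) (x : U) : motive x := by
  let _ := U.isInternal.chooseDecomposition
  exact DirectSum.Decomposition.inductionOn U.deg zero (fun {i} m => homogeneous i m m.2) add x

/-- Homogeneous maps commute with the projections. -/
theorem map_proj {U V : GrMod.{w₀, w} k} (F : U →ₗ[k] V) (n : ℤ)
    (hF : ∀ i j, i + n = j → ∀ x ∈ U.deg i, F x ∈ V.deg j) {i j : ℤ} (hij : i + n = j) (x : U) :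
    F (U.proj i x) = V.proj j (F x) := by
  refine U.induction (motive := fun x => F (U.proj i x) = V.proj j (F x)) (fun x y hx hy => ?_) ?_
    (fun l x hx => ?_) x
  · simp only [map_add, hx, hy]
  · simp only [map_zero]
  · by_cases h : l = i
    · subst h
      rw [U.proj_same hx, V.proj_same (hF l j hij x hx)]
    · rw [U.proj_ne h hx, V.proj_ne (by omega) (hF l (l + n) rfl x hx), map_zero]

end GrMod

end GradedModules

section Modules

variable {k : Type w₀} [CommRing k] {N : ℕ} {q : kˣ} {𝒜 : NqDGCat.{w₀, w₁, u} k N q}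

namespace GrRightModule

/-- The product of a finite family of graded modules, the `i`-th of which is translated by `s i`: an
element is of degree `j` if its `i`-th component is of degree `j - s i`. -/
noncomputable def pi {ι : Type} [Finite ι] (X : ι → GrRightModule.{w₀, w₁, u, w} 𝒜) (s : ι → ℤ) :
    GrRightModule.{w₀, w₁, u, w} 𝒜 where
  obj A :=
    { carrier := ∀ i, (X i).obj A
      deg := fun j => Submodule.pi Set.univ fun i => ((X i).obj A).deg (j - s i)
      isInternal := by
        refine isInternal_of_projections (fun j => LinearMap.pi fun i =>
          ((X i).obj A).proj (j - s i) ∘ₗ LinearMap.proj i) (fun j x i _ => GrMod.proj_mem _ _ _)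
          (fun j x hx => funext fun i => GrMod.proj_same _ (hx i trivial))
          (fun j j' x hj hx => funext fun i => GrMod.proj_ne _ (by omega) (hx i trivial))
          (fun x => ?_) fun x hx => funext fun i => GrMod.eq_zero_of_proj _ fun j => ?_
        · have h : ∀ i, {j | ((X i).obj A).proj (j - s i) (x i) ≠ 0}.Finite := fun i =>
            (((X i).obj A).finite_proj (x i)).preimage (sub_left_injective.injOn)
          refine (Set.finite_iUnion h).subset fun j hj => ?_
          by_contra hj'
          simp only [Set.mem_iUnion, Set.mem_ofPred_eq, not_exists, not_not] at hj'
          exact hj (funext hj')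
        · simpa using congrFun (hx (j + s i)) i }
  act {A₁ A₂} := LinearMap.mk₂ k (fun x f i => (X i).act (x i) f)
    (fun x y f => funext fun i => by simp) (fun c x f => funext fun i => by simp)
    (fun x f g => funext fun i => by simp) (fun c x f => funext fun i => by simp)
  act_mem r t x f hx hf i _ := by
    have := (X i).act_mem (r - s i) t (x i) f (hx i trivial) hf
    rwa [show r - s i + t = r + t - s i by ring] at this
  act_one x := funext fun i => (X i).act_one _
  act_comp x f g := funext fun i => (X i).act_comp _ _ _

variable {Y : GrRightModule.{w₀, w₁, u, w} 𝒜}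

/-- The kernel of a graded endomorphism. -/
noncomputable def ker (p : Y ⟶ Y) : GrRightModule.{w₀, w₁, u, w} 𝒜 where
  obj A :=
    { carrier := LinearMap.ker (p.1 A)
      deg := fun j => ((Y.obj A).deg j).comap (LinearMap.ker (p.1 A)).subtype
      isInternal := by
        refine isInternal_of_projections (fun j => ((Y.obj A).proj j).restrict fun x hx => ?_)
          (fun j x => GrMod.proj_mem _ _ _)
          (fun j x hx => Subtype.ext (GrMod.proj_same _ hx))
          (fun j j' x hj hx => Subtype.ext (GrMod.proj_ne _ hj hx))
          (fun x => ?_) fun x hx => Subtype.ext (GrMod.eq_zero_of_proj _ fun j => ?_)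
        · rw [LinearMap.mem_ker] at hx ⊢
          rw [GrMod.map_proj (p.1 A) 0 (p.2.1 A) (add_zero j), hx, map_zero]
        · exact ((Y.obj A).finite_proj x.1).subset fun j hj h => hj (Subtype.ext h)
        · exact congrArg Subtype.val (hx j) }
  act {A₁ A₂} := LinearMap.mk₂ k (fun x f => ⟨Y.act x.1 f, by
      rw [LinearMap.mem_ker, p.2.2, LinearMap.mem_ker.1 x.2]; simp⟩)
    (fun x y f => Subtype.ext (by simp)) (fun c x f => Subtype.ext (by simp))
    (fun x f g => Subtype.ext (by simp)) (fun c x f => Subtype.ext (by simp))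
  act_mem r t x f hx hf := Y.act_mem r t x.1 f hx hf
  act_one x := Subtype.ext (Y.act_one _)
  act_comp x f g := Subtype.ext (Y.act_comp _ _ _)

/-- The inclusion of the kernel. -/
noncomputable def kerι (p : Y ⟶ Y) : ker p ⟶ Y :=
  ⟨fun A => (LinearMap.ker (p.1 A)).subtype, fun _ i j hij x hx => by
    obtain rfl : i = j := by omega
    exact hx, fun _ _ _ _ => rfl⟩

/-- The projection onto the kernel of an idempotent. -/
noncomputable def kerπ (p : Y ⟶ Y) (hp : p ≫ p = p) : Y ⟶ ker p :=
  ⟨fun A => LinearMap.codRestrict _ (LinearMap.id - p.1 A) fun x => by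
      have : p.1 A (p.1 A x) = p.1 A x := congrArg (fun F : Y ⟶ Y => F.1 A x) hp
      simp [this],
    fun A i j hij x hx => by
      obtain rfl : i = j := by omega
      exact sub_mem hx (p.2.1 A i i (add_zero i) x hx),
    fun A₁ A₂ x f => Subtype.ext (by
      change Y.act x f - p.1 A₂ (Y.act x f) = Y.act (x - p.1 A₁ x) f
      rw [p.2.2]
      simp)⟩

theorem kerι_kerπ (p : Y ⟶ Y) (hp : p ≫ p = p) : kerι p ≫ kerπ p hp = 𝟙 _ :=
  Subtype.ext (funext fun A => LinearMap.ext fun x => Subtype.ext (by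
    change x.1 - p.1 A x.1 = x.1
    rw [LinearMap.mem_ker.1 x.2, sub_zero]))

theorem kerπ_kerι (p : Y ⟶ Y) (hp : p ≫ p = p) : kerπ p hp ≫ kerι p = 𝟙 _ - p := rfl

theorem kerι_comp (p : Y ⟶ Y) : kerι p ≫ p = 0 :=
  Subtype.ext (funext fun _ => LinearMap.ext fun x => x.2)

theorem comp_kerπ (p : Y ⟶ Y) (hp : p ≫ p = p) : p ≫ kerπ p hp = 0 :=
  Subtype.ext (funext fun A => LinearMap.ext fun x => Subtype.ext (by
    change p.1 A x - p.1 A (p.1 A x) = 0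
    rw [show p.1 A (p.1 A x) = p.1 A x from congrArg (fun F : Y ⟶ Y => F.1 A x) hp, sub_self]))

end GrRightModule

end Modules

/-! ### The exact structure of degreewise split sequences -/

section Modules

variable {k : Type w₀} [CommRing k] {N : ℕ} {q : kˣ} {𝒜 : NqDGCat.{w₀, w₁, u} k N q}

namespace NDGRightModule

variable {X Y Z W : NDGRightModule.{w₀, w₁, u, w} 𝒜}

/-- A morphism of `NDG` modules from a graded morphism that commutes with `d`. -/
def homMk (F : X.toGrRightModule ⟶ Y.toGrRightModule)
    (h : ∀ A x, F.1 A (X.d A x) = Y.d A (F.1 A x)) : X ⟶ Y :=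
  ⟨F.1, F.2, fun A => LinearMap.ext (h A)⟩

/-- The graded morphism underlying a morphism of `NDG` modules, with source and target in the form
`X.toGrRightModule` rather than `(forgetD 𝒜).obj X`. -/
def gr (F : X ⟶ Y) : X.toGrRightModule ⟶ Y.toGrRightModule := (forgetD 𝒜).map F

@[simp]
theorem gr_homMk (F : X.toGrRightModule ⟶ Y.toGrRightModule) (h) : gr (homMk F h) = F := rfl

@[simp]
theorem gr_comp (F : X ⟶ Y) (G : Y ⟶ Z) : gr (F ≫ G) = gr F ≫ gr G := rfl

theorem hom_d (F : X ⟶ Y) (A : 𝒜.Obj) (x : X.obj A) : F.1 A (X.d A x) = Y.d A (F.1 A x) :=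
  LinearMap.congr_fun (F.2.2 A) x

theorem hom_ext {F G : X ⟶ Y} (h : gr F = gr G) : F = G :=
  Subtype.ext (congrArg (fun H : X.toGrRightModule ⟶ Y.toGrRightModule => H.1) h)

/-- The graded direct summand `ker p` of an `NDG` module, for a graded idempotent `p`, with the
differential obtained by projecting; it is an `N`-differential if the kernel or the image of `p` is
stable under `d`. -/
noncomputable def summand (Y : NDGRightModule.{w₀, w₁, u, w} 𝒜)
    (p : Y.toGrRightModule ⟶ Y.toGrRightModule) (hp : p ≫ p = p)
    (h : (∀ A x, p.1 A x = 0 → p.1 A (Y.d A x) = 0) ∨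
      ∀ A x, p.1 A (Y.d A (p.1 A x)) = Y.d A (p.1 A x)) :
    NDGRightModule.{w₀, w₁, u, w} 𝒜 where
  toGrRightModule := GrRightModule.ker p
  d A := (GrRightModule.kerπ p hp).1 A ∘ₗ Y.d A ∘ₗ (GrRightModule.kerι p).1 A
  d_mem A i x hx := (GrRightModule.kerπ p hp).2.1 A _ _ (add_zero _) _ (Y.d_mem A i x.1 hx)
  d_pow A := by
    rcases h with h | h
    · have key : ∀ n (x : (GrRightModule.ker p).obj A),
          ((((GrRightModule.kerπ p hp).1 A ∘ₗ Y.d A ∘ₗ (GrRightModule.kerι p).1 A) ^ n) x).1 =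
            (Y.d A ^ n) x.1 := fun n => by
        induction n with
        | zero => intro x; rfl
        | succ n ih =>
          intro x
          rw [pow_succ, pow_succ, Module.End.mul_apply, Module.End.mul_apply, ih]
          congr 1
          change Y.d A x.1 - p.1 A (Y.d A x.1) = Y.d A x.1
          rw [h A _ x.2, sub_zero]
      refine LinearMap.ext fun x => Subtype.ext ?_
      rw [key, Y.d_pow]
      rfl
    · have key : ∀ n (y : Y.obj A),
          (((GrRightModule.kerπ p hp).1 A ∘ₗ Y.d A ∘ₗ (GrRightModule.kerι p).1 A) ^ n)
            ((GrRightModule.kerπ p hp).1 A y) = (GrRightModule.kerπ p hp).1 A ((Y.d A ^ n) y) :=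
        fun n => by
        induction n with
        | zero => intro x; rfl
        | succ n ih =>
          intro y
          rw [pow_succ, pow_succ, Module.End.mul_apply, Module.End.mul_apply, ← ih]
          congr 1
          refine Subtype.ext ?_
          change Y.d A (y - p.1 A y) - p.1 A (Y.d A (y - p.1 A y)) = Y.d A y - p.1 A (Y.d A y)
          rw [map_sub, map_sub, h]
          abel
      refine LinearMap.ext fun x => ?_
      have hx : (GrRightModule.kerπ p hp).1 A x.1 = x :=
        congrArg (fun F : GrRightModule.ker p ⟶ GrRightModule.ker p => F.1 A x)
          (GrRightModule.kerι_kerπ p hp)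
      rw [← hx, key, Y.d_pow]
      exact map_zero _
  leibniz {A₁ A₂} r x f hx := by
    change (GrRightModule.kerπ p hp).1 A₂ (Y.d A₂ (Y.act x.1 f)) = _
    rw [Y.leibniz r x.1 f hx, map_add, map_smul, (GrRightModule.kerπ p hp).2.2]
    congr 2
    have hx : (GrRightModule.kerπ p hp).1 A₁ x.1 = x :=
      congrArg (fun F : GrRightModule.ker p ⟶ GrRightModule.ker p => F.1 A₁ x)
        (GrRightModule.kerι_kerπ p hp)
    rw [(GrRightModule.kerπ p hp).2.2, hx]

/-- A sequence which splits in the category of graded modules is a short exact sequence. -/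
theorem degreewiseSplit_iff (S : ShortComplex (NDGRightModule.{w₀, w₁, u, w} 𝒜)) :
    degreewiseSplit 𝒜 S ↔ Nonempty (S.map (forgetD 𝒜)).Splitting := by
  refine ⟨fun h => h.2, fun ⟨s⟩ => ⟨fun A => ?_, ⟨s⟩⟩⟩
  let r : S.X₂.toGrRightModule ⟶ S.X₁.toGrRightModule := s.r
  let t : S.X₃.toGrRightModule ⟶ S.X₂.toGrRightModule := s.s
  have hr : ∀ x, r.1 A (S.f.1 A x) = x := fun x =>
    congrArg (fun F : S.X₁.toGrRightModule ⟶ S.X₁.toGrRightModule => F.1 A x) s.f_r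
  have ht : ∀ x, S.g.1 A (t.1 A x) = x := fun x =>
    congrArg (fun F : S.X₃.toGrRightModule ⟶ S.X₃.toGrRightModule => F.1 A x) s.s_g
  have hrt : ∀ y, S.f.1 A (r.1 A y) + t.1 A (S.g.1 A y) = y := fun y =>
    congrArg (fun F : S.X₂.toGrRightModule ⟶ S.X₂.toGrRightModule => F.1 A y) s.id
  refine ⟨Function.LeftInverse.injective hr, fun y => ⟨fun hy => ⟨r.1 A y, ?_⟩, ?_⟩,
    Function.RightInverse.surjective ht⟩
  · have := hrt y
    rwa [hy, map_zero, add_zero] at this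
  · rintro ⟨x, rfl⟩
    exact congrArg (fun F : S.X₁ ⟶ S.X₃ => F.1 A x) S.zero

/-- A graded splitting makes a pair of composable morphisms a conflation. -/
theorem degreewiseSplit_mk {f : X ⟶ Y} {g : Y ⟶ Z} (w : f ≫ g = 0)
    (r : Y.toGrRightModule ⟶ X.toGrRightModule) (s : Z.toGrRightModule ⟶ Y.toGrRightModule)
    (hr : gr f ≫ r = 𝟙 _) (hs : s ≫ gr g = 𝟙 _) (hrs : r ≫ gr f + gr g ≫ s = 𝟙 _) :
    degreewiseSplit 𝒜 (ShortComplex.mk f g w) :=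
  (degreewiseSplit_iff _).2 ⟨{ r := r, s := s, f_r := hr, s_g := hs, id := hrs }⟩

theorem exists_of_degreewiseSplit {S : ShortComplex (NDGRightModule.{w₀, w₁, u, w} 𝒜)}
    (hS : degreewiseSplit 𝒜 S) :
    ∃ (r : S.X₂.toGrRightModule ⟶ S.X₁.toGrRightModule)
      (s : S.X₃.toGrRightModule ⟶ S.X₂.toGrRightModule),
      gr S.f ≫ r = 𝟙 _ ∧ s ≫ gr S.g = 𝟙 _ ∧ r ≫ gr S.f + gr S.g ≫ s = 𝟙 _ := by
  obtain ⟨-, ⟨s⟩⟩ := hS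
  exact ⟨s.r, s.s, s.f_r, s.s_g, s.id⟩

/-- Inflations are the morphisms with a graded retraction. -/
theorem isInflation_iff (f : X ⟶ Y) : IsInflation (degreewiseSplit 𝒜) f ↔
    ∃ r : Y.toGrRightModule ⟶ X.toGrRightModule, gr f ≫ r = 𝟙 _ := by
  constructor
  · rintro ⟨Z, g, w, hS⟩
    obtain ⟨r, s, hr, -, -⟩ := exists_of_degreewiseSplit hS
    exact ⟨r, hr⟩
  · rintro ⟨r, hr⟩
    let p : Y.toGrRightModule ⟶ Y.toGrRightModule := r ≫ gr f
    have hp : p ≫ p = p := by simp only [p, Category.assoc, reassoc_of% hr]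
    have hpd : ∀ A x, p.1 A (Y.d A (p.1 A x)) = Y.d A (p.1 A x) := fun A x => by
      have hrf : ∀ y, r.1 A (f.1 A y) = y := fun y =>
        congrArg (fun F : X.toGrRightModule ⟶ X.toGrRightModule => F.1 A y) hr
      change f.1 A (r.1 A (Y.d A (f.1 A (r.1 A x)))) = Y.d A (f.1 A (r.1 A x))
      rw [← hom_d, hrf]
    let g : Y ⟶ Y.summand p hp (Or.inr hpd) := homMk (GrRightModule.kerπ p hp) fun A y => by
      refine Subtype.ext ?_
      change Y.d A y - p.1 A (Y.d A y) = Y.d A (y - p.1 A y) - p.1 A (Y.d A (y - p.1 A y))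
      rw [map_sub, map_sub, hpd]
      abel
    have hfp : gr f ≫ p = gr f := by simp only [p, reassoc_of% hr]
    have w : f ≫ g = 0 := hom_ext (by
      change gr f ≫ GrRightModule.kerπ p hp = 0
      rw [← hfp, Category.assoc, GrRightModule.comp_kerπ, comp_zero])
    refine ⟨_, g, w, degreewiseSplit_mk w r (GrRightModule.kerι p) hr
      (GrRightModule.kerι_kerπ p hp) ?_⟩
    change p + GrRightModule.kerπ p hp ≫ GrRightModule.kerι p = 𝟙 _
    rw [GrRightModule.kerπ_kerι, add_sub_cancel]

/-- Deflations are the morphisms with a graded section. -/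
theorem isDeflation_iff (g : Y ⟶ Z) : IsDeflation (degreewiseSplit 𝒜) g ↔
    ∃ s : Z.toGrRightModule ⟶ Y.toGrRightModule, s ≫ gr g = 𝟙 _ := by
  constructor
  · rintro ⟨X, f, w, hS⟩
    obtain ⟨r, s, -, hs, -⟩ := exists_of_degreewiseSplit hS
    exact ⟨s, hs⟩
  · rintro ⟨s, hs⟩
    let p : Y.toGrRightModule ⟶ Y.toGrRightModule := gr g ≫ s
    have hp : p ≫ p = p := by simp only [p, Category.assoc, reassoc_of% hs]
    have hgs : ∀ A z, g.1 A (s.1 A z) = z := fun A z =>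
      congrArg (fun F : Z.toGrRightModule ⟶ Z.toGrRightModule => F.1 A z) hs
    have hpd : ∀ A x, p.1 A x = 0 → p.1 A (Y.d A x) = 0 := fun A x hx => by
      have hgx : g.1 A x = 0 := (hgs A _).symm.trans ((congrArg (g.1 A) hx).trans (map_zero _))
      change s.1 A (g.1 A (Y.d A x)) = 0
      rw [hom_d, hgx, map_zero, map_zero]
    let f : Y.summand p hp (Or.inl hpd) ⟶ Y := homMk (GrRightModule.kerι p) fun A y => by
      change Y.d A y.1 - p.1 A (Y.d A y.1) = Y.d A y.1
      rw [hpd A _ y.2, sub_zero]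
    have hpg : p ≫ gr g = gr g := by simp only [p, Category.assoc, hs, Category.comp_id]
    have w : f ≫ g = 0 := hom_ext (by
      change GrRightModule.kerι p ≫ gr g = 0
      rw [← hpg, reassoc_of% (GrRightModule.kerι_comp p), zero_comp])
    refine ⟨_, f, w, degreewiseSplit_mk w (GrRightModule.kerπ p hp) s
      (GrRightModule.kerι_kerπ p hp) hs ?_⟩
    change GrRightModule.kerπ p hp ≫ GrRightModule.kerι p + p = 𝟙 _
    rw [GrRightModule.kerπ_kerι, sub_add_cancel]

/-- The biproduct of a finite family of `NDG` modules. -/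
noncomputable def pi {ι : Type} [Finite ι] (X : ι → NDGRightModule.{w₀, w₁, u, w} 𝒜) :
    NDGRightModule.{w₀, w₁, u, w} 𝒜 where
  toGrRightModule := GrRightModule.pi (fun i => (X i).toGrRightModule) 0
  d A := LinearMap.pi fun i => (X i).d A ∘ₗ LinearMap.proj i
  d_mem A j x hx i _ := by
    have := (X i).d_mem A _ _ (hx i trivial)
    rwa [show j - (0 : ι → ℤ) i + 1 = j + 1 - (0 : ι → ℤ) i by ring] at this
  d_pow A := by
    have key : ∀ (n : ℕ) x i, ((LinearMap.pi fun i => (X i).d A ∘ₗ LinearMap.proj i :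
        (∀ i, (X i).obj A) →ₗ[k] ∀ i, (X i).obj A) ^ n) x i = ((X i).d A ^ n) (x i) := fun n => by
      induction n with
      | zero => intro x i; rfl
      | succ n ih =>
        intro x i
        rw [pow_succ, pow_succ, Module.End.mul_apply, Module.End.mul_apply, ih]
        rfl
    refine LinearMap.ext fun x => funext fun i => (key N x i).trans ?_
    rw [(X i).d_pow]
    rfl
  leibniz r x f hx := funext fun i => by
    have := (X i).leibniz r (x i) f (by
      have hi : x i ∈ ((X i).obj _).deg (r - 0) := hx i trivial
      rwa [sub_zero] at hi)
    exact this

theorem hasFiniteBiproducts : HasFiniteBiproducts (NDGRightModule.{w₀, w₁, u, w} 𝒜) := by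
  classical
  refine ⟨fun n => ⟨fun X => ?_⟩⟩
  let b : Bicone X :=
    { pt := pi X
      π := fun i => homMk ⟨fun A => LinearMap.proj i, fun A j j' h x hx => by
        obtain rfl : j = j' := by omega
        have hi : x i ∈ ((X i).obj A).deg (j - 0) := hx i trivial
        rwa [sub_zero] at hi, fun _ _ _ _ => rfl⟩ fun _ _ => rfl
      ι := fun i => homMk ⟨fun A => LinearMap.single k (fun i => (X i).obj A) i,
        fun A j j' h x hx i' _ => by
          obtain rfl : j = j' := by omega
          change Pi.single (M := fun i => (X i).obj A) i x i' ∈ ((X i').obj A).deg (j - 0)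
          rw [sub_zero]
          by_cases hi : i' = i
          · subst hi
            simpa using hx
          · simp [hi],
        fun A₁ A₂ x f => funext fun i' => by
          change Pi.single (M := fun i => (X i).obj A₂) i ((X i).act x f) i' =
            (X i').act (Pi.single (M := fun i => (X i).obj A₁) i x i') f
          by_cases hi : i' = i
          · subst hi
            simp
          · simp [hi]⟩ fun A x => funext fun i' => by
          change Pi.single (M := fun i => (X i).obj A) i ((X i).d A x) i' =
            (X i').d A (Pi.single (M := fun i => (X i).obj A) i x i')
          by_cases hi : i' = i
          · subst hi
            simp
          · simp [hi]
      ι_π := fun i j => by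
        split_ifs with h
        · subst h
          exact hom_ext (Subtype.ext (funext fun A => LinearMap.ext fun x => by
            change Pi.single (M := fun i => (X i).obj A) i x i = x
            simp))
        · exact hom_ext (Subtype.ext (funext fun A => LinearMap.ext fun x => by
            change Pi.single (M := fun i => (X i).obj A) i x j = 0
            simp [Ne.symm h])) }
  refine hasBiproduct_of_total b (hom_ext (Subtype.ext (funext fun A => LinearMap.ext fun x => ?_)))
  have key : ∀ s : Finset (Fin n), (gr (∑ i ∈ s, b.π i ≫ b.ι i)).1 A x =
      ∑ i ∈ s, Pi.single (M := fun i => (X i).obj A) i (x i) := fun s => by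
    induction s using Finset.induction with
    | empty => rfl
    | insert i s hi ih => rw [Finset.sum_insert hi, Finset.sum_insert hi, ← ih]; rfl
  exact (key _).trans (Finset.univ_sum_single x)

theorem inflation_id (X : NDGRightModule.{w₀, w₁, u, w} 𝒜) :
    IsInflation (degreewiseSplit 𝒜) (𝟙 X) :=
  (isInflation_iff _).2 ⟨𝟙 _, Category.comp_id _⟩

theorem deflation_id (X : NDGRightModule.{w₀, w₁, u, w} 𝒜) :
    IsDeflation (degreewiseSplit 𝒜) (𝟙 X) :=
  (isDeflation_iff _).2 ⟨𝟙 _, Category.comp_id _⟩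

theorem inflation_comp (f : X ⟶ Y) (g : Y ⟶ Z) (hf : IsInflation (degreewiseSplit 𝒜) f)
    (hg : IsInflation (degreewiseSplit 𝒜) g) : IsInflation (degreewiseSplit 𝒜) (f ≫ g) := by
  obtain ⟨r, hr⟩ := (isInflation_iff f).1 hf
  obtain ⟨r', hr'⟩ := (isInflation_iff g).1 hg
  refine (isInflation_iff _).2 ⟨r' ≫ r, ?_⟩
  rw [gr_comp, Category.assoc, reassoc_of% hr', hr]

theorem deflation_comp (f : X ⟶ Y) (g : Y ⟶ Z) (hf : IsDeflation (degreewiseSplit 𝒜) f)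
    (hg : IsDeflation (degreewiseSplit 𝒜) g) : IsDeflation (degreewiseSplit 𝒜) (f ≫ g) := by
  obtain ⟨s, hs⟩ := (isDeflation_iff f).1 hf
  obtain ⟨s', hs'⟩ := (isDeflation_iff g).1 hg
  refine (isDeflation_iff _).2 ⟨s' ≫ s, ?_⟩
  rw [gr_comp, Category.assoc, reassoc_of% hs, hs']

/-- The first morphism of a conflation is a kernel of the second. The factorization `gr h ≫ r`, a
priori only graded, commutes with `d` because `S.f` is injective. -/
theorem nonempty_isLimit {S : ShortComplex (NDGRightModule.{w₀, w₁, u, w} 𝒜)}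
    (hS : degreewiseSplit 𝒜 S) : Nonempty (IsLimit (KernelFork.ofι S.f S.zero)) := by
  obtain ⟨r, s, hr, hs, hrs⟩ := exists_of_degreewiseSplit hS
  have key : ∀ {W : NDGRightModule.{w₀, w₁, u, w} 𝒜} (h : W ⟶ S.X₂), h ≫ S.g = 0 →
      (gr h ≫ r) ≫ gr S.f = gr h := fun h hg => by
    have hg' : gr h ≫ gr S.g = 0 := congrArg gr hg
    have := gr h ≫= hrs
    rw [Preadditive.comp_add, reassoc_of% hg', zero_comp, add_zero, Category.comp_id] at this
    rw [Category.assoc, this]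
  refine ⟨KernelFork.IsLimit.ofι _ _ (fun {W} h hg => homMk (gr h ≫ r) fun A x => ?_)
    (fun h hg => hom_ext (key h hg)) fun h hg m hm => hom_ext ?_⟩
  · have hk : ∀ y, S.f.1 A ((gr h ≫ r).1 A y) = h.1 A y := fun y =>
      congrArg (fun F : W.toGrRightModule ⟶ S.X₂.toGrRightModule => F.1 A y) (key h hg)
    refine (hS.1 A).1 ?_
    rw [hk, hom_d, hom_d, hk]
  · rw [gr_homMk, ← hm, gr_comp, Category.assoc, hr, Category.comp_id]

/-- The second morphism of a conflation is a cokernel of the first. The factorization `s ≫ gr h`, a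
priori only graded, commutes with `d` because `S.g` is surjective. -/
theorem nonempty_isColimit {S : ShortComplex (NDGRightModule.{w₀, w₁, u, w} 𝒜)}
    (hS : degreewiseSplit 𝒜 S) : Nonempty (IsColimit (CokernelCofork.ofπ S.g S.zero)) := by
  obtain ⟨r, s, hr, hs, hrs⟩ := exists_of_degreewiseSplit hS
  have key : ∀ {W : NDGRightModule.{w₀, w₁, u, w} 𝒜} (h : S.X₂ ⟶ W), S.f ≫ h = 0 →
      gr S.g ≫ s ≫ gr h = gr h := fun h hf => by
    have hf' : gr S.f ≫ gr h = 0 := congrArg gr hf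
    have := hrs =≫ gr h
    rwa [Preadditive.add_comp, Category.assoc, hf', comp_zero, zero_add, Category.id_comp,
      Category.assoc] at this
  refine ⟨CokernelCofork.IsColimit.ofπ _ _ (fun {W} h hf => homMk (s ≫ gr h) fun A x => ?_)
    (fun h hf => hom_ext (key h hf)) fun h hf m hm => hom_ext ?_⟩
  · have hk : ∀ y, (s ≫ gr h).1 A (S.g.1 A y) = h.1 A y := fun y =>
      congrArg (fun F : S.X₂.toGrRightModule ⟶ W.toGrRightModule => F.1 A y) (key h hf)
    obtain ⟨y, rfl⟩ := (hS.1 A).2.2 x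
    rw [hk, ← hom_d, ← hom_d, hk]
  · rw [gr_homMk, ← hm, gr_comp, reassoc_of% hs]

/-- The pushout is the cokernel of `(f, -a) : X ⟶ Y ⊞ X'`, which is an inflation since `f` is. -/
theorem exists_isPushout {X' : NDGRightModule.{w₀, w₁, u, w} 𝒜} (f : X ⟶ Y) (a : X ⟶ X')
    (hf : IsInflation (degreewiseSplit 𝒜) f) :
    ∃ (Y' : NDGRightModule.{w₀, w₁, u, w} 𝒜) (b : Y ⟶ Y') (f' : X' ⟶ Y'),
      IsPushout f a b f' ∧ IsInflation (degreewiseSplit 𝒜) f' := by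
  have := hasFiniteBiproducts (𝒜 := 𝒜)
  have := hasBinaryBiproducts_of_finite_biproducts (NDGRightModule.{w₀, w₁, u, w} 𝒜)
  obtain ⟨r, hr⟩ := (isInflation_iff f).1 hf
  have hinl : gr (biprod.inl : Y ⟶ Y ⊞ X') ≫ gr biprod.fst = 𝟙 _ := congrArg gr biprod.inl_fst
  have hinr : gr (biprod.inr : X' ⟶ Y ⊞ X') ≫ gr biprod.fst = 0 := congrArg gr biprod.inr_fst
  have hinr' : gr (biprod.inr : X' ⟶ Y ⊞ X') ≫ gr biprod.snd = 𝟙 _ := congrArg gr biprod.inr_snd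
  have hfst : gr (biprod.lift f (-a)) ≫ gr biprod.fst = gr f := congrArg gr (biprod.lift_fst _ _)
  have hsnd : gr (biprod.lift f (-a)) ≫ gr biprod.snd = -gr a := congrArg gr (biprod.lift_snd _ _)
  have hl : IsInflation (degreewiseSplit 𝒜) (biprod.lift f (-a)) :=
    (isInflation_iff _).2 ⟨gr biprod.fst ≫ r, by rw [reassoc_of% hfst, hr]⟩
  obtain ⟨Y', p, w, hS⟩ := hl
  obtain ⟨hc⟩ := nonempty_isColimit hS
  obtain ⟨r', s, hr', hs, hrs⟩ := exists_of_degreewiseSplit hS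
  dsimp only at r' s hr' hs hrs
  have hw : f ≫ biprod.inl ≫ p = a ≫ biprod.inr ≫ p := by
    have : biprod.lift f (-a) = f ≫ biprod.inl - a ≫ biprod.inr := by ext <;> simp
    rw [this, Preadditive.sub_comp, sub_eq_zero, Category.assoc, Category.assoc] at w
    exact w
  refine ⟨Y', biprod.inl ≫ p, biprod.inr ≫ p, ⟨⟨hw⟩, ⟨?_⟩⟩, (isInflation_iff _).2
    ⟨s ≫ (gr biprod.fst ≫ r ≫ gr a + gr biprod.snd), ?_⟩⟩
  · refine PushoutCocone.IsColimit.mk hw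
      (fun c => (CokernelCofork.IsColimit.desc' hc (biprod.desc c.inl c.inr) ?_).1)
      (fun c => ?_) (fun c => ?_) fun c m hm₁ hm₂ => ?_
    · simp [c.condition]
    · have := (CokernelCofork.IsColimit.desc' hc (biprod.desc c.inl c.inr)
        (by simp [c.condition])).2
      rw [Category.assoc]
      exact (biprod.inl ≫= this).trans (biprod.inl_desc _ _)
    · have := (CokernelCofork.IsColimit.desc' hc (biprod.desc c.inl c.inr)
        (by simp [c.condition])).2
      rw [Category.assoc]
      exact (biprod.inr ≫= this).trans (biprod.inr_desc _ _)
    · have := (CokernelCofork.IsColimit.desc' hc (biprod.desc c.inl c.inr)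
        (by simp [c.condition])).2
      refine Cofork.IsColimit.hom_ext hc (Eq.trans ?_ this.symm)
      change p ≫ m = _
      ext
      · simpa using hm₁
      · simpa using hm₂
  · -- The map `gr fst ≫ r ≫ gr a + gr snd` vanishes on the kernel of `p`, so precomposing it with
    -- `gr p ≫ s` does not change it.
    have h0 : gr (biprod.lift f (-a)) ≫ (gr biprod.fst ≫ r ≫ gr a + gr biprod.snd) = 0 := by
      rw [Preadditive.comp_add, reassoc_of% hfst, reassoc_of% hr, hsnd, add_neg_cancel]
    have h1 := hrs =≫ (gr biprod.fst ≫ r ≫ gr a + gr biprod.snd)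
    rw [Preadditive.add_comp, Category.assoc, h0, comp_zero, zero_add, Category.id_comp,
      Category.assoc] at h1
    rw [gr_comp, Category.assoc, h1, Preadditive.comp_add, reassoc_of% hinr, zero_comp, zero_add,
      hinr']

/-- The pullback is the kernel of `(g, -c) : Y ⊞ Z' ⟶ Z`, which is a deflation since `g` is. -/
theorem exists_isPullback {Z' : NDGRightModule.{w₀, w₁, u, w} 𝒜} (g : Y ⟶ Z) (c : Z' ⟶ Z)
    (hg : IsDeflation (degreewiseSplit 𝒜) g) :
    ∃ (Y' : NDGRightModule.{w₀, w₁, u, w} 𝒜) (b : Y' ⟶ Y) (g' : Y' ⟶ Z'),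
      IsPullback b g' g c ∧ IsDeflation (degreewiseSplit 𝒜) g' := by
  have := hasFiniteBiproducts (𝒜 := 𝒜)
  have := hasBinaryBiproducts_of_finite_biproducts (NDGRightModule.{w₀, w₁, u, w} 𝒜)
  obtain ⟨s, hs⟩ := (isDeflation_iff g).1 hg
  have hsnd : gr (biprod.inl : Y ⟶ Y ⊞ Z') ≫ gr biprod.snd = 0 := congrArg gr biprod.inl_snd
  have hsnd' : gr (biprod.inr : Z' ⟶ Y ⊞ Z') ≫ gr biprod.snd = 𝟙 _ := congrArg gr biprod.inr_snd
  have hinl : gr biprod.inl ≫ gr (biprod.desc g (-c)) = gr g := congrArg gr (biprod.inl_desc _ _)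
  have hinr : gr biprod.inr ≫ gr (biprod.desc g (-c)) = -gr c := congrArg gr (biprod.inr_desc _ _)
  have hl : IsDeflation (degreewiseSplit 𝒜) (biprod.desc g (-c)) :=
    (isDeflation_iff _).2 ⟨s ≫ gr biprod.inl, by rw [Category.assoc, hinl, hs]⟩
  obtain ⟨Y', i, w, hS⟩ := hl
  obtain ⟨hc⟩ := nonempty_isLimit hS
  obtain ⟨r, s', hr, hs', hrs⟩ := exists_of_degreewiseSplit hS
  dsimp only at r s' hr hs' hrs
  have hw : (i ≫ biprod.fst) ≫ g = (i ≫ biprod.snd) ≫ c := by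
    have : biprod.desc g (-c) = biprod.fst ≫ g - biprod.snd ≫ c := by ext <;> simp
    rw [this, Preadditive.comp_sub, sub_eq_zero] at w
    rw [Category.assoc, Category.assoc]
    exact w
  refine ⟨Y', i ≫ biprod.fst, i ≫ biprod.snd, ⟨⟨hw⟩, ⟨?_⟩⟩, (isDeflation_iff _).2
    ⟨(gr c ≫ s ≫ gr biprod.inl + gr biprod.inr) ≫ r, ?_⟩⟩
  · refine PullbackCone.IsLimit.mk hw
      (fun c' => (KernelFork.IsLimit.lift' hc (biprod.lift c'.fst c'.snd) ?_).1)
      (fun c' => ?_) (fun c' => ?_) fun c' m hm₁ hm₂ => ?_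
    · simp [c'.condition]
    · have := (KernelFork.IsLimit.lift' hc (biprod.lift c'.fst c'.snd)
        (by simp [c'.condition])).2
      rw [← Category.assoc]
      exact (this =≫ biprod.fst).trans (biprod.lift_fst _ _)
    · have := (KernelFork.IsLimit.lift' hc (biprod.lift c'.fst c'.snd)
        (by simp [c'.condition])).2
      rw [← Category.assoc]
      exact (this =≫ biprod.snd).trans (biprod.lift_snd _ _)
    · have := (KernelFork.IsLimit.lift' hc (biprod.lift c'.fst c'.snd)
        (by simp [c'.condition])).2
      refine Fork.IsLimit.hom_ext hc (Eq.trans ?_ this.symm)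
      change m ≫ i = _
      ext
      · simpa using hm₁
      · simpa using hm₂
  · -- The map `gr c ≫ s ≫ gr inl + gr inr` lands in the kernel of `desc g (-c)`, so composing it
    -- with `r ≫ gr i` does not change it.
    have h0 : (gr c ≫ s ≫ gr biprod.inl + gr biprod.inr) ≫ gr (biprod.desc g (-c)) = 0 := by
      rw [Preadditive.add_comp, Category.assoc, Category.assoc, hinl, hs, hinr, Category.comp_id,
        add_neg_cancel]
    have h1 := (gr c ≫ s ≫ gr biprod.inl + gr biprod.inr) ≫= hrs
    rw [Preadditive.comp_add, reassoc_of% h0, zero_comp, add_zero, Category.comp_id] at h1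
    rw [gr_comp, Category.assoc, reassoc_of% h1, Preadditive.add_comp, Category.assoc,
      Category.assoc, hsnd, comp_zero, comp_zero, zero_add, hsnd']

variable (𝒜) in
theorem isExactCategory : IsExactCategory (degreewiseSplit.{w₀, w₁, u, w} 𝒜) where
  additive := hasFiniteBiproducts
  iso_closed := fun S S' ⟨e⟩ hS => (degreewiseSplit_iff S').2
    (((degreewiseSplit_iff S).1 hS).map fun s =>
      s.ofIso ((forgetD 𝒜).mapShortComplex.mapIso e))
  kernel _ := nonempty_isLimit
  cokernel _ := nonempty_isColimit
  id_inflation := inflation_id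
  id_deflation := deflation_id
  comp_inflation := inflation_comp
  comp_deflation := deflation_comp
  pushout := exists_isPushout
  pullback := exists_isPullback

end NDGRightModule

end Modules

/-! ### Sums of two `q`-commuting nilpotent operators -/

section QBinomial

variable {k : Type w₀} [CommRing k]

/-- The Gaussian binomial coefficients, defined by the `q`-Pascal rule. -/
def qChoose (q : k) : ℕ → ℕ → k
  | _, 0 => 1
  | 0, _ + 1 => 0
  | n + 1, j + 1 => qChoose q n j + q ^ (j + 1) * qChoose q n (j + 1)

theorem qChoose_zero_right (q : k) (n : ℕ) : qChoose q n 0 = 1 := by cases n <;> rfl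

theorem qChoose_of_lt (q : k) : ∀ {n j : ℕ}, n < j → qChoose q n j = 0
  | 0, j + 1, _ => rfl
  | n + 1, j + 1, h => by
    rw [qChoose, qChoose_of_lt q (by omega), qChoose_of_lt q (by omega), mul_zero, add_zero]

/-- The quotient of two consecutive Gaussian binomial coefficients, without denominators. -/
theorem qChoose_succ_right (q : k) : ∀ n j : ℕ,
    (q ^ (j + 1) - 1) * q ^ j * qChoose q n (j + 1) = (q ^ n - q ^ j) * qChoose q n j
  | 0, 0 => by simp [qChoose]
  | 0, j + 1 => by simp [qChoose]
  | n + 1, 0 => by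
    have h := qChoose_succ_right q n 0
    simp only [qChoose, qChoose_zero_right] at h ⊢
    linear_combination q * h
  | n + 1, j + 1 => by
    have h := qChoose_succ_right q n j
    have h' := qChoose_succ_right q n (j + 1)
    simp only [qChoose]
    linear_combination q ^ (j + 2) * h' + q * h

theorem qChoose_eq_zero {N : ℕ} {q : kˣ} (hq : IsPrimitiveRootOfOne q N) :
    ∀ {j : ℕ}, 0 < j → j < N → qChoose (q : k) N j = 0
  | j + 1, _, hj => by
    have h := qChoose_succ_right (q : k) N j
    have h0 : ((q : k) ^ N - (q : k) ^ j) * qChoose (q : k) N j = 0 := by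
      rcases Nat.eq_zero_or_pos j with rfl | hj'
      · rw [hq.1, pow_zero, sub_self, zero_mul]
      · rw [qChoose_eq_zero hq hj' (by omega), mul_zero]
    rw [h0, mul_assoc] at h
    have h1 := (mem_nonZeroDivisors_iff.1 (hq.2 (j + 1) (by omega) hj)).1 _ h
    exact ((q.isUnit.pow j).mul_right_eq_zero).1 h1

variable {R : Type*} [Ring R] [Algebra k R]

theorem mul_pow_of_qCommute {q : k} {a b : R} (h : b * a = q • (a * b)) :
    ∀ n : ℕ, b * a ^ n = q ^ n • (a ^ n * b)
  | 0 => by simp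
  | n + 1 => by
    rw [pow_succ, ← mul_assoc, mul_pow_of_qCommute h n, smul_mul_assoc, mul_assoc, h,
      mul_smul_comm, smul_smul, pow_succ, mul_assoc]

/-- The `q`-binomial formula. -/
theorem add_pow_of_qCommute {q : k} {a b : R} (h : b * a = q • (a * b)) (n : ℕ) :
    (a + b) ^ n = ∑ j ∈ Finset.range (n + 1), qChoose q n j • (a ^ j * b ^ (n - j)) := by
  induction n with
  | zero => simp [qChoose]
  | succ n ih =>
    have h1 : ∀ j ∈ Finset.range (n + 1), b * (qChoose q n j • (a ^ j * b ^ (n - j))) =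
        (q ^ j * qChoose q n j) • (a ^ j * b ^ (n + 1 - j)) := fun j hj => by
      rw [Finset.mem_range] at hj
      rw [mul_smul_comm, ← mul_assoc, mul_pow_of_qCommute h, smul_mul_assoc, mul_assoc, ← pow_succ',
        smul_smul, mul_comm (q ^ j), show n - j + 1 = n + 1 - j by omega]
    have h2 : ∑ j ∈ Finset.range (n + 1), (q ^ j * qChoose q n j) • (a ^ j * b ^ (n + 1 - j)) =
        ∑ j ∈ Finset.range (n + 2), (q ^ j * qChoose q n j) • (a ^ j * b ^ (n + 1 - j)) := by
      rw [Finset.sum_range_succ _ (n + 1), qChoose_of_lt q (Nat.lt_succ_self n), mul_zero,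
        zero_smul, add_zero]
    rw [pow_succ', ih, add_mul, Finset.mul_sum, Finset.mul_sum, Finset.sum_congr rfl h1, h2,
      Finset.sum_range_succ' _ (n + 1), Finset.sum_range_succ' _ (n + 1), ← add_assoc,
      ← Finset.sum_add_distrib]
    congr 1
    · refine Finset.sum_congr rfl fun j _ => ?_
      rw [mul_smul_comm, ← mul_assoc, ← pow_succ', Nat.add_sub_add_right, ← add_smul, qChoose]
    · simp [qChoose_zero_right]

/-- The mixed terms of `(a + b) ^ N` vanish if `b a = q a b` for a primitive `N`-th root of unity
`q`. -/
theorem add_pow_eq_zero_of_qCommute {N : ℕ} {q : kˣ} (hq : IsPrimitiveRootOfOne q N) {a b : R}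
    (h : b * a = (q : k) • (a * b)) (ha : a ^ N = 0) (hb : b ^ N = 0) : (a + b) ^ N = 0 := by
  rw [add_pow_of_qCommute h]
  refine Finset.sum_eq_zero fun j hj => ?_
  rw [Finset.mem_range] at hj
  rcases Nat.eq_zero_or_pos j with rfl | hj0
  · rw [Nat.sub_zero, hb, mul_zero, smul_zero]
  · rcases Nat.lt_or_ge j N with hjN | hjN
    · rw [qChoose_eq_zero hq hj0 hjN, zero_smul]
    · rw [show j = N by omega, ha, zero_mul, smul_zero]

end QBinomial

/-! ### The Hom `N`-complex -/

section HomComplex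

variable {k : Type w₀} [CommRing k] {N : ℕ} {q : kˣ} {𝒜 : NqDGCat.{w₀, w₁, u} k N q}
  {X Y : NDGRightModule.{w₀, w₁, u, w} 𝒜}

theorem homD_apply (i : ℤ) (F : Fam X.toGrRightModule Y.toGrRightModule) (A : 𝒜.Obj)
    (x : X.obj A) : homD X Y i F A x = Y.d A (F A x) - ((q ^ i : kˣ) : k) • F A (X.d A x) := rfl

theorem homD_mem {i j : ℤ} (hij : i + 1 = j) {F : Fam X.toGrRightModule Y.toGrRightModule}
    (hF : F ∈ grHom X.toGrRightModule Y.toGrRightModule i) :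
    homD X Y i F ∈ grHom X.toGrRightModule Y.toGrRightModule j := by
  subst hij
  have h_deg : ∀ (A : 𝒜.Obj) (l m : ℤ), l + (i + 1) = m → ∀ x ∈ (X.obj A).deg l,
      homD X Y i F A x ∈ (Y.obj A).deg m := fun A l m h x hx => by
    rw [homD_apply]
    refine sub_mem ?_ (Submodule.smul_mem _ _ (hF.1 A _ _ (by omega) _ (X.d_mem A l x hx)))
    rw [← show l + i + 1 = m by omega]
    exact Y.d_mem A _ _ (hF.1 A _ _ rfl x hx)
  refine ⟨h_deg, fun A₁ A₂ x f => ?_⟩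
  refine (X.obj A₁).induction (motive := fun x => homD X Y i F A₂ (X.act x f) =
    Y.act (homD X Y i F A₁ x) f) (fun x y hx hy => ?_) ?_ (fun l x hx => ?_) x
  · simp only [map_add, LinearMap.add_apply, hx, hy]
  · simp only [map_zero, LinearMap.zero_apply]
  · rw [homD_apply, homD_apply, hF.2, Y.leibniz (l + i) _ _ (hF.1 A₁ l _ rfl x hx),
      X.leibniz l x f hx]
    simp only [map_add, map_smul, map_sub, LinearMap.sub_apply, LinearMap.smul_apply, hF.2,
      smul_add, smul_smul, ← Units.val_mul, ← zpow_add, add_comm l i]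
    abel

/-- The definition of `homDPow` peels off the first differential; this peels off the last one. -/
theorem homDPow_succ' (r : ℕ) : ∀ (i j : ℤ) (_ : i + r = j)
    (F : Fam X.toGrRightModule Y.toGrRightModule),
    homDPow X Y (r + 1) i F = homD X Y j (homDPow X Y r i F) := by
  induction r with
  | zero =>
    intro i j h F
    obtain rfl : i = j := by simpa using h
    rfl
  | succ r ih =>
    intro i j h F
    exact ih (i + 1) j (by push_cast at h; omega) (homD X Y i F)

theorem homDPow_mem (r : ℕ) {i j : ℤ} (h : i + r = j)
    {F : Fam X.toGrRightModule Y.toGrRightModule}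
    (hF : F ∈ grHom X.toGrRightModule Y.toGrRightModule i) :
    homDPow X Y r i F ∈ grHom X.toGrRightModule Y.toGrRightModule j := by
  induction r generalizing j with
  | zero =>
    obtain rfl : i = j := by simpa using h
    exact hF
  | succ r ih =>
    rw [homDPow_succ' r i _ rfl]
    exact homD_mem (by push_cast at h; omega) (ih rfl)

/-- The Hom `N`-complex is an `N`-complex: its differential, acting on all sequences of families of
maps, is the sum of the `q`-commuting operators of composing with `d_Y` and with `d_X`. -/
theorem homDPow_eq_zero (hq : IsPrimitiveRootOfOne q N) (i : ℤ)
    (F : Fam X.toGrRightModule Y.toGrRightModule) : homDPow X Y N i F = 0 := by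
  let V := ℤ → Fam X.toGrRightModule Y.toGrRightModule
  let a : Module.End k V :=
    { toFun := fun v j A => Y.d A ∘ₗ v (j - 1) A
      map_add' := fun v v' => funext fun j => funext fun A => LinearMap.comp_add _ _ _
      map_smul' := fun c v => funext fun j => funext fun A => LinearMap.comp_smul _ _ _ }
  let b : Module.End k V :=
    { toFun := fun v j A => -(((q ^ (j - 1) : kˣ) : k) • (v (j - 1) A ∘ₗ X.d A))
      map_add' := fun v v' => funext fun j => funext fun A => LinearMap.ext fun x => by
        change -(((q ^ (j - 1) : kˣ) : k) • (v (j - 1) A (X.d A x) + v' (j - 1) A (X.d A x))) =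
          -(((q ^ (j - 1) : kˣ) : k) • v (j - 1) A (X.d A x)) +
            -(((q ^ (j - 1) : kˣ) : k) • v' (j - 1) A (X.d A x))
        rw [smul_add, neg_add]
      map_smul' := fun c v => funext fun j => funext fun A => LinearMap.ext fun x => by
        change -(((q ^ (j - 1) : kˣ) : k) • c • v (j - 1) A (X.d A x)) =
          c • -(((q ^ (j - 1) : kˣ) : k) • v (j - 1) A (X.d A x))
        rw [smul_neg, smul_comm] }
  have hab : b * a = (q : k) • (a * b) := by
    refine LinearMap.ext fun v => funext fun j => funext fun A => LinearMap.ext fun x => ?_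
    change -(((q ^ (j - 1) : kˣ) : k) • Y.d A (v (j - 1 - 1) A (X.d A x))) =
      (q : k) • Y.d A (-(((q ^ (j - 1 - 1) : kˣ) : k) • v (j - 1 - 1) A (X.d A x)))
    rw [map_neg, map_smul, smul_neg, smul_smul, ← Units.val_mul, ← zpow_one_add,
      show 1 + (j - 1 - 1) = j - 1 by ring]
  have ha : ∀ (n : ℕ) (v : V) (j : ℤ) (A : 𝒜.Obj) (x : X.obj A),
      (a ^ n) v j A x = (Y.d A ^ n) (v (j - n) A x) := fun n => by
    induction n with
    | zero => intro v j A x; simp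
    | succ n ih =>
      intro v j A x
      rw [pow_succ, pow_succ, Module.End.mul_apply, Module.End.mul_apply, ih,
        show j - ((n + 1 : ℕ) : ℤ) = j - n - 1 by push_cast; ring]
      rfl
  have hb : ∀ (n : ℕ) (v : V) (j : ℤ) (A : 𝒜.Obj), ∃ c : k, ∀ x : X.obj A,
      (b ^ n) v j A x = c • v (j - n) A ((X.d A ^ n) x) := fun n => by
    induction n with
    | zero => intro v j A; exact ⟨1, fun x => by simp⟩
    | succ n ih =>
      intro v j A
      obtain ⟨c, hc⟩ := ih (b v) j A
      refine ⟨c * -((q ^ (j - n - 1) : kˣ) : k), fun x => ?_⟩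
      rw [pow_succ, pow_succ', Module.End.mul_apply, Module.End.mul_apply, hc,
        show j - ((n + 1 : ℕ) : ℤ) = j - n - 1 by push_cast; ring, mul_smul, neg_smul]
      rfl
  -- `a + b` sends `v` to the sequence with `homD (v l)` in place `l + 1`.
  have hT : ∀ (n : ℕ) (v : V) (j l : ℤ), l + n = j →
      ((a + b) ^ n) v j = homDPow X Y n l (v l) := fun n => by
    induction n with
    | zero =>
      intro v j l h
      obtain rfl : l = j := by simpa using h
      rfl
    | succ n ih =>
      intro v j l h
      rw [pow_succ, Module.End.mul_apply, ih _ j (l + 1) (by push_cast at h; omega)]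
      change _ = homDPow X Y n (l + 1) (homD X Y l (v l))
      congr 1
      funext A
      refine LinearMap.ext fun x => ?_
      change Y.d A (v (l + 1 - 1) A x) +
        -(((q ^ (l + 1 - 1) : kˣ) : k) • v (l + 1 - 1) A (X.d A x)) = _
      rw [add_sub_cancel_right, ← sub_eq_add_neg]
      rfl
  have h0 : (a + b) ^ N = 0 := by
    refine add_pow_eq_zero_of_qCommute hq hab ?_ ?_
    · refine LinearMap.ext fun v => funext fun j => funext fun A => LinearMap.ext fun x => ?_
      rw [ha, Y.d_pow]
      rfl
    · refine LinearMap.ext fun v => funext fun j => funext fun A => LinearMap.ext fun x => ?_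
      obtain ⟨c, hc⟩ := hb N v j A
      rw [hc, X.d_pow, LinearMap.zero_apply, map_zero, smul_zero]
      rfl
  rw [← hT N (fun _ => F) (i + N) i rfl, h0]
  rfl

end HomComplex

/-! ### The cone, free and cofree on a graded module -/

section Shift

variable (k : Type*) [CommRing k] (N : ℕ) (M : Type*) [AddCommGroup M] [Module k M]

/-- The nilpotent operator that moves each entry of a vector of length `N` one place up. -/
def shiftUp : Module.End k (Fin N → M) where
  toFun x i := if 0 < i.1 then x ⟨i.1 - 1, by omega⟩ else 0
  map_add' x y := funext fun i => by
    change (if 0 < i.1 then x _ + y _ else 0) =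
      (if 0 < i.1 then x _ else 0) + if 0 < i.1 then y _ else 0
    split_ifs <;> simp
  map_smul' c x := funext fun i => by
    change (if 0 < i.1 then c • x _ else 0) = c • if 0 < i.1 then x _ else 0
    split_ifs <;> simp

variable {k N M}

theorem shiftUp_of_pos (x : Fin N → M) {i : Fin N} (hi : 0 < i.1) :
    shiftUp k N M x i = x ⟨i.1 - 1, by omega⟩ := if_pos hi

theorem shiftUp_of_eq_zero (x : Fin N → M) {i : Fin N} (hi : i.1 = 0) :
    shiftUp k N M x i = 0 := if_neg (by omega)

theorem shiftUp_single (i j : Fin N) (h : i.1 + 1 = j.1) (x : M) :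
    shiftUp k N M (Pi.single i x) = Pi.single j x := by
  funext l
  rcases Nat.eq_zero_or_pos l.1 with hl | hl
  · rw [shiftUp_of_eq_zero _ hl, Pi.single_eq_of_ne]
    rintro rfl
    omega
  · rw [shiftUp_of_pos _ hl, Pi.single_apply, Pi.single_apply]
    simp only [Fin.ext_iff]
    exact if_congr (by omega) rfl rfl

theorem shiftUp_pow_eq_zero : shiftUp k N M ^ N = 0 := by
  have key : ∀ (n : ℕ) (x : Fin N → M) (i : Fin N), i.1 < n → (shiftUp k N M ^ n) x i = 0 :=
    fun n => by
    induction n with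
    | zero => intro x i h; omega
    | succ n ih =>
      intro x i h
      rw [pow_succ', Module.End.mul_apply]
      rcases Nat.eq_zero_or_pos i.1 with hi | hi
      · exact shiftUp_of_eq_zero _ hi
      · rw [shiftUp_of_pos _ hi]
        exact ih _ _ (by dsimp only; omega)
  exact LinearMap.ext fun x => funext fun i => key N x i i.2

/-- Summation by parts. -/
theorem sum_shiftUp {M' : Type*} [AddCommGroup M'] [Module k M'] (F : ℕ → M →ₗ[k] M')
    (hF : F N = 0) (x : Fin N → M) :
    ∑ i : Fin N, F i (shiftUp k N M x i) = ∑ i : Fin N, F (i + 1) (x i) := by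
  cases N with
  | zero => simp
  | succ n =>
    rw [Fin.sum_univ_succ, Fin.sum_univ_castSucc (fun i => F (i + 1) (x i)),
      shiftUp_of_eq_zero _ rfl, map_zero, zero_add, Fin.val_last, hF, LinearMap.zero_apply,
      add_zero]
    refine Finset.sum_congr rfl fun i _ => ?_
    rw [shiftUp_of_pos _ (Nat.succ_pos _)]
    rfl

end Shift

section Cofree

variable {k : Type w₀} [CommRing k] {N : ℕ} {q : kˣ} {𝒜 : NqDGCat.{w₀, w₁, u} k N q}

namespace NDGRightModule

variable {X Y : NDGRightModule.{w₀, w₁, u, w} 𝒜} (hq : IsPrimitiveRootOfOne q N)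

/-- The differential of the cone. -/
noncomputable def coneD (X : NDGRightModule.{w₀, w₁, u, w} 𝒜) (m : ℤ) (A : 𝒜.Obj) :
    Module.End k (Fin N → X.obj A) :=
  shiftUp k N (X.obj A) +
    LinearMap.pi fun i : Fin N => ((q ^ (m + i) : kˣ) : k) • X.d A ∘ₗ LinearMap.proj i

theorem coneD_apply (m : ℤ) (A : 𝒜.Obj) (x : Fin N → X.obj A) (i : Fin N) :
    X.coneD m A x i =
      shiftUp k N (X.obj A) x i + ((q ^ (m + i) : kˣ) : k) • X.d A (x i) := rfl

theorem coneD_mem {m j : ℤ} {A : 𝒜.Obj} {x : Fin N → X.obj A}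
    (hx : ∀ i : Fin N, x i ∈ (X.obj A).deg (j - (m + i))) (i : Fin N) :
    X.coneD m A x i ∈ (X.obj A).deg (j + 1 - (m + i)) := by
  rw [coneD_apply]
  refine add_mem ?_ (Submodule.smul_mem _ _ ?_)
  · rcases Nat.eq_zero_or_pos i.1 with hi | hi
    · rw [shiftUp_of_eq_zero _ hi]
      exact zero_mem _
    · rw [shiftUp_of_pos _ hi]
      have := hx ⟨i.1 - 1, by omega⟩
      rwa [show j - (m + ((i.1 - 1 : ℕ) : ℤ)) = j + 1 - (m + i) by omega] at this
  · have := X.d_mem A _ _ (hx i)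
    rwa [show j - (m + i) + 1 = j + 1 - (m + (i : ℤ)) by ring] at this

/-- The two summands of the differential are nilpotent of order `N` and `q`-commute. -/
theorem coneD_pow (hq : IsPrimitiveRootOfOne q N) (m : ℤ) (A : 𝒜.Obj) :
    X.coneD m A ^ N = 0 := by
  refine add_pow_eq_zero_of_qCommute hq ?_ shiftUp_pow_eq_zero ?_
  · refine LinearMap.ext fun x => funext fun i => ?_
    change ((q ^ (m + i) : kˣ) : k) • X.d A (shiftUp k N (X.obj A) x i) =
      (q : k) • shiftUp k N (X.obj A) (fun i => ((q ^ (m + i) : kˣ) : k) • X.d A (x i)) i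
    rcases Nat.eq_zero_or_pos i.1 with hi | hi
    · rw [shiftUp_of_eq_zero _ hi, shiftUp_of_eq_zero _ hi, map_zero, smul_zero, smul_zero]
    · rw [shiftUp_of_pos _ hi, shiftUp_of_pos _ hi, smul_smul, ← Units.val_mul, ← zpow_one_add,
        show 1 + (m + ((i.1 - 1 : ℕ) : ℤ)) = m + i by omega]
  · have key : ∀ n : ℕ, ∃ c : Fin N → k, ∀ (x : Fin N → X.obj A) (i : Fin N),
        ((LinearMap.pi fun i : Fin N => ((q ^ (m + i) : kˣ) : k) • X.d A ∘ₗ LinearMap.proj i :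
          Module.End k (Fin N → X.obj A)) ^ n) x i = c i • (X.d A ^ n) (x i) := fun n => by
      induction n with
      | zero => exact ⟨fun _ => 1, fun x i => by simp⟩
      | succ n ih =>
        obtain ⟨c, hc⟩ := ih
        refine ⟨fun i => c i * ((q ^ (m + i) : kˣ) : k), fun x i => ?_⟩
        rw [pow_succ, pow_succ, Module.End.mul_apply, Module.End.mul_apply, hc, mul_smul,
          ← map_smul (X.d A ^ n) ((q ^ (m + i) : kˣ) : k)]
        rfl
    obtain ⟨c, hc⟩ := key N
    refine LinearMap.ext fun x => funext fun i => ?_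
    rw [hc, X.d_pow, LinearMap.zero_apply, smul_zero]
    rfl

theorem coneD_leibniz {m r : ℤ} {A₁ A₂ : 𝒜.Obj} {x : Fin N → X.obj A₁}
    (hx : ∀ i : Fin N, x i ∈ (X.obj A₁).deg (r - (m + i))) (f : 𝒜.Hom A₂ A₁) (i : Fin N) :
    X.coneD m A₂ (fun i => X.act (x i) f) i =
      X.act (X.coneD m A₁ x i) f + ((q ^ r : kˣ) : k) • X.act (x i) ((𝒜.Hom A₂ A₁).d f) := by
  have h : shiftUp k N (X.obj A₂) (fun i => X.act (x i) f) i =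
      X.act (shiftUp k N (X.obj A₁) x i) f := by
    rcases Nat.eq_zero_or_pos i.1 with hi | hi
    · rw [shiftUp_of_eq_zero _ hi, shiftUp_of_eq_zero _ hi, map_zero, LinearMap.zero_apply]
    · rw [shiftUp_of_pos _ hi, shiftUp_of_pos _ hi]
  rw [coneD_apply, coneD_apply, h, X.leibniz _ _ _ (hx i), smul_add, smul_smul, ← Units.val_mul,
    ← zpow_add, show m + i + (r - (m + i)) = r by ring, map_add, map_smul, LinearMap.add_apply,
    LinearMap.smul_apply, add_assoc]

/-- The analogue of the cone of the identity: `N` copies of `X`, the `i`-th of which is translated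
by `m + i`, with a differential that combines the differential of `X` with the map from each copy to
the next one. Up to translation it is both the free and the cofree `NDG` module on the graded module
of `X`; the differential of `X` only serves to describe it in convenient coordinates. -/
noncomputable def cone (hq : IsPrimitiveRootOfOne q N) (X : NDGRightModule.{w₀, w₁, u, w} 𝒜)
    (m : ℤ) : NDGRightModule.{w₀, w₁, u, w} 𝒜 where
  toGrRightModule := GrRightModule.pi (fun _ : Fin N => X.toGrRightModule) fun i => m + i
  d A := X.coneD m A
  d_mem _ _ _ hx i _ := coneD_mem (fun i => hx i trivial) i
  d_pow A := coneD_pow hq m A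
  leibniz _ _ f hx := funext fun i => coneD_leibniz (fun i => hx i trivial) f i

/-- The coordinates of an element of the cone. -/
noncomputable def coneπ (hq : IsPrimitiveRootOfOne q N) (X : NDGRightModule.{w₀, w₁, u, w} 𝒜)
    (m : ℤ) (i : Fin N) : Fam (X.cone hq m).toGrRightModule X.toGrRightModule :=
  fun A => (LinearMap.proj i : (Fin N → X.obj A) →ₗ[k] X.obj A)

/-- The element of the cone with given coordinates. -/
noncomputable def coneMk (hq : IsPrimitiveRootOfOne q N) (X : NDGRightModule.{w₀, w₁, u, w} 𝒜)
    (m : ℤ) (A : 𝒜.Obj) : (Fin N → X.obj A) →ₗ[k] (X.cone hq m).obj A :=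
  (LinearMap.id : (Fin N → X.obj A) →ₗ[k] (Fin N → X.obj A))

@[simp]
theorem coneπ_coneMk (m : ℤ) (i : Fin N) (A : 𝒜.Obj) (x : Fin N → X.obj A) :
    coneπ hq X m i A (coneMk hq X m A x) = x i := rfl

theorem cone_ext {m : ℤ} {A : 𝒜.Obj} {x y : (X.cone hq m).obj A}
    (h : ∀ i, coneπ hq X m i A x = coneπ hq X m i A y) : x = y := funext h

theorem mem_cone_deg {m j : ℤ} {A : 𝒜.Obj} {x : (X.cone hq m).obj A} :
    x ∈ ((X.cone hq m).obj A).deg j ↔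
      ∀ i : Fin N, coneπ hq X m i A x ∈ (X.obj A).deg (j - (m + i)) :=
  ⟨fun h i => h i trivial, fun h i _ => h i⟩

theorem coneπ_mem (m : ℤ) (i : Fin N) {n : ℤ} (hn : n = -(m + i)) :
    coneπ hq X m i ∈ grHom (X.cone hq m).toGrRightModule X.toGrRightModule n := by
  refine ⟨fun A j l hl x hx => ?_, fun _ _ _ _ => rfl⟩
  have := (mem_cone_deg hq).1 hx i
  rwa [show j - (m + i) = l by omega] at this

theorem coneπ_act (m : ℤ) (i : Fin N) {A₁ A₂ : 𝒜.Obj} (x : (X.cone hq m).obj A₁)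
    (f : 𝒜.Hom A₂ A₁) : coneπ hq X m i A₂ ((X.cone hq m).act x f) =
      X.act (coneπ hq X m i A₁ x) f := rfl

theorem coneπ_d (m : ℤ) (i : Fin N) (A : 𝒜.Obj) (x : (X.cone hq m).obj A) :
    coneπ hq X m i A ((X.cone hq m).d A x) =
      shiftUp k N (X.obj A) (fun i => coneπ hq X m i A x) i +
        ((q ^ (m + i) : kˣ) : k) • X.d A (coneπ hq X m i A x) := rfl

/-- The inclusion of the `i`-th copy of `X` into the cone. -/
noncomputable def coneι (hq : IsPrimitiveRootOfOne q N) (X : NDGRightModule.{w₀, w₁, u, w} 𝒜)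
    (m : ℤ) (i : Fin N) : Fam X.toGrRightModule (X.cone hq m).toGrRightModule :=
  fun A => coneMk hq X m A ∘ₗ LinearMap.single k (fun _ : Fin N => (X.obj A : Type w)) i

theorem coneι_apply (m : ℤ) (i : Fin N) (A : 𝒜.Obj) (x : X.obj A) :
    coneι hq X m i A x = coneMk hq X m A (Pi.single i x) := rfl

theorem coneι_mem (m : ℤ) (i : Fin N) {n : ℤ} (hn : n = m + i) :
    coneι hq X m i ∈ grHom X.toGrRightModule (X.cone hq m).toGrRightModule n := by
  refine ⟨fun A j l hl x hx => (mem_cone_deg hq).2 fun i' => ?_, fun A₁ A₂ x f =>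
    cone_ext hq fun i' => ?_⟩
  · rw [coneι_apply, coneπ_coneMk]
    by_cases h : i' = i
    · subst h
      rwa [Pi.single_eq_same, show l - (m + i') = j by omega]
    · rw [Pi.single_eq_of_ne h]
      exact zero_mem _
  · rw [coneπ_act, coneι_apply, coneι_apply, coneπ_coneMk, coneπ_coneMk]
    by_cases h : i' = i
    · subst h
      rw [Pi.single_eq_same, Pi.single_eq_same]
    · rw [Pi.single_eq_of_ne h, Pi.single_eq_of_ne h, map_zero, LinearMap.zero_apply]

theorem cone_d_coneι (m : ℤ) (i : Fin N) (A : 𝒜.Obj) (x : X.obj A) :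
    (X.cone hq m).d A (coneι hq X m i A x) =
      coneMk hq X m A (shiftUp k N (X.obj A) (Pi.single i x)) +
        ((q ^ (m + i) : kˣ) : k) • coneι hq X m i A (X.d A x) := by
  refine cone_ext hq fun j => ?_
  rw [coneπ_d, map_add, map_smul, coneι_apply, coneι_apply]
  simp only [coneπ_coneMk]
  congr 1
  by_cases h : j = i
  · subst h
    rw [Pi.single_eq_same, Pi.single_eq_same]
  · rw [Pi.single_eq_of_ne h, Pi.single_eq_of_ne h, map_zero, smul_zero, smul_zero]

theorem cone_d_coneι_succ (m : ℤ) (i j : Fin N) (h : i.1 + 1 = j.1) (A : 𝒜.Obj) (x : X.obj A) :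
    (X.cone hq m).d A (coneι hq X m i A x) = coneι hq X m j A x +
      ((q ^ (m + i) : kˣ) : k) • coneι hq X m i A (X.d A x) := by
  rw [cone_d_coneι, shiftUp_single i j h, coneι_apply hq m j]

/-- The morphism out of the cone extending a graded morphism on the zeroth copy. -/
noncomputable def coneDesc (hq : IsPrimitiveRootOfOne q N) {m : ℤ}
    (G : Fam X.toGrRightModule Y.toGrRightModule)
    (hG : G ∈ grHom X.toGrRightModule Y.toGrRightModule m) : X.cone hq m ⟶ Y :=
  homMk ⟨∑ i : Fin N, fun A => homDPow X Y i m G A ∘ₗ coneπ hq X m i A,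
    sum_mem fun i _ => grHom_comp (by ring) (coneπ_mem hq m i rfl) (homDPow_mem i rfl hG)⟩
    fun A x => by
    dsimp only
    rw [Finset.sum_apply, LinearMap.sum_apply, LinearMap.sum_apply, map_sum]
    simp only [LinearMap.comp_apply, coneπ_d, map_add, map_smul]
    rw [Finset.sum_add_distrib, sum_shiftUp (fun i => homDPow X Y i m G A)
      (congrFun (homDPow_eq_zero hq m G) A), ← Finset.sum_add_distrib]
    refine Finset.sum_congr rfl fun i _ => ?_
    rw [homDPow_succ' i m _ rfl, homD_apply, sub_add_cancel]

theorem coneDesc_coneι {m : ℤ} (G : Fam X.toGrRightModule Y.toGrRightModule)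
    (hG : G ∈ grHom X.toGrRightModule Y.toGrRightModule m) (i : Fin N) (A : 𝒜.Obj) (x : X.obj A) :
    (coneDesc hq G hG).1 A (coneι hq X m i A x) = homDPow X Y i m G A x := by
  change (∑ i : Fin N, fun A => homDPow X Y i m G A ∘ₗ coneπ hq X m i A) A _ = _
  rw [Finset.sum_apply, LinearMap.sum_apply, Finset.sum_eq_single i]
  · rw [LinearMap.comp_apply, coneι_apply, coneπ_coneMk, Pi.single_eq_same]
  · intro j _ hj
    rw [LinearMap.comp_apply, coneι_apply, coneπ_coneMk, Pi.single_eq_of_ne hj, map_zero]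
  · simp

/-- A morphism out of the cone is determined by its restriction to the zeroth copy, since its
restriction to the `i`-th copy is the `i`-fold differential of that one. -/
theorem hom_coneι [NeZero N] {m : ℤ} (F : X.cone hq m ⟶ Y) (i : Fin N) :
    (fun A => F.1 A ∘ₗ coneι hq X m i A) =
      homDPow X Y i m fun A => F.1 A ∘ₗ coneι hq X m 0 A := by
  obtain ⟨i, hi⟩ := i
  induction i with
  | zero => rfl
  | succ i ih =>
    rw [homDPow_succ' i m _ rfl, ← ih (by omega)]
    funext A
    refine LinearMap.ext fun x => ?_
    rw [homD_apply, LinearMap.comp_apply, LinearMap.comp_apply, LinearMap.comp_apply, ← hom_d,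
      cone_d_coneι_succ hq m ⟨i, by omega⟩ ⟨i + 1, hi⟩ rfl, map_add, map_smul,
      add_sub_cancel_right]

theorem cone_hom_ext [NeZero N] {m : ℤ} {F G : X.cone hq m ⟶ Y}
    (h : ∀ A x, F.1 A (coneι hq X m 0 A x) = G.1 A (coneι hq X m 0 A x)) : F = G := by
  have h' : (fun A => F.1 A ∘ₗ coneι hq X m 0 A) = fun A => G.1 A ∘ₗ coneι hq X m 0 A :=
    funext fun A => LinearMap.ext (h A)
  refine Subtype.ext (funext fun A => LinearMap.pi_ext' fun i => ?_)
  have := (hom_coneι hq F i).trans ((congrArg _ h').trans (hom_coneι hq G i).symm)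
  exact congrFun this A

/-- The coordinates of the morphism `X ⟶ Y.cone m` with last coordinate `H`, where
`c = m + N - 1`, in descending order. -/
def coneLiftAux (c : ℤ) (H : Fam X.toGrRightModule Y.toGrRightModule) :
    ℕ → Fam X.toGrRightModule Y.toGrRightModule
  | 0 => H
  | j + 1 => -((q ^ (c - j) : kˣ) : k) • homD X Y (j - c) (coneLiftAux c H j)

theorem coneLiftAux_mem {c : ℤ} {H : Fam X.toGrRightModule Y.toGrRightModule}
    (hH : H ∈ grHom X.toGrRightModule Y.toGrRightModule (-c)) :
    ∀ (j : ℕ) {n : ℤ}, n = j - c →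
      coneLiftAux c H j ∈ grHom X.toGrRightModule Y.toGrRightModule n
  | 0, n, h => by
    obtain rfl : n = -c := by simpa using h
    exact hH
  | j + 1, n, h => Submodule.smul_mem _ _ (homD_mem (by push_cast at h; omega)
      (coneLiftAux_mem hH j rfl))

theorem exists_coneLiftAux_eq (c : ℤ) (H : Fam X.toGrRightModule Y.toGrRightModule) :
    ∀ j : ℕ, ∃ a : k, coneLiftAux c H j = a • homDPow X Y j (-c) H
  | 0 => ⟨1, (one_smul _ _).symm⟩
  | j + 1 => by
    obtain ⟨a, ha⟩ := exists_coneLiftAux_eq c H j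
    refine ⟨-((q ^ (c - j) : kˣ) : k) * a, ?_⟩
    rw [coneLiftAux, ha, map_smul, homDPow_succ' j (-c) (j - c) (by ring), mul_smul]

theorem coneLiftAux_eq_zero (hq : IsPrimitiveRootOfOne q N) (c : ℤ)
    (H : Fam X.toGrRightModule Y.toGrRightModule) : coneLiftAux c H N = 0 := by
  obtain ⟨a, ha⟩ := exists_coneLiftAux_eq c H N
  rw [ha, homDPow_eq_zero hq, smul_zero]

/-- The morphism into the cone with a given last coordinate. -/
noncomputable def coneLift (hq : IsPrimitiveRootOfOne q N) {m c : ℤ} (hc : c = m + N - 1)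
    (H : Fam X.toGrRightModule Y.toGrRightModule)
    (hH : H ∈ grHom X.toGrRightModule Y.toGrRightModule (-c)) : X ⟶ Y.cone hq m :=
  homMk ⟨fun A => coneMk hq Y m A ∘ₗ
      LinearMap.pi fun i : Fin N => coneLiftAux c H (N - (i + 1)) A, by
    refine ⟨fun A j l hl x hx => (mem_cone_deg hq).2 fun i => ?_, fun A₁ A₂ x f =>
      cone_ext hq fun i => ?_⟩
    · exact (coneLiftAux_mem hH (N - (i + 1)) rfl).1 A _ _ (by omega) x hx
    · exact (coneLiftAux_mem hH (N - (i + 1)) rfl).2 A₁ A₂ x f⟩ fun A x => by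
    refine cone_ext hq fun i => ?_
    rw [coneπ_d]
    simp only [LinearMap.comp_apply, coneπ_coneMk, LinearMap.pi_apply]
    have h : shiftUp k N (Y.obj A) (fun i : Fin N => coneLiftAux c H (N - (i + 1)) A x) i =
        coneLiftAux c H (N - (i + 1) + 1) A x := by
      rcases Nat.eq_zero_or_pos i.1 with hi | hi
      · rw [shiftUp_of_eq_zero _ hi, show N - (i.1 + 1) + 1 = N by omega,
          coneLiftAux_eq_zero hq]
        rfl
      · rw [shiftUp_of_pos _ hi]
        dsimp only
        rw [show N - (i.1 - 1 + 1) = N - (i.1 + 1) + 1 by omega]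
    have h' : coneLiftAux c H (N - (i + 1) + 1) A x =
        -((q ^ (m + i) : kˣ) : k) • (Y.d A (coneLiftAux c H (N - (i + 1)) A x) -
          ((q ^ (-(m + i) : ℤ) : kˣ) : k) • coneLiftAux c H (N - (i + 1)) A (X.d A x)) := by
      rw [show m + i = c - ((N - (i.1 + 1) : ℕ) : ℤ) by omega, neg_sub]
      rfl
    rw [h, h', smul_sub, smul_smul, neg_mul, ← Units.val_mul, ← zpow_add, add_neg_cancel, zpow_zero,
      Units.val_one, neg_smul, neg_smul, one_smul]
    abel

theorem coneLift_last {m c : ℤ} (hc : c = m + N - 1)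
    (H : Fam X.toGrRightModule Y.toGrRightModule)
    (hH : H ∈ grHom X.toGrRightModule Y.toGrRightModule (-c)) (A : 𝒜.Obj) (x : X.obj A)
    (i : Fin N) (hi : i.1 + 1 = N) :
    coneπ hq Y m i A ((coneLift hq hc H hH).1 A x) = H A x := by
  change coneLiftAux c H (N - (i + 1)) A x = _
  rw [hi, Nat.sub_self]
  rfl

/-- A morphism into the cone is determined by its last coordinate. -/
theorem hom_cone_ext {m : ℤ} {F G : X ⟶ Y.cone hq m}
    (h : ∀ A x (i : Fin N), i.1 + 1 = N →
      coneπ hq Y m i A (F.1 A x) = coneπ hq Y m i A (G.1 A x)) : F = G := by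
  have key : ∀ (j : ℕ) (i : Fin N), i.1 + j + 1 = N → ∀ A x,
      coneπ hq Y m i A (F.1 A x) = coneπ hq Y m i A (G.1 A x) := fun j => by
    induction j with
    | zero => exact fun i hi A x => h A x i hi
    | succ j ih =>
      intro i hi A x
      have hs : ∀ F : X ⟶ Y.cone hq m, coneπ hq Y m i A (F.1 A x) =
          coneπ hq Y m ⟨i + 1, by omega⟩ A (F.1 A (X.d A x)) -
            ((q ^ (m + (i + 1 : ℕ)) : kˣ) : k) •
              Y.d A (coneπ hq Y m ⟨i + 1, by omega⟩ A (F.1 A x)) := fun F => by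
        rw [hom_d, coneπ_d, shiftUp_of_pos _ (Nat.succ_pos _), add_sub_cancel_right]
        rfl
      rw [hs F, hs G, ih _ (by dsimp only; omega), ih _ (by dsimp only; omega)]
  exact Subtype.ext (funext fun A => LinearMap.ext fun x => cone_ext hq fun i =>
    key (N - (i + 1)) i (by omega) A x)

end NDGRightModule

end Cofree

/-! ### The Frobenius structure and its stable category -/

section Frobenius

variable {k : Type w₀} [CommRing k] {N : ℕ} {q : kˣ} {𝒜 : NqDGCat.{w₀, w₁, u} k N q}

namespace NDGRightModule

variable {X Y : NDGRightModule.{w₀, w₁, u, w} 𝒜} (hq : IsPrimitiveRootOfOne q N)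

/-- Morphisms out of a cone are the graded morphisms on the zeroth copy, and these lift along
deflations. -/
theorem isProj_cone [NeZero N] (X : NDGRightModule.{w₀, w₁, u, w} 𝒜) (m : ℤ) :
    IsProj (degreewiseSplit 𝒜) (X.cone hq m) := by
  intro Y Z g hg f
  obtain ⟨s, hs⟩ := (isDeflation_iff g).1 hg
  refine ⟨coneDesc hq (m := m) (fun A => s.1 A ∘ₗ f.1 A ∘ₗ coneι hq X m 0 A)
    (grHom_comp (add_zero m) (grHom_comp (add_zero m) (coneι_mem hq m 0 (by simp)) f.2.1) s.2),
    cone_hom_ext hq fun A x => ?_⟩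
  have := coneDesc_coneι hq (m := m) (fun A => s.1 A ∘ₗ f.1 A ∘ₗ coneι hq X m 0 A)
    (grHom_comp (add_zero m) (grHom_comp (add_zero m) (coneι_mem hq m 0 (by simp)) f.2.1) s.2) 0 A x
  exact (congrArg (g.1 A) this).trans
    (congrArg (fun F : Z.toGrRightModule ⟶ Z.toGrRightModule => F.1 A _) hs)

/-- Morphisms into a cone are the graded morphisms to the last copy, and these extend along
inflations. -/
theorem isInj_cone [NeZero N] (Y : NDGRightModule.{w₀, w₁, u, w} 𝒜) (m : ℤ) :
    IsInj (degreewiseSplit 𝒜) (Y.cone hq m) := by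
  intro X X' f hf h
  obtain ⟨r, hr⟩ := (isInflation_iff f).1 hf
  have hN : N ≠ 0 := NeZero.ne N
  let l : Fin N := ⟨N - 1, by omega⟩
  have hH : (fun A => coneπ hq Y m l A ∘ₗ h.1 A ∘ₗ r.1 A) ∈
      grHom X'.toGrRightModule Y.toGrRightModule (-(m + N - 1)) :=
    grHom_comp (zero_add _) (grHom_comp (add_zero 0) r.2 h.2.1)
      (coneπ_mem hq m l (by simp only [l]; omega))
  refine ⟨coneLift hq rfl _ hH, hom_cone_ext hq fun A x i hi => ?_⟩
  obtain rfl : i = l := Fin.ext (by simp only [l]; omega)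
  refine (coneLift_last hq rfl _ hH A (f.1 A x) l hi).trans ?_
  change coneπ hq Y m l A (h.1 A (r.1 A (f.1 A x))) = _
  rw [show r.1 A (f.1 A x) = x from
    congrArg (fun F : X.toGrRightModule ⟶ X.toGrRightModule => F.1 A x) hr]

/-- The inclusion of `X` into its cone as the last copy. -/
noncomputable def toCone (hq : IsPrimitiveRootOfOne q N) [NeZero N]
    (X : NDGRightModule.{w₀, w₁, u, w} 𝒜) : X ⟶ X.cone hq (1 - N) :=
  homMk ⟨coneι hq X (1 - N) (Fin.rev 0), coneι_mem hq _ _ (by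
    have := NeZero.ne N
    simp only [Fin.val_rev, Fin.val_zero]
    omega)⟩ fun A x => by
  have hN := NeZero.ne N
  have h : shiftUp k N (X.obj A) (Pi.single (Fin.rev 0) x) = 0 := funext fun j => by
    rcases Nat.eq_zero_or_pos j.1 with hj | hj
    · exact shiftUp_of_eq_zero _ hj
    · rw [shiftUp_of_pos _ hj, Pi.single_eq_of_ne]
      · rfl
      · simp only [ne_eq, Fin.ext_iff, Fin.val_rev, Fin.val_zero]
        omega
  have h0 : (1 - N : ℤ) + (Fin.rev (0 : Fin N) : ℕ) = 0 := by
    simp only [Fin.val_rev, Fin.val_zero]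
    omega
  dsimp only
  rw [cone_d_coneι, h, h0, map_zero, zero_add, zpow_zero, Units.val_one, one_smul]

theorem inflation_toCone [NeZero N] (X : NDGRightModule.{w₀, w₁, u, w} 𝒜) :
    IsInflation (degreewiseSplit 𝒜) (X.toCone hq) := by
  refine (isInflation_iff _).2 ⟨⟨coneπ hq X (1 - N) (Fin.rev 0), coneπ_mem hq _ _ ?_⟩,
    Subtype.ext (funext fun A => LinearMap.ext fun x => ?_)⟩
  · have := NeZero.ne N
    simp only [Fin.val_rev, Fin.val_zero]
    omega
  · exact Pi.single_eq_same (M := fun _ : Fin N => X.obj A) (Fin.rev 0) x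

/-- The identity of `X` induces a deflation from a cone onto `X`. -/
theorem exists_deflation_cone [NeZero N] (X : NDGRightModule.{w₀, w₁, u, w} 𝒜) :
    ∃ p : X.cone hq 0 ⟶ X, IsDeflation (degreewiseSplit 𝒜) p :=
  ⟨coneDesc hq _ (grHom_id _), (isDeflation_iff _).2
    ⟨⟨coneι hq X 0 0, coneι_mem hq 0 0 (by simp)⟩, Subtype.ext (funext fun A =>
      LinearMap.ext fun x => coneDesc_coneι hq _ (grHom_id X.toGrRightModule) 0 A x)⟩⟩

theorem isProj_of_retract {P : NDGRightModule.{w₀, w₁, u, w} 𝒜}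
    (hP : IsProj (degreewiseSplit 𝒜) P) (i : X ⟶ P) (p : P ⟶ X) (h : i ≫ p = 𝟙 X) :
    IsProj (degreewiseSplit 𝒜) X := fun g hg f => by
  obtain ⟨f', hf'⟩ := hP g hg (p ≫ f)
  exact ⟨i ≫ f', by rw [Category.assoc, hf', reassoc_of% h]⟩

theorem isInj_of_retract {P : NDGRightModule.{w₀, w₁, u, w} 𝒜}
    (hP : IsInj (degreewiseSplit 𝒜) P) (i : X ⟶ P) (p : P ⟶ X) (h : i ≫ p = 𝟙 X) :
    IsInj (degreewiseSplit 𝒜) X := fun f hf g => by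
  obtain ⟨g', hg'⟩ := hP f hf (g ≫ i)
  exact ⟨g' ≫ p, by rw [reassoc_of% hg', h, Category.comp_id]⟩

variable (𝒜) in
theorem isFrobenius (hq : IsPrimitiveRootOfOne q N) [NeZero N] :
    IsFrobenius (degreewiseSplit.{w₀, w₁, u, w} 𝒜) where
  exact := isExactCategory 𝒜
  enough_proj X := by
    obtain ⟨p, hp⟩ := exists_deflation_cone hq X
    exact ⟨_, p, isProj_cone hq X 0, hp⟩
  enough_inj X := ⟨_, X.toCone hq, isInj_cone hq X _, inflation_toCone hq X⟩
  proj_iff_inj X := by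
    constructor
    · intro h
      obtain ⟨p, hp⟩ := exists_deflation_cone hq X
      obtain ⟨i, hi⟩ := h p hp (𝟙 X)
      exact isInj_of_retract (isInj_cone hq X 0) i p hi
    · intro h
      obtain ⟨p, hp⟩ := h _ (inflation_toCone hq X) (𝟙 X)
      exact isProj_of_retract (isProj_cone hq X _) _ p hp

/-- A morphism that factors through the inclusion into the cone is an `(N - 1)`-fold
differential. -/
theorem toCone_comp [NeZero N] (F : X.cone hq (1 - N) ⟶ Y) : (X.toCone hq ≫ F).1 =
    homDPow X Y (N - 1) (1 - N) fun A => F.1 A ∘ₗ coneι hq X (1 - N) 0 A := by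
  have := hom_coneι hq F (Fin.rev 0)
  rwa [Fin.val_rev, Fin.val_zero] at this

/-- A morphism is null-homotopic if and only if it factors through a projective object. -/
theorem mem_homB_iff (hq : IsPrimitiveRootOfOne q N) [NeZero N] (f : X ⟶ Y) :
    f.1 ∈ homB X Y (N - 1) 0 ↔
    ∃ (P : NDGRightModule.{w₀, w₁, u, w} 𝒜) (a : X ⟶ P) (b : P ⟶ Y),
      IsProj (degreewiseSplit 𝒜) P ∧ f = a ≫ b := by
  have hN := NeZero.ne N
  have hdeg : (0 : ℤ) - (N - 1 : ℕ) = 1 - N := by omega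
  rw [homB, hdeg]
  constructor
  · rintro ⟨G, hG, hf⟩
    refine ⟨_, X.toCone hq, coneDesc hq G hG, isProj_cone hq X _, Subtype.ext ?_⟩
    rw [toCone_comp, ← hf]
    congr 1
    exact (funext fun A => LinearMap.ext fun x => coneDesc_coneι hq G hG 0 A x).symm
  · rintro ⟨P, a, b, hP, rfl⟩
    have hP' : IsInj (degreewiseSplit 𝒜) P := ((isFrobenius 𝒜 hq).proj_iff_inj P).1 hP
    obtain ⟨a', rfl⟩ := hP' _ (inflation_toCone hq X) a
    refine ⟨fun A => (a' ≫ b).1 A ∘ₗ coneι hq X (1 - N) 0 A,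
      grHom_comp (add_zero _) (coneι_mem hq _ 0 (by simp)) (a' ≫ b).2.1, ?_⟩
    rw [Category.assoc, toCone_comp]

theorem homotopyProj_map_eq_zero_iff {f : X ⟶ Y} :
    (homotopyProj 𝒜).map f = 0 ↔ f.1 ∈ homB X Y (N - 1) 0 :=
  Submodule.Quotient.mk_eq_zero _

variable (𝒜) in
theorem presentsStable (hq : IsPrimitiveRootOfOne q N) [NeZero N] :
    PresentsStable (degreewiseSplit 𝒜) (homotopyProj.{w₀, w₁, u, w} 𝒜) where
  additive := ⟨rfl⟩
  full := ⟨by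
    rintro X Y ⟨F⟩
    exact ⟨⟨F.1, mem_homZ_iff.1 F.2⟩, rfl⟩⟩
  essSurj := ⟨fun Y => ⟨Y.as, ⟨Iso.refl _⟩⟩⟩
  map_eq_zero_iff f := homotopyProj_map_eq_zero_iff.trans (mem_homB_iff hq f)

end NDGRightModule

section Stable

universe v v' u₁ u₂

variable {C : Type u₁} [Category.{v} C] [Preadditive C] {E : ObjectProperty (ShortComplex C)}
  {T : Type u₂} [Category.{v'} T] [Preadditive T] {π : C ⥤ T}

/-- A functor which presents the stable category and is bijective on objects identifies its target
with the quotient category. -/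
theorem PresentsStable.exists_stableCategory_functor (hπ : PresentsStable E π)
    (h_obj : Function.Bijective π.obj) :
    ∃ Φ : StableCategory E ⥤ T, stableProj E ⋙ Φ = π ∧ Φ.Full ∧ Φ.Faithful ∧
      Function.Bijective Φ.obj := by
  have := hπ.additive
  have := hπ.full
  have h : ∀ (X Y : C) (f g : X ⟶ Y), stableRel E f g ↔ π.map f = π.map g := fun X Y f g => by
    rw [← sub_eq_zero, ← π.map_sub]
    exact (hπ.map_eq_zero_iff _).symm
  refine ⟨CategoryTheory.Quotient.lift _ π fun X Y f g hfg => (h X Y f g).1 hfg,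
    CategoryTheory.Quotient.lift_spec _ _ _, ⟨?_⟩, ⟨?_⟩, ?_⟩
  · intro X Y f
    obtain ⟨g, hg⟩ := π.map_surjective f
    exact ⟨(stableProj E).map g, hg⟩
  · rintro ⟨X⟩ ⟨Y⟩ f g hfg
    obtain ⟨f, rfl⟩ := (stableProj E).map_surjective f
    obtain ⟨g, rfl⟩ := (stableProj E).map_surjective g
    exact CategoryTheory.Quotient.sound _ ((h X Y f g).2 hfg)
  · refine ⟨fun X Y hXY => ?_, fun Y => ?_⟩
    · cases X
      cases Y
      exact congrArg _ (h_obj.1 hXY)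
    · obtain ⟨X, hX⟩ := h_obj.2 Y
      exact ⟨⟨X⟩, hX⟩

end Stable

end Frobenius

end NDG

theorem mainTheorem4 {k : Type w₀} [CommRing k] (N : ℕ) (hN : 2 ≤ N) (q : kˣ)
    (hq : NDG.IsPrimitiveRootOfOne q N) (𝒜 : NDG.NqDGCat.{w₀, w₁, u} k N q) :
    NDG.IsFrobenius (NDG.degreewiseSplit.{w₀, w₁, u, w} 𝒜) ∧
    (∃ Φ : NDG.StableCategory (NDG.degreewiseSplit.{w₀, w₁, u, w} 𝒜) ⥤ NDG.KNdg.{w₀, w₁, u, w} 𝒜,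
      NDG.stableProj (NDG.degreewiseSplit 𝒜) ⋙ Φ = NDG.homotopyProj 𝒜 ∧
      Φ.Full ∧ Φ.Faithful ∧ Function.Bijective Φ.obj) ∧
    (∃ (_ : HasZeroObject (NDG.KNdg.{w₀, w₁, u, w} 𝒜))
      (_ : HasShift (NDG.KNdg.{w₀, w₁, u, w} 𝒜) ℤ)
      (_ : ∀ n : ℤ, (shiftFunctor (NDG.KNdg.{w₀, w₁, u, w} 𝒜) n).Additive)
      (_ : Pretriangulated (NDG.KNdg.{w₀, w₁, u, w} 𝒜)),
      IsTriangulated (NDG.KNdg.{w₀, w₁, u, w} 𝒜) ∧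
      NDG.IsStableTriangulation (NDG.degreewiseSplit 𝒜) (NDG.homotopyProj 𝒜)) := by
  have : NeZero N := ⟨by omega⟩
  have hE := NDG.NDGRightModule.isFrobenius.{w₀, w₁, u, w} 𝒜 hq
  have hπ := NDG.NDGRightModule.presentsStable.{w₀, w₁, u, w} 𝒜 hq
  refine ⟨hE, hπ.exists_stableCategory_functor
    ⟨fun X Y h => congrArg NDG.KNdg.as h, fun Y => ⟨Y.as, rfl⟩⟩, ?_⟩
  exact NDG.exists_isStableTriangulation hE hπ
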